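/- Consider in $\mathbb R^2$, for $t\ge 0$, the system of rotational gas dynamics \[ \partial_t(\varrho \mathbf u)+\operatorname{div}(\varrho\,\mathbf u\otimes\mathbf u)+\varrho\, l\,\mathcal L\mathbf u+\nabla p=0,\quad \partial_t\varrho+\operatorname{div}(\varrho\mathbf u)=0,\quad \partial_t S+\mathbf u\cdot\nabla S=0,\quad p=e^{S}\varrho^{\gamma}, \] with $\mathcal L\mathbf u=(-u_2,u_1)$, a constant $l\ge 0$ and $\gamma>2$, and initial data $(\mathbf u,\varrho,p)|_{t=0}=(\mathbf u_0,\varrho_0,p_0)\in C^1(\mathbb R^2)$ with $\varrho_0,p_0>0$ and $(\mathbf u_0,\varrho_0,p_0)=(\mathbf 0,\bar\varrho,\bar p)$ for $|\mathbf x|\ge R$, where $R,\bar\varrho,\bar p>0$ are constants. A classical solution on $[0,T)$ is a quadruple $(\mathbf u,\varrho,p,S)\in C^1([0,T)\times\mathbb R^2)$, $T>0$, with $\varrho>0$ that satisfies the system and the initial conditions. Put $\bar S=\ln(\bar p\bar\varrho^{-\gamma})$, $S_0=\ln(p_0\varrho_0^{-\gamma})$, $\sigma=\sqrt{\gamma e^{\bar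 S}\bar\varrho^{\gamma-1}}$ (the sound speed of the constant state) and $r(t)=R+\sigma t$. For a solution let $G(t)=\frac12\int_{|\mathbf x|<r(t)}|\mathbf x|^2\varrho\,d\mathbf x$. From the initial data form, with all integrals over $|\mathbf x|<R$ and $\mathbf x_\perp=(x_2,-x_1)$, \[ G(0)=\tfrac12\!\int|\mathbf x|^2\varrho_0,\quad F_1(0)=\int\varrho_0\mathbf u_0\cdot\mathbf x,\quad F_2(0)=\int\varrho_0\mathbf u_0\cdot\mathbf x_\perp,\quad m(0)=\int(\varrho_0-\bar\varrho), \] \[ e(0)=\tfrac12\int\varrho_0|\mathbf u_0|^2+\tfrac1{\gamma-1}\int(p_0-\bar p),\quad \mathbf P(0)=\int\varrho_0\mathbf x,\quad \mathbf I(0)=\int\varrho_0\mathbf u_0, \quad G'(0)=F_1(0)+\pi\bar\varrho\sigma R^3, \] and define \[ I_1(t)=I_1(0)\cos lt+I_2(0)\sin lt,\quad I_2(t)=I_2(0)\cos lt-I_1(0)\sin lt,\quad P_i(t)=P_i(0)+\int_0^tI_i(\tau)\,d\tau, \] \[ \phi_-(t)=\frac{P_1(t)^2+P_2(t)^2}{2\,(m(0)+\pi\bar\varrho\,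 r(t)^2)},\qquad \phi_+(t)=\frac{r(t)^2}{2}\bigl(m(0)+\pi\bar\varrho\, r(t)^2\bigr), \] \[ q(t)=\frac{l^2\pi\bar\varrho}{4}\bigl(r(t)^4-R^4\bigr)+3\pi\bar\varrho\sigma^2r(t)^2, \] \[ A_0=2(\gamma-1)e(0)+l^2G(0)-lF_2(0),\qquad A_1=2e(0)+l^2G(0)-lF_2(0)+\frac{2(\gamma-2)}{\gamma-1}\sigma^2m(0), \] \[ f_+(t)=\int_0^t\!\!\int_0^\tau q(\lambda)\,d\lambda\,d\tau+\frac{A_0}{2}t^2+G'(0)t+G(0), \] \[ f_-(t)=\int_0^t\!\!\int_0^\tau\bigl(q(\lambda)-l^2\phi_+(\lambda)\bigr)\,d\lambda\,d\tau+\frac{A_1}{2}t^2+G'(0)t+G(0). \] **Theorem.** Let $\gamma>2$ and suppose that $S_0(\mathbf x)\ge\bar S$ for all $\mathbf x\in\mathbb R^2$. Then every classical solution on $[0,T)$ satisfies $f_-(t)\le G(t)\le f_+(t)$ for all $t\in[0,T)$. Moreover, if there is $T_*>0$ with $f_+(T_*)=\phi_-(T_*)$ or $f_-(T_*)=\phi_+(T_*)$,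 then the classical solution loses smoothness before $T_*$: every classical solution on $[0,T)$ has $T<T_*$. -/

import Mathlib

open MeasureTheory Set

noncomputable section

/-- The Euclidean plane. -/
abbrev Plane : Type := EuclideanSpace ℝ (Fin 2)

/-- The rotation `𝓛 v = (-v₂, v₁)`. -/
def rotL (v : Plane) : Plane := !₂[-(v 1), v 0]

/-- The vector `x_⊥ = (x₂, -x₁)`. -/
def perp (x : Plane) : Plane := !₂[x 1, -(x 0)]

/-- The partial derivative of `f` in the `j`-th coordinate direction. -/
def pd (j : Fin 2) (f : Plane → ℝ) (x : Plane) : ℝ :=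
  fderiv ℝ f x (EuclideanSpace.single j 1)

/-! Integral functionals of a state (density, velocity, pressure) over the disc `|x| < r`. -/

/-- The moment of inertia `½ ∫ |x|² ϱ`. -/
def momentG (r : ℝ) (ρ : Plane → ℝ) : ℝ :=
  (1 / 2) * ∫ x in Metric.ball (0 : Plane) r, ‖x‖ ^ 2 * ρ x

/-- The radial momentum `∫ ϱ u · x`. -/
def momentF₁ (r : ℝ) (ρ : Plane → ℝ) (u : Plane → Plane) : ℝ :=
  ∫ x in Metric.ball (0 : Plane) r, ρ x * inner ℝ (u x) x

/-- The angular momentum `∫ ϱ u · x_⊥`. -/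
def momentF₂ (r : ℝ) (ρ : Plane → ℝ) (u : Plane → Plane) : ℝ :=
  ∫ x in Metric.ball (0 : Plane) r, ρ x * inner ℝ (u x) (perp x)

/-- The kinetic energy `½ ∫ ϱ |u|²`. -/
def kineticEnergy (r : ℝ) (ρ : Plane → ℝ) (u : Plane → Plane) : ℝ :=
  (1 / 2) * ∫ x in Metric.ball (0 : Plane) r, ρ x * ‖u x‖ ^ 2

/-- The total energy excess `E_k + (γ - 1)⁻¹ ∫ (p - p̄)`. -/
def energyExcess (γ pbar r : ℝ) (ρ : Plane → ℝ) (u : Plane → Plane) (p : Plane → ℝ) : ℝ :=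
  kineticEnergy r ρ u + (1 / (γ - 1)) * ∫ x in Metric.ball (0 : Plane) r, (p x - pbar)

/-- The mass excess `∫ (ϱ - ϱ̄)`. -/
def massExcess (ρbar r : ℝ) (ρ : Plane → ℝ) : ℝ :=
  ∫ x in Metric.ball (0 : Plane) r, (ρ x - ρbar)

/-- The first moments of mass `∫ ϱ x_i`. -/
def massMoment (r : ℝ) (ρ : Plane → ℝ) (i : Fin 2) : ℝ :=
  ∫ x in Metric.ball (0 : Plane) r, ρ x * x i

/-- The linear momentum `∫ ϱ u_i`. -/
def momentum (r : ℝ) (ρ : Plane → ℝ) (u : Plane → Plane) (i : Fin 2) : ℝ :=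
  ∫ x in Metric.ball (0 : Plane) r, ρ x * u x i

/-- Parameters and Cauchy data of the problem: the heat ratio `γ > 1`, the Coriolis parameter
`l ≥ 0`, and `C¹` data `(u₀, ϱ₀, p₀)` with positive density and pressure which coincide with the
constant state `(0, ϱ̄, p̄)` outside the disc `|x| < R`. -/
structure CauchyData where
  γ : ℝ
  l : ℝ
  R : ℝ
  ρbar : ℝ
  pbar : ℝ
  u₀ : Plane → Plane
  ρ₀ : Plane → ℝ
  p₀ : Plane → ℝ
  one_lt_γ : 1 < γ
  l_nonneg : 0 ≤ l
  R_pos : 0 < R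
  ρbar_pos : 0 < ρbar
  pbar_pos : 0 < pbar
  contDiff_u₀ : ContDiff ℝ 1 u₀
  contDiff_ρ₀ : ContDiff ℝ 1 ρ₀
  contDiff_p₀ : ContDiff ℝ 1 p₀
  ρ₀_pos : ∀ x, 0 < ρ₀ x
  p₀_pos : ∀ x, 0 < p₀ x
  u₀_outside : ∀ x, x ∉ Metric.ball (0 : Plane) R → u₀ x = 0
  ρ₀_outside : ∀ x, x ∉ Metric.ball (0 : Plane) R → ρ₀ x = ρbar
  p₀_outside : ∀ x, x ∉ Metric.ball (0 : Plane) R → p₀ x = pbar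

namespace CauchyData

variable (D : CauchyData)

/-- The entropy of the constant state, `S̄ = ln (p̄ ϱ̄^(-γ))`. -/
def Sbar : ℝ := Real.log (D.pbar * D.ρbar ^ (-D.γ))

/-- The initial entropy, `S₀ = ln (p₀ ϱ₀^(-γ))`. -/
def S₀ (x : Plane) : ℝ := Real.log (D.p₀ x * D.ρ₀ x ^ (-D.γ))

/-- The sound speed in the constant state: the square root of `∂p/∂ϱ` at `ϱ = ϱ̄`, where
`p = exp(S̄) ϱ^γ`. -/
def σ : ℝ := Real.sqrt (D.γ * Real.exp D.Sbar * D.ρbar ^ (D.γ - 1))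

/-- The radius `R + σ t` of the disc that contains the perturbation at time `t`. -/
def radius (t : ℝ) : ℝ := D.R + D.σ * t

/-- `(u, ϱ, p, S)` is a classical (`C¹`) solution on `[0, T) × ℝ²` of the rotational gas dynamics
system with Cauchy data `D`. -/
structure IsClassicalSolution (T : ℝ) (u : ℝ → Plane → Plane) (ρ p S : ℝ → Plane → ℝ) :
    Prop where
  T_pos : 0 < T
  contDiffOn_u : ContDiffOn ℝ 1 (fun z : ℝ × Plane => u z.1 z.2) (Ico 0 T ×ˢ univ)
  contDiffOn_ρ : ContDiffOn ℝ 1 (fun z : ℝ × Plane => ρ z.1 z.2) (Ico 0 T ×ˢ univ)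
  contDiffOn_p : ContDiffOn ℝ 1 (fun z : ℝ × Plane => p z.1 z.2) (Ico 0 T ×ˢ univ)
  contDiffOn_S : ContDiffOn ℝ 1 (fun z : ℝ × Plane => S z.1 z.2) (Ico 0 T ×ˢ univ)
  ρ_pos : ∀ t ∈ Ico 0 T, ∀ x, 0 < ρ t x
  momentum_eq : ∀ t ∈ Ioo 0 T, ∀ x, ∀ i : Fin 2,
    deriv (fun s => ρ s x * u s x i) t
      + ∑ j : Fin 2, pd j (fun y => ρ t y * u t y i * u t y j) x
      + ρ t x * D.l * rotL (u t x) i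
      + pd i (p t) x = 0
  mass_eq : ∀ t ∈ Ioo 0 T, ∀ x,
    deriv (fun s => ρ s x) t + ∑ j : Fin 2, pd j (fun y => ρ t y * u t y j) x = 0
  entropy_eq : ∀ t ∈ Ioo 0 T, ∀ x,
    deriv (fun s => S s x) t + ∑ j : Fin 2, u t x j * pd j (S t) x = 0
  state_eq : ∀ t ∈ Ico 0 T, ∀ x, p t x = Real.exp (S t x) * ρ t x ^ D.γ
  initial_u : ∀ x, u 0 x = D.u₀ x
  initial_ρ : ∀ x, ρ 0 x = D.ρ₀ x
  initial_p : ∀ x, p 0 x = D.p₀ x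

/-- `G(t) = ½ ∫_{|x| < R + σ t} |x|² ϱ(t, x) dx` along a density field `ϱ`. -/
def G (ρ : ℝ → Plane → ℝ) (t : ℝ) : ℝ := momentG (D.radius t) (ρ t)

/-! Initial values of the functionals. -/

/-- `G(0)`. -/
def G0 : ℝ := momentG D.R D.ρ₀

/-- `F₁(0)`. -/
def F₁0 : ℝ := momentF₁ D.R D.ρ₀ D.u₀

/-- `F₂(0)`. -/
def F₂0 : ℝ := momentF₂ D.R D.ρ₀ D.u₀

/-- `e(0)`. -/
def e0 : ℝ := energyExcess D.γ D.pbar D.R D.ρ₀ D.u₀ D.p₀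

/-- `m(0)`. -/
def m0 : ℝ := massExcess D.ρbar D.R D.ρ₀

/-- `P(0)`. -/
def P0 (i : Fin 2) : ℝ := massMoment D.R D.ρ₀ i

/-- `I(0)`. -/
def I0 (i : Fin 2) : ℝ := momentum D.R D.ρ₀ D.u₀ i

/-- `G'(0)`, expressed through the data: `F₁(0)` plus the contribution `π ϱ̄ σ R³` of the moving
boundary. -/
def dG0 : ℝ := D.F₁0 + Real.pi * D.ρbar * D.σ * D.R ^ 3

/-- `I₁(t)`; the momentum obeys `I' = -l 𝓛 I`. -/
def I₁ (t : ℝ) : ℝ := D.I0 0 * Real.cos (D.l * t) + D.I0 1 * Real.sin (D.l * t)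

/-- `I₂(t)`. -/
def I₂ (t : ℝ) : ℝ := D.I0 1 * Real.cos (D.l * t) - D.I0 0 * Real.sin (D.l * t)

/-- `P₁(t) = P₁(0) + ∫₀ᵗ I₁`. -/
def P₁ (t : ℝ) : ℝ := D.P0 0 + ∫ s in (0 : ℝ)..t, D.I₁ s

/-- `P₂(t) = P₂(0) + ∫₀ᵗ I₂`. -/
def P₂ (t : ℝ) : ℝ := D.P0 1 + ∫ s in (0 : ℝ)..t, D.I₂ s

/-- The mass in the disc of radius `R + σ t`: `m(0) + π ϱ̄ (R + σ t)²`. -/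
def totalMass (t : ℝ) : ℝ := D.m0 + D.ρbar * Real.pi * D.radius t ^ 2

/-- `φ₋(t) = |P(t)|² / (2 (m(0) + π ϱ̄ (R + σ t)²))`. -/
def phiMinus (t : ℝ) : ℝ := (D.P₁ t ^ 2 + D.P₂ t ^ 2) / (2 * D.totalMass t)

/-- `φ₊(t) = ½ (R + σ t)² (m(0) + π ϱ̄ (R + σ t)²)`. -/
def phiPlus (t : ℝ) : ℝ := D.radius t ^ 2 / 2 * D.totalMass t

/-- `q(t) = ¼ l² π ϱ̄ ((R + σ t)⁴ - R⁴) + 3 π ϱ̄ σ² (R + σ t)²`. -/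
def q (t : ℝ) : ℝ :=
  D.l ^ 2 * Real.pi * D.ρbar / 4 * (D.radius t ^ 4 - D.R ^ 4)
    + 3 * Real.pi * D.ρbar * D.σ ^ 2 * D.radius t ^ 2

/-- `A₀ = 2 (γ - 1) e(0) + l² G(0) - l F₂(0)`. -/
def A₀ : ℝ := 2 * (D.γ - 1) * D.e0 + D.l ^ 2 * D.G0 - D.l * D.F₂0

/-- `A₁ = 2 e(0) + l² G(0) - l F₂(0) + 2 (γ - 2) / (γ - 1) σ² m(0)`. -/
def A₁ : ℝ :=
  2 * D.e0 + D.l ^ 2 * D.G0 - D.l * D.F₂0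
    + 2 * (D.γ - 2) / (D.γ - 1) * D.σ ^ 2 * D.m0

/-- `f₊(t) = ∫₀ᵗ ∫₀^τ q + ½ A₀ t² + G'(0) t + G(0)`. -/
def fPlus (t : ℝ) : ℝ :=
  (∫ τ in (0 : ℝ)..t, ∫ s in (0 : ℝ)..τ, D.q s) + D.A₀ / 2 * t ^ 2 + D.dG0 * t + D.G0

/-- `f₋(t) = ∫₀ᵗ ∫₀^τ (q - l² φ₊) + ½ A₁ t² + G'(0) t + G(0)`. -/
def fMinus (t : ℝ) : ℝ :=
  (∫ τ in (0 : ℝ)..t, ∫ s in (0 : ℝ)..τ, (D.q s - D.l ^ 2 * D.phiPlus s))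
    + D.A₁ / 2 * t ^ 2 + D.dG0 * t + D.G0

end CauchyData

end

/-! Outside the disc `|x| < R + σt` the solution is the constant state, so every excess over that
state has compact support, and integrating the equations over the plane gives exact laws. Mass
excess and total energy are conserved; the momentum rotates with angular velocity `-l`; the first
moments of mass integrate the momentum; and `F₂ - l·G`, with `G` replaced by its excess part, is
constant. Differentiating `G` twice and using these laws gives `G'' = 2E_k + 2Π + l²G(0) - lF₂(0) +
q - l²G`, where `E_k` is the kinetic energy and `Π` the integral of `p - p̄`.

Upper bound: `2(γ-1)e(0) = 2(γ-1)E_k + 2Π`, so for `γ > 2` discarding `(γ-2)E_k ≥ 0` and `l²G ≥ 0`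
leaves `G'' ≤ f₊''`. Lower bound: `2E_k + 2Π = 2e(0) + 2(γ-2)/(γ-1)·Π`. The entropy never falls
below `S̄`, hence `p ≥ e^S̄ ϱ^γ`, and the tangent line of this convex function at `ϱ̄` gives `Π ≥
σ²m(0)`; with `G ≤ φ₊` this yields `G'' ≥ f₋''`. The initial values and slopes agree, so two
integrations finish (`G_le_fPlus`, `fMinus_le_G`).

Blow-up: `G - φ₋` is half the moment of inertia about the centre of mass and `φ₊ - G` is half the
integral of `ϱ(r² - |x|²)`. Both are positive at each time, but the case `T = T_*` needs a gap that
survives the limit `t → T_*`. The energy bounds the integral of `ϱ^γ`, so mass concentrates neither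
at a point nor at the boundary circle, and the gap is uniform on `[0, T)` (`exists_gap`).

Finite propagation speed (`atRest_of_radius_le`) is proved by hand: a weighted acoustic energy on
backward cones obeys a Grönwall inequality (`cone_step`) as long as the gas is nearly at rest there,
and a continuity argument in time (`atRest_cone`) removes that proviso at the cost of a cone speed
slightly above `σ`. -/

open Filter Topology

/-! ### Directional derivatives on space-time -/

/-- The derivative of a space-time function in a fixed direction. -/
noncomputable def dd (v : ℝ × Plane) (f : ℝ × Plane → ℝ) (z : ℝ × Plane) : ℝ := fderiv ℝ f z v

/-- The time direction. -/
noncomputable def dirT : ℝ × Plane := (1, 0)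

/-- The coordinate directions of the plane. -/
noncomputable def dirX (j : Fin 2) : ℝ × Plane := (0, EuclideanSpace.single j 1)

section DirectionalDerivative

variable {f g : ℝ × Plane → ℝ} {z v : ℝ × Plane}

theorem dd_const (c : ℝ) : dd v (fun _ => c) z = 0 := by simp [dd]

theorem dd_add (hf : DifferentiableAt ℝ f z) (hg : DifferentiableAt ℝ g z) :
    dd v (fun y => f y + g y) z = dd v f z + dd v g z := by
  simp [dd, fderiv_fun_add hf hg]

theorem dd_sub (hf : DifferentiableAt ℝ f z) (hg : DifferentiableAt ℝ g z) :
    dd v (fun y => f y - g y) z = dd v f z - dd v g z := by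
  simp [dd, fderiv_fun_sub hf hg]

theorem dd_mul (hf : DifferentiableAt ℝ f z) (hg : DifferentiableAt ℝ g z) :
    dd v (fun y => f y * g y) z = f z * dd v g z + g z * dd v f z := by
  simp [dd, fderiv_fun_mul hf hg]

theorem dd_sq (hf : DifferentiableAt ℝ f z) :
    dd v (fun y => f y ^ 2) z = 2 * f z * dd v f z := by
  simp only [sq]; rw [dd_mul hf hf]; ring

theorem dd_comp {φ : ℝ → ℝ} {φ' : ℝ} (hφ : HasDerivAt φ φ' (f z)) (hf : DifferentiableAt ℝ f z) :
    dd v (fun y => φ (f y)) z = φ' * dd v f z := by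
  have := (hφ.comp_hasFDerivAt z hf.hasFDerivAt).fderiv
  rw [dd, dd]
  change (fderiv ℝ (φ ∘ f) z) v = _
  rw [this]; simp

theorem dd_fst : dd v (fun y => y.1) z = v.1 := by
  simp [dd, fderiv_fst]

theorem dd_coord (i : Fin 2) : dd v (fun y => y.2 i) z = v.2 i := by
  have h : HasFDerivAt (fun y : ℝ × Plane => y.2 i)
      ((EuclideanSpace.proj i : Plane →L[ℝ] ℝ).comp (ContinuousLinearMap.snd ℝ ℝ Plane)) z :=
    ((EuclideanSpace.proj i : Plane →L[ℝ] ℝ).comp (ContinuousLinearMap.snd ℝ ℝ Plane)).hasFDerivAt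
  simp [dd, h.fderiv]

theorem hasDerivAt_time {t : ℝ} {x : Plane} (hf : DifferentiableAt ℝ f (t, x)) :
    HasDerivAt (fun s => f (s, x)) (dd dirT f (t, x)) t := by
  have h1 : HasDerivAt (fun s : ℝ => (s, x)) ((1 : ℝ), (0 : Plane)) t :=
    (hasDerivAt_id t).prodMk (hasDerivAt_const t x)
  exact hf.hasFDerivAt.comp_hasDerivAt t h1

theorem hasFDerivAt_space {t : ℝ} {x : Plane} (hf : DifferentiableAt ℝ f (t, x)) :
    HasFDerivAt (fun y => f (t, y))
      ((fderiv ℝ f (t, x)).comp (ContinuousLinearMap.inr ℝ ℝ Plane)) x := by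
  have h1 : HasFDerivAt (fun y : Plane => (t, y)) (ContinuousLinearMap.inr ℝ ℝ Plane) x :=
    hasFDerivAt_prodMk_right t x
  exact hf.hasFDerivAt.comp x h1

theorem pd_slice {t : ℝ} {x : Plane} (j : Fin 2) (hf : DifferentiableAt ℝ f (t, x)) :
    pd j (fun y => f (t, y)) x = dd (dirX j) f (t, x) := by
  rw [pd, (hasFDerivAt_space hf).fderiv]; rfl

end DirectionalDerivative

theorem coord_dirT (i : Fin 2) : dirT.2 i = 0 := by simp [dirT]

theorem coord_dirX_same (i : Fin 2) : (dirX i).2 i = 1 := by simp [dirX]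

theorem coord_dirX_zero_one : (dirX 0).2 1 = 0 := by simp [dirX]

theorem coord_dirX_one_zero : (dirX 1).2 0 = 0 := by simp [dirX]

/-! ### Balance laws for densities of compact spatial support -/

section Balance

variable {a b r : ℝ} {F H₀ H₁ : ℝ × Plane → ℝ}

theorem differentiableAt_of_contDiffOn_strip (hF : ContDiffOn ℝ 1 F (Ioo a b ×ˢ univ)) {t : ℝ}
    (ht : t ∈ Ioo a b) (x : Plane) : DifferentiableAt ℝ F (t, x) :=
  (hF.contDiffAt ((isOpen_Ioo.prod isOpen_univ).mem_nhds ⟨ht, mem_univ x⟩)).differentiableAt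
    (by norm_num)

theorem continuousOn_dd (hF : ContDiffOn ℝ 1 F (Ioo a b ×ˢ univ)) (v : ℝ × Plane) :
    ContinuousOn (dd v F) (Ioo a b ×ˢ univ) :=
  (hF.continuousOn_fderiv_of_isOpen (isOpen_Ioo.prod isOpen_univ) le_rfl).clm_apply
    continuousOn_const

theorem continuous_slice {A : Set ℝ} {f : ℝ × Plane → ℝ} (hf : ContinuousOn f (A ×ˢ univ)) {t : ℝ}
    (ht : t ∈ A) : Continuous fun x => f (t, x) :=
  hf.comp_continuous (by fun_prop) fun x => ⟨ht, mem_univ x⟩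

theorem integrable_of_eq_zero_outside {f : Plane → ℝ} (hf : Continuous f)
    (h0 : ∀ x, r < ‖x‖ → f x = 0) : Integrable f := by
  refine hf.integrable_of_hasCompactSupport ?_
  refine HasCompactSupport.intro (isCompact_closedBall (0 : Plane) r) fun x hx => h0 x ?_
  simpa using hx

/-- The strict inequality `r < ‖x‖` makes the exterior region open in space-time, so all derivatives
vanish there along with `F`. -/
theorem dd_eq_zero_of_support (v : ℝ × Plane) (h0 : ∀ t ∈ Ioo a b, ∀ x, r < ‖x‖ → F (t, x) = 0)
    {t : ℝ} (ht : t ∈ Ioo a b) {x : Plane} (hx : r < ‖x‖) : dd v F (t, x) = 0 := by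
  have : F =ᶠ[𝓝 (t, x)] fun _ => 0 := by
    have ho : IsOpen (Ioo a b ×ˢ {x : Plane | r < ‖x‖}) :=
      isOpen_Ioo.prod (isOpen_lt continuous_const continuous_norm)
    filter_upwards [ho.mem_nhds (show (t, x) ∈ _ from ⟨ht, hx⟩)] with z hz
    exact h0 z.1 hz.1 z.2 hz.2
  rw [dd, this.fderiv_eq]; simp

/-- Divergence theorem without boundary term: integration by parts against the constant function
`1`. -/
theorem integral_dd_dirX_eq_zero (hF : ContDiffOn ℝ 1 F (Ioo a b ×ˢ univ))
    (h0 : ∀ t ∈ Ioo a b, ∀ x, r < ‖x‖ → F (t, x) = 0) {t : ℝ} (ht : t ∈ Ioo a b) (j : Fin 2) :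
    ∫ x, dd (dirX j) F (t, x) = 0 := by
  have hd := fun x => hasFDerivAt_space (differentiableAt_of_contDiffOn_strip hF ht x)
  have hi : Integrable fun x => dd (dirX j) F (t, x) :=
    integrable_of_eq_zero_outside (continuous_slice (continuousOn_dd hF _) ht)
      fun x hx => dd_eq_zero_of_support _ h0 ht hx
  have hi' : Integrable fun x => F (t, x) :=
    integrable_of_eq_zero_outside (continuous_slice hF.continuousOn ht) (h0 t ht)
  have := integral_bilinear_hasFDerivAt_right_eq_neg_left_of_integrable (μ := volume)
    (f := fun _ : Plane => (1 : ℝ)) (f' := fun _ => 0) (g := fun x => F (t, x))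
    (v := EuclideanSpace.single j 1) (B := ContinuousLinearMap.mul ℝ ℝ)
    (g' := fun x => (fderiv ℝ F (t, x)).comp (ContinuousLinearMap.inr ℝ ℝ Plane))
    (by simp) (by simpa [dd, dirX] using hi) (by simpa using hi')
    (fun x _ => hasFDerivAt_const _ _) (fun x _ => hd x)
  simpa [dd, dirX] using this

theorem hasDerivAt_integral_time (hF : ContDiffOn ℝ 1 F (Ioo a b ×ˢ univ))
    (h0 : ∀ t ∈ Ioo a b, ∀ x, r < ‖x‖ → F (t, x) = 0) {t : ℝ} (ht : t ∈ Ioo a b) :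
    HasDerivAt (fun s => ∫ x, F (s, x)) (∫ x, dd dirT F (t, x)) t := by
  -- A smaller compact time interval around `t` makes the time derivative bounded on the support,
  -- which supplies the dominating function.
  obtain ⟨a', ha', hat⟩ := exists_between ht.1
  obtain ⟨b', htb, hb'⟩ := exists_between ht.2
  have hsub : Icc a' b' ⊆ Ioo a b := fun s hs => ⟨ha'.trans_le hs.1, hs.2.trans_lt hb'⟩
  have hK : IsCompact (Icc a' b' ×ˢ Metric.closedBall (0 : Plane) r) :=
    isCompact_Icc.prod (isCompact_closedBall _ _)
  obtain ⟨C, hC⟩ := hK.exists_bound_of_continuousOn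
    ((continuousOn_dd hF dirT).mono (prod_mono hsub (subset_univ _)))
  refine (hasDerivAt_integral_of_dominated_loc_of_deriv_le (μ := volume) (s := Ioo a' b')
    (F := fun s x => F (s, x)) (F' := fun s x => dd dirT F (s, x))
    (bound := (Metric.closedBall (0 : Plane) r).indicator fun _ => C)
    (Ioo_mem_nhds hat htb) ?_ ?_ ?_ ?_ ?_ ?_).2
  · filter_upwards [Ioo_mem_nhds ht.1 ht.2] with s hs
    exact (continuous_slice hF.continuousOn hs).aestronglyMeasurable
  · exact integrable_of_eq_zero_outside (continuous_slice hF.continuousOn ht) (h0 t ht)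
  · exact (continuous_slice (continuousOn_dd hF _) ht).aestronglyMeasurable
  · refine ae_of_all _ fun x s hs => ?_
    by_cases hx : x ∈ Metric.closedBall (0 : Plane) r
    · rw [indicator_of_mem hx]
      exact hC (s, x) ⟨Ioo_subset_Icc_self hs, hx⟩
    · rw [indicator_of_notMem hx, dd_eq_zero_of_support _ h0 (hsub (Ioo_subset_Icc_self hs))
        (by simpa using hx)]
      simp
  · exact (integrable_indicator_iff Metric.isClosed_closedBall.measurableSet).2
      (integrableOn_const (isCompact_closedBall _ _).measure_lt_top.ne)
  · refine ae_of_all _ fun x s hs => ?_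
    exact hasDerivAt_time (differentiableAt_of_contDiffOn_strip hF
      (hsub (Ioo_subset_Icc_self hs)) x)

theorem integrable_balance (hF : ContDiffOn ℝ 1 F (Ioo a b ×ˢ univ))
    (hH₀ : ContDiffOn ℝ 1 H₀ (Ioo a b ×ˢ univ)) (hH₁ : ContDiffOn ℝ 1 H₁ (Ioo a b ×ˢ univ))
    (hF0 : ∀ t ∈ Ioo a b, ∀ x, r < ‖x‖ → F (t, x) = 0)
    (hH₀0 : ∀ t ∈ Ioo a b, ∀ x, r < ‖x‖ → H₀ (t, x) = 0)
    (hH₁0 : ∀ t ∈ Ioo a b, ∀ x, r < ‖x‖ → H₁ (t, x) = 0) {t : ℝ} (ht : t ∈ Ioo a b) :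
    Integrable fun x => dd dirT F (t, x) + dd (dirX 0) H₀ (t, x) + dd (dirX 1) H₁ (t, x) := by
  have key : ∀ {G : ℝ × Plane → ℝ} (v : ℝ × Plane), ContDiffOn ℝ 1 G (Ioo a b ×ˢ univ) →
      (∀ t ∈ Ioo a b, ∀ x, r < ‖x‖ → G (t, x) = 0) → Integrable fun x => dd v G (t, x) :=
    fun v hG hG0 => integrable_of_eq_zero_outside (continuous_slice (continuousOn_dd hG _) ht)
      fun x hx => dd_eq_zero_of_support _ hG0 ht hx
  exact ((key _ hF hF0).add (key _ hH₀ hH₀0)).add (key _ hH₁ hH₁0)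

/-- The balance law `d/dt ∫ F = ∫ (∂ₜ F + div H)` for compactly supported densities. -/
theorem hasDerivAt_integral_of_balance (hF : ContDiffOn ℝ 1 F (Ioo a b ×ˢ univ))
    (hH₀ : ContDiffOn ℝ 1 H₀ (Ioo a b ×ˢ univ)) (hH₁ : ContDiffOn ℝ 1 H₁ (Ioo a b ×ˢ univ))
    (hF0 : ∀ t ∈ Ioo a b, ∀ x, r < ‖x‖ → F (t, x) = 0)
    (hH₀0 : ∀ t ∈ Ioo a b, ∀ x, r < ‖x‖ → H₀ (t, x) = 0)
    (hH₁0 : ∀ t ∈ Ioo a b, ∀ x, r < ‖x‖ → H₁ (t, x) = 0) {t : ℝ} (ht : t ∈ Ioo a b) :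
    HasDerivAt (fun s => ∫ x, F (s, x))
      (∫ x, (dd dirT F (t, x) + dd (dirX 0) H₀ (t, x) + dd (dirX 1) H₁ (t, x))) t := by
  have key : ∀ {G : ℝ × Plane → ℝ} (v : ℝ × Plane), ContDiffOn ℝ 1 G (Ioo a b ×ˢ univ) →
      (∀ t ∈ Ioo a b, ∀ x, r < ‖x‖ → G (t, x) = 0) → Integrable fun x => dd v G (t, x) :=
    fun v hG hG0 => integrable_of_eq_zero_outside (continuous_slice (continuousOn_dd hG _) ht)
      fun x hx => dd_eq_zero_of_support _ hG0 ht hx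
  have e₁ : ∫ x, (dd dirT F (t, x) + dd (dirX 0) H₀ (t, x) + dd (dirX 1) H₁ (t, x))
      = (∫ x, (dd dirT F (t, x) + dd (dirX 0) H₀ (t, x))) + ∫ x, dd (dirX 1) H₁ (t, x) :=
    integral_add ((key _ hF hF0).add (key _ hH₀ hH₀0)) (key _ hH₁ hH₁0)
  rw [e₁, integral_add (key _ hF hF0) (key _ hH₀ hH₀0), integral_dd_dirX_eq_zero hH₀ hH₀0 ht,
    integral_dd_dirX_eq_zero hH₁ hH₁0 ht, add_zero, add_zero]
  exact hasDerivAt_integral_time hF hF0 ht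

theorem continuousOn_integral_of_support {A : Set ℝ} (hF : ContinuousOn F (A ×ˢ univ))
    (h0 : ∀ t ∈ A, ∀ x, r < ‖x‖ → F (t, x) = 0) : ContinuousOn (fun t => ∫ x, F (t, x)) A :=
  continuousOn_integral_of_compact_support (f := fun t x => F (t, x))
    (isCompact_closedBall (0 : Plane) r) hF fun t x ht hx => h0 t ht x (by simpa using hx)

end Balance

/-! ### Explicit integrals over discs -/

section Disc

theorem volume_real_ball_plane (x : Plane) {r : ℝ} (hr : 0 ≤ r) :
    volume.real (Metric.ball x r) = Real.pi * r ^ 2 := by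
  rw [Measure.real, EuclideanSpace.volume_ball_fin_two]
  simp [ENNReal.toReal_ofReal hr, ENNReal.toReal_ofReal Real.pi_pos.le, mul_comm]

theorem integrableOn_ball_of_continuous {f : Plane → ℝ} (hf : Continuous f) (r : ℝ) :
    IntegrableOn f (Metric.ball 0 r) :=
  (hf.continuousOn.integrableOn_compact (isCompact_closedBall 0 r)).mono_set
    Metric.ball_subset_closedBall

theorem integral_ball_normSq {r : ℝ} (hr : 0 ≤ r) :
    ∫ x in Metric.ball (0 : Plane) r, ‖x‖ ^ 2 = Real.pi * r ^ 4 / 2 := by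
  have h1 : (fun x : Plane => (Iio r).indicator (fun y : ℝ => y ^ 2) ‖x‖)
      = (Metric.ball (0 : Plane) r).indicator fun x => ‖x‖ ^ 2 := by
    ext x; simp [indicator]
  rw [← integral_indicator Metric.isOpen_ball.measurableSet, ← h1,
    integral_fun_norm_addHaar volume, volume_real_ball_plane _ zero_le_one]
  -- Polar coordinates: the weight `y` of the plane times `y²` gives `y³`.
  have h2 : ∫ y in Ioi (0 : ℝ), y ^ (Module.finrank ℝ Plane - 1) • (Iio r).indicator
      (fun y : ℝ => y ^ 2) y = ∫ y in (0 : ℝ)..r, y ^ 3 := by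
    rw [intervalIntegral.integral_of_le hr, ← integral_indicator measurableSet_Ioi,
      integral_Ioc_eq_integral_Ioo, ← integral_indicator measurableSet_Ioo]
    congr 1; ext y
    by_cases h0 : 0 < y <;> by_cases h3 : y < r <;> simp [indicator, h0, h3]
    ring
  rw [h2, integral_pow]
  simp; ring

theorem integral_ball_coord (r : ℝ) (i : Fin 2) : ∫ x in Metric.ball (0 : Plane) r, x i = 0 := by
  have h : ∫ x : Plane, (Metric.ball (0 : Plane) r).indicator (fun x => x i) (-x)
      = ∫ x : Plane, (Metric.ball (0 : Plane) r).indicator (fun x => x i) x :=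
    integral_neg_eq_self _ _
  have h2 : (fun x : Plane => (Metric.ball (0 : Plane) r).indicator (fun x => x i) (-x))
      = fun x => -(Metric.ball (0 : Plane) r).indicator (fun x => x i) x := by
    ext x; by_cases hx : ‖x‖ < r <;> simp [indicator, hx]
  rw [h2, integral_neg, integral_indicator Metric.isOpen_ball.measurableSet] at h
  linarith

end Disc

/-! ### Reduction to primitive variables -/

/-- A `C¹` solution of the rotating gas equations in primitive variables: density `ρ`, velocity
components `U`, `V`, pressure `p`, entropy `S`, as functions on space-time. -/
structure IsFlow (T γ l : ℝ) (ρ U V p S : ℝ × Plane → ℝ) : Prop where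
  contDiffOn_ρ : ContDiffOn ℝ 1 ρ (Ico 0 T ×ˢ univ)
  contDiffOn_U : ContDiffOn ℝ 1 U (Ico 0 T ×ˢ univ)
  contDiffOn_V : ContDiffOn ℝ 1 V (Ico 0 T ×ˢ univ)
  contDiffOn_p : ContDiffOn ℝ 1 p (Ico 0 T ×ˢ univ)
  contDiffOn_S : ContDiffOn ℝ 1 S (Ico 0 T ×ˢ univ)
  ρ_pos : ∀ t ∈ Ico 0 T, ∀ x, 0 < ρ (t, x)
  mass : ∀ t ∈ Ioo 0 T, ∀ x, dd dirT ρ (t, x)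
    + (ρ (t, x) * dd (dirX 0) U (t, x) + U (t, x) * dd (dirX 0) ρ (t, x))
    + (ρ (t, x) * dd (dirX 1) V (t, x) + V (t, x) * dd (dirX 1) ρ (t, x)) = 0
  momentum_U : ∀ t ∈ Ioo 0 T, ∀ x, ρ (t, x) * (dd dirT U (t, x)
    + U (t, x) * dd (dirX 0) U (t, x) + V (t, x) * dd (dirX 1) U (t, x))
    - l * ρ (t, x) * V (t, x) + dd (dirX 0) p (t, x) = 0
  momentum_V : ∀ t ∈ Ioo 0 T, ∀ x, ρ (t, x) * (dd dirT V (t, x)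
    + U (t, x) * dd (dirX 0) V (t, x) + V (t, x) * dd (dirX 1) V (t, x))
    + l * ρ (t, x) * U (t, x) + dd (dirX 1) p (t, x) = 0
  pressure : ∀ t ∈ Ioo 0 T, ∀ x, dd dirT p (t, x)
    + U (t, x) * dd (dirX 0) p (t, x) + V (t, x) * dd (dirX 1) p (t, x)
    + γ * p (t, x) * (dd (dirX 0) U (t, x) + dd (dirX 1) V (t, x)) = 0
  entropy : ∀ t ∈ Ioo 0 T, ∀ x, dd dirT S (t, x)
    + U (t, x) * dd (dirX 0) S (t, x) + V (t, x) * dd (dirX 1) S (t, x) = 0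
  state : ∀ t ∈ Ico 0 T, ∀ x, p (t, x) = Real.exp (S (t, x)) * ρ (t, x) ^ γ

theorem differentiableAt_of_contDiffOn_Ico {T t : ℝ} {f : ℝ × Plane → ℝ}
    (hf : ContDiffOn ℝ 1 f (Ico 0 T ×ˢ univ)) (ht : t ∈ Ioo 0 T) (x : Plane) :
    DifferentiableAt ℝ f (t, x) :=
  differentiableAt_of_contDiffOn_strip (hf.mono (prod_mono Ioo_subset_Ico_self subset_rfl)) ht x

/-- Logarithmic differentiation of `p = e^S ϱ^γ`, multiplied by `ρ` so that no quotient appears. -/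
theorem dd_pressure_of_state {T γ : ℝ} {ρ p S : ℝ × Plane → ℝ}
    (hρ : ContDiffOn ℝ 1 ρ (Ico 0 T ×ˢ univ)) (hS : ContDiffOn ℝ 1 S (Ico 0 T ×ˢ univ))
    (hpos : ∀ t ∈ Ico 0 T, ∀ x, 0 < ρ (t, x))
    (hst : ∀ t ∈ Ico 0 T, ∀ x, p (t, x) = Real.exp (S (t, x)) * ρ (t, x) ^ γ)
    {t : ℝ} (ht : t ∈ Ioo 0 T) (x : Plane) (v : ℝ × Plane) :
    ρ (t, x) * dd v p (t, x)
      = p (t, x) * (ρ (t, x) * dd v S (t, x) + γ * dd v ρ (t, x)) := by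
  have hρd := differentiableAt_of_contDiffOn_Ico hρ ht x
  have hSd := differentiableAt_of_contDiffOn_Ico hS ht x
  have h0 := hpos t (Ioo_subset_Ico_self ht) x
  have he : p =ᶠ[𝓝 (t, x)] fun z => Real.exp (S z) * ρ z ^ γ := by
    filter_upwards [(isOpen_Ioo.prod isOpen_univ).mem_nhds
      (show (t, x) ∈ Ioo 0 T ×ˢ univ from ⟨ht, mem_univ x⟩)] with z hz
    exact hst z.1 (Ioo_subset_Ico_self hz.1) z.2
  have h1 : dd v p (t, x) = dd v (fun z => Real.exp (S z) * ρ z ^ γ) (t, x) := by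
    rw [dd, dd, he.fderiv_eq]
  have hd1 : DifferentiableAt ℝ (fun z => Real.exp (S z)) (t, x) := hSd.exp
  have hd2 : DifferentiableAt ℝ (fun z => ρ z ^ γ) (t, x) :=
    hρd.rpow (differentiableAt_const γ) h0.ne'
  rw [h1, dd_mul hd1 hd2, dd_comp (φ := Real.exp) (Real.hasDerivAt_exp _) hSd,
    dd_comp (φ := fun y => y ^ γ) (Real.hasDerivAt_rpow_const (Or.inl h0.ne')) hρd,
    hst t (Ioo_subset_Ico_self ht) x]
  have h2 : ρ (t, x) ^ γ = ρ (t, x) ^ (γ - 1) * ρ (t, x) := by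
    rw [← Real.rpow_add_one h0.ne']; ring_nf
  rw [h2]; ring

theorem CauchyData.IsClassicalSolution.isFlow {D : CauchyData} {T : ℝ} {u : ℝ → Plane → Plane}
    {ρ p S : ℝ → Plane → ℝ} (h : D.IsClassicalSolution T u ρ p S) :
    IsFlow T D.γ D.l (fun z => ρ z.1 z.2) (fun z => u z.1 z.2 0) (fun z => u z.1 z.2 1)
      (fun z => p z.1 z.2) (fun z => S z.1 z.2) := by
  have hU : ∀ i, ContDiffOn ℝ 1 (fun z : ℝ × Plane => u z.1 z.2 i) (Ico 0 T ×ˢ univ) := fun i =>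
    (contDiffOn_euclidean.1 h.contDiffOn_u) i
  have dρ : ∀ t ∈ Ioo 0 T, ∀ x, DifferentiableAt ℝ (fun z : ℝ × Plane => ρ z.1 z.2) (t, x) :=
    fun t ht x => differentiableAt_of_contDiffOn_Ico h.contDiffOn_ρ ht x
  have dU : ∀ i, ∀ t ∈ Ioo 0 T, ∀ x,
      DifferentiableAt ℝ (fun z : ℝ × Plane => u z.1 z.2 i) (t, x) :=
    fun i t ht x => differentiableAt_of_contDiffOn_Ico (hU i) ht x
  have dp : ∀ t ∈ Ioo 0 T, ∀ x, DifferentiableAt ℝ (fun z : ℝ × Plane => p z.1 z.2) (t, x) :=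
    fun t ht x => differentiableAt_of_contDiffOn_Ico h.contDiffOn_p ht x
  have dS : ∀ t ∈ Ioo 0 T, ∀ x, DifferentiableAt ℝ (fun z : ℝ × Plane => S z.1 z.2) (t, x) :=
    fun t ht x => differentiableAt_of_contDiffOn_Ico h.contDiffOn_S ht x
  have mass : ∀ t ∈ Ioo 0 T, ∀ x, dd dirT (fun z => ρ z.1 z.2) (t, x)
    + (ρ t x * dd (dirX 0) (fun z => u z.1 z.2 0) (t, x)
      + u t x 0 * dd (dirX 0) (fun z => ρ z.1 z.2) (t, x))
    + (ρ t x * dd (dirX 1) (fun z => u z.1 z.2 1) (t, x)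
      + u t x 1 * dd (dirX 1) (fun z => ρ z.1 z.2) (t, x)) = 0 := by
    intro t ht x
    have e := h.mass_eq t ht x
    rw [Fin.sum_univ_two, (hasDerivAt_time (dρ t ht x)).deriv,
      pd_slice (f := fun z => ρ z.1 z.2 * u z.1 z.2 0) 0 ((dρ t ht x).mul (dU 0 t ht x)),
      pd_slice (f := fun z => ρ z.1 z.2 * u z.1 z.2 1) 1 ((dρ t ht x).mul (dU 1 t ht x)),
      dd_mul (dρ t ht x) (dU 0 t ht x), dd_mul (dρ t ht x) (dU 1 t ht x)] at e
    linarith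
  have entr : ∀ t ∈ Ioo 0 T, ∀ x, dd dirT (fun z => S z.1 z.2) (t, x)
    + u t x 0 * dd (dirX 0) (fun z => S z.1 z.2) (t, x)
    + u t x 1 * dd (dirX 1) (fun z => S z.1 z.2) (t, x) = 0 := by
    intro t ht x
    have e := h.entropy_eq t ht x
    rw [Fin.sum_univ_two, (hasDerivAt_time (dS t ht x)).deriv,
      ← pd_slice (f := fun z => S z.1 z.2) 0 (dS t ht x),
      ← pd_slice (f := fun z => S z.1 z.2) 1 (dS t ht x)] at *
    linarith
  have mom : ∀ t ∈ Ioo 0 T, ∀ x, ∀ i, ρ t x * (dd dirT (fun z => u z.1 z.2 i) (t, x)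
    + u t x 0 * dd (dirX 0) (fun z => u z.1 z.2 i) (t, x)
    + u t x 1 * dd (dirX 1) (fun z => u z.1 z.2 i) (t, x))
    + ρ t x * D.l * rotL (u t x) i + dd (dirX i) (fun z => p z.1 z.2) (t, x) = 0 := by
    intro t ht x i
    have e := h.momentum_eq t ht x i
    have h1 := (dρ t ht x).fun_mul (dU i t ht x)
    rw [Fin.sum_univ_two, (hasDerivAt_time (f := fun z => ρ z.1 z.2 * u z.1 z.2 i) h1).deriv,
      pd_slice (f := fun z => ρ z.1 z.2 * u z.1 z.2 i * u z.1 z.2 0) 0 (h1.mul (dU 0 t ht x)),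
      pd_slice (f := fun z => ρ z.1 z.2 * u z.1 z.2 i * u z.1 z.2 1) 1 (h1.mul (dU 1 t ht x)),
      pd_slice (f := fun z => p z.1 z.2) i (dp t ht x),
      dd_mul h1 (dU 0 t ht x), dd_mul h1 (dU 1 t ht x), dd_mul (dρ t ht x) (dU i t ht x),
      dd_mul (dρ t ht x) (dU i t ht x), dd_mul (dρ t ht x) (dU i t ht x)] at e
    -- The conservative momentum equation minus `u_i` times the mass equation is the advective form.
    linear_combination e - u t x i * mass t ht x
  refine ⟨h.contDiffOn_ρ, hU 0, hU 1, h.contDiffOn_p, h.contDiffOn_S, h.ρ_pos, mass,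
    fun t ht x => ?_, fun t ht x => ?_, fun t ht x => ?_, entr, h.state_eq⟩
  · have e := mom t ht x 0
    simp only [rotL] at e
    simp at e
    linear_combination e
  · have e := mom t ht x 1
    simp only [rotL] at e
    simp at e
    linear_combination e
  · have hd := dd_pressure_of_state (p := fun z => p z.1 z.2) h.contDiffOn_ρ h.contDiffOn_S h.ρ_pos h.state_eq ht x
    have h0 := h.ρ_pos t (Ioo_subset_Ico_self ht) x
    have e0 := hd dirT
    have e1 := hd (dirX 0)
    have e2 := hd (dirX 1)
    simp only at e0 e1 e2 ⊢
    refine mul_left_cancel₀ h0.ne' ?_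
    -- The material derivative of the state law: entropy transport removes the `S` terms, and the
    -- mass equation turns the material derivative of the density into `-ρ div u`.
    linear_combination e0 + u t x 0 * e1 + u t x 1 * e2 + p t x * ρ t x * entr t ht x
      + D.γ * p t x * mass t ht x

/-! ### Tools for the energy estimate: a `C¹` positive part, Grönwall, derivative bounds -/

section PosPartSq

theorem hasDerivAt_posPart_sq (s : ℝ) : HasDerivAt (fun s : ℝ => max s 0 ^ 2) (2 * max s 0) s := by
  rcases lt_trichotomy s 0 with hs | rfl | hs
  · have : (fun s : ℝ => max s 0 ^ 2) =ᶠ[𝓝 s] fun _ => 0 := by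
      filter_upwards [Iio_mem_nhds hs] with y hy
      simp [max_eq_right (mem_Iio.1 hy).le]
    simpa [max_eq_right hs.le] using (hasDerivAt_const s (0 : ℝ)).congr_of_eventuallyEq this
  · have h1 : HasDerivWithinAt (fun s : ℝ => max s 0 ^ 2) 0 (Iic 0) 0 :=
      (hasDerivWithinAt_const 0 _ (0 : ℝ)).congr (fun y hy => by simp [max_eq_right (mem_Iic.1 hy)])
        (by simp)
    have h2 : HasDerivWithinAt (fun s : ℝ => max s 0 ^ 2) 0 (Ici 0) 0 := by
      have := ((hasDerivAt_id (0 : ℝ)).pow 2).hasDerivWithinAt (s := Ici 0)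
      refine (this.congr (fun y hy => ?_) (by simp)).congr_deriv (by simp)
      simp [max_eq_left (mem_Ici.1 hy)]
    simpa using (h1.union h2).hasDerivAt (by simp)
  · have : (fun s : ℝ => max s 0 ^ 2) =ᶠ[𝓝 s] fun s => s ^ 2 := by
      filter_upwards [Ioi_mem_nhds hs] with y hy
      simp [max_eq_left (mem_Ioi.1 hy).le]
    simpa [max_eq_left hs.le] using (hasDerivAt_pow 2 s).congr_of_eventuallyEq this

theorem contDiff_posPart_sq : ContDiff ℝ 1 (fun s : ℝ => max s 0 ^ 2) := by
  refine contDiff_one_iff_deriv.2 ⟨fun s => (hasDerivAt_posPart_sq s).differentiableAt, ?_⟩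
  have : deriv (fun s : ℝ => max s 0 ^ 2) = fun s => 2 * max s 0 :=
    funext fun s => (hasDerivAt_posPart_sq s).deriv
  rw [this]; fun_prop

end PosPartSq

/-- Grönwall's inequality with zero initial value. -/
theorem nonpos_of_deriv_le_mul {E E' : ℝ → ℝ} {a b C : ℝ} (hE : ContinuousOn E (Icc a b))
    (ha : E a = 0) (hd : ∀ t ∈ Ioo a b, HasDerivAt E (E' t) t)
    (hle : ∀ t ∈ Ioo a b, E' t ≤ C * E t) {t : ℝ} (ht : t ∈ Icc a b) : E t ≤ 0 := by
  have hd' : ∀ t ∈ Ioo a b, HasDerivAt (fun t => Real.exp (-C * t) * E t)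
      (Real.exp (-C * t) * (-C * 1) * E t + Real.exp (-C * t) * E' t) t := fun t ht =>
    ((((hasDerivAt_id t).const_mul (-C)).exp).mul (hd t ht))
  have hanti : AntitoneOn (fun t => Real.exp (-C * t) * E t) (Icc a b) := by
    refine antitoneOn_of_deriv_nonpos (convex_Icc a b) ?_ ?_ ?_
    · exact ContinuousOn.mul (by fun_prop) hE
    · rw [interior_Icc]
      exact fun t ht => (hd' t ht).differentiableAt.differentiableWithinAt
    · rw [interior_Icc]
      intro t ht
      rw [(hd' t ht).deriv]
      nlinarith [Real.exp_pos (-C * t), hle t ht]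
  have h1 := hanti (left_mem_Icc.2 (ht.1.trans ht.2)) ht ht.1
  simp only [ha, mul_zero] at h1
  have := Real.exp_pos (-C * t)
  by_contra hcon
  push Not at hcon
  nlinarith [mul_pos this hcon]

/-- The function is `C¹` only on the half-closed strip, so `fderiv` need not be controlled at `t =
0`. The within-derivative is continuous up to `t = 0`, hence bounded on compact sets, and agrees
with `fderiv` at interior times. -/
theorem exists_bound_dd {T t₂ : ℝ} {f : ℝ × Plane → ℝ}
    (hf : ContDiffOn ℝ 1 f (Ico 0 T ×ˢ univ)) (ht₂ : t₂ < T) (v : ℝ × Plane) (a : Plane) (r : ℝ) :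
    ∃ B, 0 ≤ B ∧ ∀ t ∈ Ioo 0 t₂, ∀ x ∈ Metric.closedBall a r, |dd v f (t, x)| ≤ B := by
  have hK : IsCompact (Icc 0 t₂ ×ˢ Metric.closedBall a r) :=
    isCompact_Icc.prod (isCompact_closedBall _ _)
  have hc : ContinuousOn (fun z => fderivWithin ℝ f (Ico 0 T ×ˢ univ) z v)
      (Icc 0 t₂ ×ˢ Metric.closedBall a r) :=
    (((hf.continuousOn_fderivWithin ((uniqueDiffOn_Ico 0 T).prod uniqueDiffOn_univ) le_rfl).clm_apply
      continuousOn_const)).mono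
        (prod_mono (fun s hs => ⟨hs.1, hs.2.trans_lt ht₂⟩) (subset_univ _))
  obtain ⟨C, hC⟩ := hK.exists_bound_of_continuousOn hc
  refine ⟨max C 0, le_max_right _ _, fun t ht x hx => ?_⟩
  have h1 := hC (t, x) ⟨Ioo_subset_Icc_self ht, hx⟩
  have h2 : Ico 0 T ×ˢ univ ∈ 𝓝 (t, x) :=
    mem_of_superset ((isOpen_Ioo.prod isOpen_univ).mem_nhds
      (show (t, x) ∈ Ioo 0 T ×ˢ univ from ⟨⟨ht.1, ht.2.trans ht₂⟩, mem_univ x⟩))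
      (prod_mono Ioo_subset_Ico_self subset_rfl)
  rw [fderivWithin_of_mem_nhds h2] at h1
  exact le_max_of_le_left h1

/-! ### Acoustic energy on backward cones -/

/-- The acoustic flux through the lateral boundary of a cone is dominated by the energy. -/
theorem cone_flux_nonneg {ρ U V P g s ε k y₀ y₁ : ℝ} (hρ : 0 < ρ) (hg : 0 < g) (hs : 0 < s)
    (hε : 0 ≤ ε) (hk : 0 ≤ k) (hy : y₀ ^ 2 + y₁ ^ 2 ≤ k ^ 2) (hu : U ^ 2 + V ^ 2 ≤ ε ^ 2)
    (hρs : g ≤ ρ * s ^ 2) :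
    0 ≤ (s + ε) * k * (1 / 2 * ρ * (U ^ 2 + V ^ 2) + P ^ 2 / (2 * g))
      + (P + 1 / 2 * ρ * (U ^ 2 + V ^ 2)) * (y₀ * U + y₁ * V) := by
  set w := Real.sqrt (U ^ 2 + V ^ 2) with hw
  have hw0 : 0 ≤ w := Real.sqrt_nonneg _
  have hw2 : U ^ 2 + V ^ 2 = w ^ 2 := (Real.sq_sqrt (by positivity)).symm
  have hwε : w ≤ ε := Real.sqrt_le_iff.2 ⟨hε, hu⟩
  rw [hw2]
  have hY : |y₀ * U + y₁ * V| ≤ k * w := by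
    apply abs_le_of_sq_le_sq _ (by positivity)
    have h1 : (y₀ * U + y₁ * V) ^ 2 ≤ (y₀ ^ 2 + y₁ ^ 2) * (U ^ 2 + V ^ 2) := by
      nlinarith [sq_nonneg (y₀ * V - y₁ * U)]
    rw [hw2] at h1
    calc _ ≤ _ := h1
      _ ≤ k ^ 2 * w ^ 2 := by gcongr
      _ = _ := by ring
  -- Young's inequality `2(gw)(s|P|) ≤ g²w² + s²P²`, with `g ≤ ρs²` replacing one factor `g`:
  -- pressure waves move at most at speed `s`. The bound `h2` below does the same for convection at
  -- speed at most `ε`, so the total speed is `s + ε`.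
  have h1 : |P| * w ≤ s * (1 / 2 * ρ * w ^ 2 + P ^ 2 / (2 * g)) := by
    have h2 : 2 * g * s * (|P| * w) ≤ g ^ 2 * w ^ 2 + s ^ 2 * P ^ 2 := by
      rw [← sq_abs P]; nlinarith [sq_nonneg (g * w - s * |P|)]
    have h3 : g ^ 2 * w ^ 2 ≤ g * (ρ * s ^ 2) * w ^ 2 := by
      rw [sq g]; gcongr
    have h4 : 2 * g * s * (s * (1 / 2 * ρ * w ^ 2 + P ^ 2 / (2 * g)))
      = g * (ρ * s ^ 2) * w ^ 2 + s ^ 2 * P ^ 2 := by field_simp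
    have h5 : 0 < 2 * g * s := by positivity
    exact le_of_mul_le_mul_left (by linarith) h5
  have h2 : 1 / 2 * ρ * w ^ 2 * w ≤ ε * (1 / 2 * ρ * w ^ 2 + P ^ 2 / (2 * g)) := by
    have h3 : 1 / 2 * ρ * w ^ 2 * w ≤ 1 / 2 * ρ * w ^ 2 * ε := by gcongr
    have h4 : 0 ≤ ε * (P ^ 2 / (2 * g)) := by positivity
    linarith
  have h3 : -((|P| + 1 / 2 * ρ * w ^ 2) * (k * w))
      ≤ (P + 1 / 2 * ρ * w ^ 2) * (y₀ * U + y₁ * V) := by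
    have h4 : |(P + 1 / 2 * ρ * w ^ 2) * (y₀ * U + y₁ * V)|
        ≤ (|P| + 1 / 2 * ρ * w ^ 2) * (k * w) := by
      rw [abs_mul]
      gcongr
      refine (abs_add_le _ _).trans_eq ?_
      rw [abs_of_nonneg (by positivity : 0 ≤ 1 / 2 * ρ * w ^ 2)]
    exact (abs_le.1 h4).1
  nlinarith [mul_le_mul_of_nonneg_left (add_le_add h1 h2) hk]

/-- The source term in the acoustic energy balance is dominated by the energy. -/
theorem cone_source_le {ρ U V P g γ pb s B div p₀ p₁ : ℝ} (hγ : 0 < γ) (hpb : 0 < pb)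
    (hρ : 0 < ρ) (hg : g = γ * pb) (hB : 0 ≤ B) (hdiv : |div| ≤ 2 * B) (hp₀ : |p₀| ≤ B)
    (hp₁ : |p₁| ≤ B) (hρs : g ≤ ρ * s ^ 2) :
    -(P ^ 2 / pb) * div - P / g * (U * p₀ + V * p₁)
      ≤ (4 * γ * B + B / g * (2 * g + s ^ 2 / g)) *
        (1 / 2 * ρ * (U ^ 2 + V ^ 2) + P ^ 2 / (2 * g)) := by
  have hg0 : 0 < g := hg ▸ mul_pos hγ hpb
  set η := 1 / 2 * ρ * (U ^ 2 + V ^ 2) + P ^ 2 / (2 * g) with hη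
  have hP : P ^ 2 ≤ 2 * g * η := by
    have h1 : 2 * g * η = g * ρ * (U ^ 2 + V ^ 2) + P ^ 2 := by rw [hη]; field_simp
    rw [h1]; nlinarith [mul_nonneg (mul_pos hg0 hρ).le (add_nonneg (sq_nonneg U) (sq_nonneg V))]
  -- The hypothesis `g ≤ ρs²` bounds the density below by `g/s²`, so the energy controls the
  -- velocity itself.
  have hu : 1 / 2 * (U ^ 2 + V ^ 2) ≤ s ^ 2 / g * η := by
    rw [div_mul_eq_mul_div (s ^ 2), le_div_iff₀ hg0]
    have h1 : 1 / 2 * (U ^ 2 + V ^ 2) * g ≤ 1 / 2 * (U ^ 2 + V ^ 2) * (ρ * s ^ 2) := by gcongr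
    have h2 : 0 ≤ s ^ 2 * (P ^ 2 / (2 * g)) := by positivity
    rw [hη]; linarith
  have t1 : -(P ^ 2 / pb) * div ≤ 4 * γ * B * η := by
    have h1 : -(P ^ 2 / pb) * div ≤ P ^ 2 / pb * (2 * B) := by
      have : -div ≤ 2 * B := (neg_le_abs div).trans hdiv
      have h2 : 0 ≤ P ^ 2 / pb := by positivity
      nlinarith
    have h2 : P ^ 2 / pb * (2 * B) ≤ (2 * g * η) / pb * (2 * B) := by gcongr
    have h3 : (2 * g * η) / pb * (2 * B) = 4 * γ * B * η := by rw [hg]; field_simp; ring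
    linarith
  have t2 : -(P * (U * p₀ + V * p₁)) ≤ B * (P ^ 2 + 1 / 2 * (U ^ 2 + V ^ 2)) := by
    have h1 : -(P * (U * p₀)) ≤ B * (1 / 2 * (P ^ 2 + U ^ 2)) := by
      refine (neg_le_abs _).trans ?_
      rw [abs_mul, abs_mul]
      have h2 : |P| * |U| ≤ 1 / 2 * (P ^ 2 + U ^ 2) := by
        nlinarith [sq_nonneg (|P| - |U|), sq_abs P, sq_abs U]
      calc |P| * (|U| * |p₀|) = |P| * |U| * |p₀| := by ring
        _ ≤ 1 / 2 * (P ^ 2 + U ^ 2) * B := by gcongr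
        _ = _ := by ring
    have h1' : -(P * (V * p₁)) ≤ B * (1 / 2 * (P ^ 2 + V ^ 2)) := by
      refine (neg_le_abs _).trans ?_
      rw [abs_mul, abs_mul]
      have h2 : |P| * |V| ≤ 1 / 2 * (P ^ 2 + V ^ 2) := by
        nlinarith [sq_nonneg (|P| - |V|), sq_abs P, sq_abs V]
      calc |P| * (|V| * |p₁|) = |P| * |V| * |p₁| := by ring
        _ ≤ 1 / 2 * (P ^ 2 + V ^ 2) * B := by gcongr
        _ = _ := by ring
    linarith
  have t3 : -(P / g * (U * p₀ + V * p₁)) ≤ B / g * (2 * g + s ^ 2 / g) * η := by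
    calc -(P / g * (U * p₀ + V * p₁)) = 1 / g * -(P * (U * p₀ + V * p₁)) := by ring
      _ ≤ 1 / g * (B * (2 * g * η + s ^ 2 / g * η)) := by
          have : B * (P ^ 2 + 1 / 2 * (U ^ 2 + V ^ 2)) ≤ B * (2 * g * η + s ^ 2 / g * η) := by
            gcongr
          gcongr; linarith
      _ = _ := by ring
  linarith

/-- The defining function of the backward cone with speed `c` and apex `(τ, a)`. -/
noncomputable def coneFun (c τ : ℝ) (a : Plane) (z : ℝ × Plane) : ℝ :=
  c ^ 2 * (τ - z.1) ^ 2 - ((z.2 0 - a 0) ^ 2 + (z.2 1 - a 1) ^ 2)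

/-- A `C¹` cutoff function supported in the cone. -/
noncomputable def coneCutoff (c τ : ℝ) (a : Plane) (z : ℝ × Plane) : ℝ :=
  max (coneFun c τ a z) 0 ^ 2

theorem contDiff_coneFun (c τ : ℝ) (a : Plane) : ContDiff ℝ 1 (coneFun c τ a) := by
  unfold coneFun; fun_prop

theorem contDiff_coneCutoff (c τ : ℝ) (a : Plane) : ContDiff ℝ 1 (coneCutoff c τ a) :=
  contDiff_posPart_sq.comp (contDiff_coneFun c τ a)

theorem normSq_sub_plane (x a : Plane) : ‖x - a‖ ^ 2 = (x 0 - a 0) ^ 2 + (x 1 - a 1) ^ 2 := by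
  rw [EuclideanSpace.norm_sq_eq, Fin.sum_univ_two]; simp

theorem coneFun_pos_iff {c τ : ℝ} (hc : 0 < c) {a : Plane} {t : ℝ} (ht : t ≤ τ) {x : Plane} :
    0 < coneFun c τ a (t, x) ↔ ‖x - a‖ < c * (τ - t) := by
  rw [coneFun, ← normSq_sub_plane, sub_pos, ← mul_pow]
  exact pow_lt_pow_iff_left₀ (norm_nonneg _) (mul_nonneg hc.le (sub_nonneg.2 ht)) two_ne_zero

theorem dd_coneFun (c τ : ℝ) (a : Plane) (z v : ℝ × Plane) :
    dd v (coneFun c τ a) z = -(2 * c ^ 2 * (τ - z.1) * v.1)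
      - 2 * ((z.2 0 - a 0) * v.2 0 + (z.2 1 - a 1) * v.2 1) := by
  unfold coneFun
  simp (disch := fun_prop) only [dd_sub, dd_mul, dd_sq, dd_add, dd_const, dd_fst, dd_coord]
  ring

theorem dd_coneCutoff (c τ : ℝ) (a : Plane) (z v : ℝ × Plane) :
    dd v (coneCutoff c τ a) z = 2 * max (coneFun c τ a z) 0 * dd v (coneFun c τ a) z := by
  have h := (contDiff_coneFun c τ a).differentiable one_ne_zero z
  exact dd_comp (φ := fun s => max s 0 ^ 2) (hasDerivAt_posPart_sq _) h

theorem coneCutoff_eq_zero {c τ : ℝ} (hc : 0 < c) {a : Plane} {t : ℝ} (ht : t ∈ Icc 0 τ)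
    {x : Plane} (hx : ‖a‖ + c * τ < ‖x‖) : coneCutoff c τ a (t, x) = 0 := by
  have h1 : ¬ 0 < coneFun c τ a (t, x) := by
    rw [coneFun_pos_iff hc ht.2, not_lt]
    have := norm_sub_norm_le x a
    nlinarith [ht.1]
  rw [coneCutoff, max_eq_right (not_lt.1 h1)]; simp

theorem fst_dirT : dirT.1 = 1 := rfl

theorem fst_dirX (j : Fin 2) : (dirX j).1 = 0 := rfl

namespace IsFlow

variable {T γ l : ℝ} {ρ U V p S : ℝ × Plane → ℝ}

/-- The density is `½ρ|u|² + (p - p̄)²/(2g)` with `g = γp̄`, the energy of the acoustic equations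
linearised at rest. Derivatives falling on the cutoff give the lateral flux, which has a favourable
sign by `cone_flux_nonneg`. The nonlinear remainder is quadratic in the perturbation, with
coefficients bounded through `B`, and is absorbed by `cone_source_le`. The Coriolis force does no
work and drops out. -/
theorem cone_balance_le (h : IsFlow T γ l ρ U V p S) {g pb s ε c τ B t : ℝ} {a x : Plane}
    (hγ : 0 < γ) (hpb : 0 < pb) (hg : g = γ * pb) (hs : 0 < s) (hε : 0 ≤ ε) (hc : c = s + ε)
    (ht : t ∈ Ioo 0 T) (htτ : t ≤ τ) (hB : 0 ≤ B)
    (hU₀ : 0 < coneFun c τ a (t, x) → |dd (dirX 0) U (t, x)| ≤ B)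
    (hV₁ : 0 < coneFun c τ a (t, x) → |dd (dirX 1) V (t, x)| ≤ B)
    (hp₀ : 0 < coneFun c τ a (t, x) → |dd (dirX 0) p (t, x)| ≤ B)
    (hp₁ : 0 < coneFun c τ a (t, x) → |dd (dirX 1) p (t, x)| ≤ B)
    (hu : 0 < coneFun c τ a (t, x) → U (t, x) ^ 2 + V (t, x) ^ 2 ≤ ε ^ 2)
    (hρs : 0 < coneFun c τ a (t, x) → g ≤ ρ (t, x) * s ^ 2) :
    dd dirT (fun z => coneCutoff c τ a z *
        (1 / 2 * ρ z * (U z ^ 2 + V z ^ 2) + 1 / (2 * g) * (p z - pb) ^ 2)) (t, x)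
      + dd (dirX 0) (fun z => coneCutoff c τ a z *
        ((p z - pb + 1 / 2 * ρ z * (U z ^ 2 + V z ^ 2)) * U z)) (t, x)
      + dd (dirX 1) (fun z => coneCutoff c τ a z *
        ((p z - pb + 1 / 2 * ρ z * (U z ^ 2 + V z ^ 2)) * V z)) (t, x)
    ≤ (4 * γ * B + B / g * (2 * g + s ^ 2 / g)) * (coneCutoff c τ a (t, x) *
        (1 / 2 * ρ (t, x) * (U (t, x) ^ 2 + V (t, x) ^ 2)
          + 1 / (2 * g) * (p (t, x) - pb) ^ 2)) := by
  have hg0 : 0 < g := hg ▸ mul_pos hγ hpb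
  have hρd := differentiableAt_of_contDiffOn_Ico h.contDiffOn_ρ ht x
  have hUd := differentiableAt_of_contDiffOn_Ico h.contDiffOn_U ht x
  have hVd := differentiableAt_of_contDiffOn_Ico h.contDiffOn_V ht x
  have hpd := differentiableAt_of_contDiffOn_Ico h.contDiffOn_p ht x
  have hχd := (contDiff_coneCutoff c τ a).differentiable one_ne_zero (t, x)
  have m := h.mass t ht x
  have mU := h.momentum_U t ht x
  have mV := h.momentum_V t ht x
  have pr := h.pressure t ht x
  have hρ := h.ρ_pos t (Ioo_subset_Ico_self ht) x
  simp (disch := fun_prop) only [dd_sub, dd_mul, dd_sq, dd_add, dd_const, dd_coneCutoff,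
    dd_coneFun]
  simp only [coord_dirT, coord_dirX_same, coord_dirX_one_zero, coord_dirX_zero_one, fst_dirT,
    fst_dirX]
  generalize hχ : coneCutoff c τ a (t, x) = χ
  by_cases hh : 0 < coneFun c τ a (t, x)
  · have hU₀ := hU₀ hh
    have hV₁ := hV₁ hh
    have hp₀ := hp₀ hh
    have hp₁ := hp₁ hh
    have hY := (coneFun_pos_iff (by linarith) htτ).1 hh
    have hY2 : (x 0 - a 0) ^ 2 + (x 1 - a 1) ^ 2 ≤ (c * (τ - t)) ^ 2 := by
      rw [← normSq_sub_plane]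
      exact pow_le_pow_left₀ (norm_nonneg _) hY.le 2
    have flux := cone_flux_nonneg (P := p (t, x) - pb) (k := c * (τ - t)) hρ hg0 hs hε
      ((norm_nonneg _).trans hY.le) hY2 (hu hh) (hρs hh)
    have src := cone_source_le (P := p (t, x) - pb) (U := U (t, x)) (V := V (t, x)) hγ hpb hρ hg hB
      ((abs_add_le _ _).trans (by linarith) : |dd (dirX 0) U (t, x)
        + dd (dirX 1) V (t, x)| ≤ 2 * B) hp₀ hp₁ (hρs hh)
    have hχ0 : 0 ≤ χ := by rw [← hχ]; exact sq_nonneg _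
    rw [max_eq_left hh.le]
    have e1 := mul_le_mul_of_nonneg_left src hχ0
    have e2 := mul_nonneg hh.le flux
    have h1 : γ * g⁻¹ = pb⁻¹ := by rw [hg]; field_simp
    have h2 : pb⁻¹ * pb = 1 := inv_mul_cancel₀ hpb.ne'
    subst hc
    -- The multipliers `½|u|²`, `U`, `V` and `(p - p̄)/g` are those of the energy identity. The
    -- factor `4` combines the `2` from the squared positive part with the `2` from the quadratic
    -- cone function; the last term uses `γ/g = 1/p̄`.
    linear_combination e1 + 4 * e2 + χ * (1 / 2 * (U (t, x) ^ 2 + V (t, x) ^ 2) * m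
        + U (t, x) * mU + V (t, x) * mV + (p (t, x) - pb) * g⁻¹ * pr)
      - χ * (p (t, x) - pb) * (dd (dirX 0) U (t, x) + dd (dirX 1) V (t, x))
        * (p (t, x) * h1 + h2)
  · have h0 : χ = 0 := by
      rw [← hχ, coneCutoff, max_eq_right (not_lt.1 hh)]; simp
    rw [max_eq_right (not_lt.1 hh), h0]
    simp

end IsFlow

theorem eq_zero_of_integral_nonpos {f : Plane → ℝ} {r : ℝ} (hf : Continuous f) (h0 : ∀ x, 0 ≤ f x)
    (hr : ∀ x, r < ‖x‖ → f x = 0) (hi : ∫ x, f x ≤ 0) (x : Plane) : f x = 0 := by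
  have h1 : ∫ x, f x = 0 := le_antisymm hi (integral_nonneg h0)
  have h2 := (integral_eq_zero_iff_of_nonneg h0 (integrable_of_eq_zero_outside hf hr)).1 h1
  exact congrFun ((hf.ae_eq_iff_eq volume continuous_const).1 h2) x

theorem eq_of_hasDerivAt_zero {f : ℝ → ℝ} {a b : ℝ} (hab : a ≤ b) (hf : ContinuousOn f (Icc a b))
    (hd : ∀ t ∈ Ioo a b, HasDerivAt f 0 t) : f b = f a := by
  rcases hab.eq_or_lt with rfl | hab
  · rfl
  obtain ⟨c, hc, h⟩ := exists_hasDerivAt_eq_slope f (fun _ => 0) hab hf hd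
  have : b - a ≠ 0 := (sub_pos.2 hab).ne'
  rw [eq_comm, div_eq_zero_iff] at h
  rcases h with h | h
  · linarith
  · exact absurd h this

theorem eq_zero_of_energy_eq_zero {ρ g U V P : ℝ} (hρ : 0 < ρ) (hg : 0 < g)
    (h : 1 / 2 * ρ * (U ^ 2 + V ^ 2) + 1 / (2 * g) * P ^ 2 = 0) : U = 0 ∧ V = 0 ∧ P = 0 := by
  have e1 : 0 ≤ 1 / 2 * ρ * U ^ 2 := by positivity
  have e2 : 0 ≤ 1 / 2 * ρ * V ^ 2 := by positivity
  have e3 : 0 ≤ 1 / (2 * g) * P ^ 2 := by positivity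
  have h1 : 1 / 2 * ρ * U ^ 2 = 0 := by linarith
  have h2 : 1 / 2 * ρ * V ^ 2 = 0 := by linarith
  have h3 : 1 / (2 * g) * P ^ 2 = 0 := by linarith
  simpa [hρ.ne', hg.ne'] using And.intro h1 (And.intro h2 h3)

namespace IsFlow

variable {T γ l : ℝ} {ρ U V p S : ℝ × Plane → ℝ}

/-- The cutoff acoustic energy vanishes at `t₁` and satisfies `E' ≤ C·E`, so by Grönwall it stays
zero. Inside the cone the cutoff is positive, which forces velocity and pressure perturbation to
vanish. The density is not seen by this energy and is recovered in `cone_density`. -/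
theorem cone_step (h : IsFlow T γ l ρ U V p S) {g pb s ε c τ t₁ t₂ : ℝ} {a : Plane}
    (hγ : 0 < γ) (hpb : 0 < pb) (hg : g = γ * pb) (hs : 0 < s) (hε : 0 ≤ ε) (hc : c = s + ε)
    (ht₁ : 0 ≤ t₁) (ht₂ : t₂ < T) (ht₂τ : t₂ ≤ τ)
    (h1 : ∀ x, ‖x - a‖ < c * (τ - t₁) → U (t₁, x) = 0 ∧ V (t₁, x) = 0 ∧ p (t₁, x) = pb)
    (hsm : ∀ t ∈ Ioo t₁ t₂, ∀ x, ‖x - a‖ < c * (τ - t) →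
      U (t, x) ^ 2 + V (t, x) ^ 2 ≤ ε ^ 2 ∧ g ≤ ρ (t, x) * s ^ 2)
    {t : ℝ} (ht : t ∈ Icc t₁ t₂) {x : Plane} (hx : ‖x - a‖ < c * (τ - t)) :
    U (t, x) = 0 ∧ V (t, x) = 0 ∧ p (t, x) = pb := by
  have hg0 : 0 < g := hg ▸ mul_pos hγ hpb
  have hc0 : 0 < c := by linarith
  have hτ : 0 ≤ τ := ht₁.trans (ht.1.trans (ht.2.trans ht₂τ))
  obtain ⟨B₁, hB₁, hb₁⟩ := exists_bound_dd h.contDiffOn_U ht₂ (dirX 0) a (c * τ)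
  obtain ⟨B₂, hB₂, hb₂⟩ := exists_bound_dd h.contDiffOn_V ht₂ (dirX 1) a (c * τ)
  obtain ⟨B₃, hB₃, hb₃⟩ := exists_bound_dd h.contDiffOn_p ht₂ (dirX 0) a (c * τ)
  obtain ⟨B₄, hB₄, hb₄⟩ := exists_bound_dd h.contDiffOn_p ht₂ (dirX 1) a (c * τ)
  set B := B₁ + B₂ + B₃ + B₄ with hB
  set C := 4 * γ * B + B / g * (2 * g + s ^ 2 / g) with hC
  set F : ℝ × Plane → ℝ := fun z => coneCutoff c τ a z *
    (1 / 2 * ρ z * (U z ^ 2 + V z ^ 2) + 1 / (2 * g) * (p z - pb) ^ 2) with hF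
  set H₀ : ℝ × Plane → ℝ := fun z => coneCutoff c τ a z *
    ((p z - pb + 1 / 2 * ρ z * (U z ^ 2 + V z ^ 2)) * U z) with hH₀
  set H₁ : ℝ × Plane → ℝ := fun z => coneCutoff c τ a z *
    ((p z - pb + 1 / 2 * ρ z * (U z ^ 2 + V z ^ 2)) * V z) with hH₁
  have cχ : ContDiffOn ℝ 1 (coneCutoff c τ a) (Ico 0 T ×ˢ univ) :=
    (contDiff_coneCutoff c τ a).contDiffOn
  have cρ := h.contDiffOn_ρ
  have cU := h.contDiffOn_U
  have cV := h.contDiffOn_V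
  have cp := h.contDiffOn_p
  have hsubI : Icc t₁ t₂ ⊆ Ico 0 T := fun r hr => ⟨ht₁.trans hr.1, hr.2.trans_lt ht₂⟩
  have hsub : Ioo t₁ t₂ ×ˢ (univ : Set Plane) ⊆ Ico 0 T ×ˢ univ :=
    prod_mono (Ioo_subset_Icc_self.trans hsubI) subset_rfl
  have cF : ContDiffOn ℝ 1 F (Ico 0 T ×ˢ univ) := by fun_prop
  have cH₀ : ContDiffOn ℝ 1 H₀ (Ico 0 T ×ˢ univ) := by fun_prop
  have cH₁ : ContDiffOn ℝ 1 H₁ (Ico 0 T ×ˢ univ) := by fun_prop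
  have hχ0 : ∀ r ∈ Icc t₁ t₂, ∀ y : Plane, ‖a‖ + c * τ < ‖y‖ → coneCutoff c τ a (r, y) = 0 :=
    fun r hr y hy => coneCutoff_eq_zero hc0 ⟨ht₁.trans hr.1, hr.2.trans ht₂τ⟩ hy
  have hF0 : ∀ r ∈ Icc t₁ t₂, ∀ y : Plane, ‖a‖ + c * τ < ‖y‖ → F (r, y) = 0 :=
    fun r hr y hy => by simp [hF, hχ0 r hr y hy]
  have hρ0 : ∀ r ∈ Icc t₁ t₂, ∀ y, 0 < ρ (r, y) := fun r hr => h.ρ_pos r (hsubI hr)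
  have hFnn : ∀ r ∈ Icc t₁ t₂, ∀ y, 0 ≤ F (r, y) := fun r hr y =>
    mul_nonneg (sq_nonneg _) (by have := hρ0 r hr y; positivity)
  have hder : ∀ r ∈ Ioo t₁ t₂, HasDerivAt (fun r => ∫ y, F (r, y))
      (∫ y, (dd dirT F (r, y) + dd (dirX 0) H₀ (r, y) + dd (dirX 1) H₁ (r, y))) r := by
    intro r hr
    exact hasDerivAt_integral_of_balance (r := ‖a‖ + c * τ) (cF.mono hsub) (cH₀.mono hsub)
      (cH₁.mono hsub)
      (fun r hr y hy => hF0 r (Ioo_subset_Icc_self hr) y hy)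
      (fun r hr y hy => by simp [hH₀, hχ0 r (Ioo_subset_Icc_self hr) y hy])
      (fun r hr y hy => by simp [hH₁, hχ0 r (Ioo_subset_Icc_self hr) y hy]) hr
  have hcont : ∀ r ∈ Icc t₁ t₂, Continuous fun y => F (r, y) := fun r hr =>
    continuous_slice cF.continuousOn (hsubI hr)
  have hle : ∀ r ∈ Ioo t₁ t₂,
      ∫ y, (dd dirT F (r, y) + dd (dirX 0) H₀ (r, y) + dd (dirX 1) H₁ (r, y))
        ≤ C * ∫ y, F (r, y) := by
    intro r hr
    have hr' := Ioo_subset_Icc_self hr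
    have hr0 : r ∈ Ioo 0 T := ⟨ht₁.trans_lt hr.1, hr.2.trans ht₂⟩
    have hball : ∀ y, 0 < coneFun c τ a (r, y) → y ∈ Metric.closedBall a (c * τ) := by
      intro y hy
      rw [coneFun_pos_iff hc0 (hr.2.le.trans ht₂τ)] at hy
      rw [mem_closedBall_iff_norm]
      nlinarith [hr0.1]
    rw [← integral_const_mul]
    refine integral_mono (integrable_balance (r := ‖a‖ + c * τ) (cF.mono hsub) (cH₀.mono hsub)
      (cH₁.mono hsub)
      (fun r hr y hy => hF0 r (Ioo_subset_Icc_self hr) y hy)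
      (fun r hr y hy => by simp [hH₀, hχ0 r (Ioo_subset_Icc_self hr) y hy])
      (fun r hr y hy => by simp [hH₁, hχ0 r (Ioo_subset_Icc_self hr) y hy]) hr)
      ((integrable_of_eq_zero_outside (hcont r hr') (hF0 r hr')).const_mul C) fun y => ?_
    have hr2 : r ∈ Ioo 0 t₂ := ⟨hr0.1, hr.2⟩
    exact h.cone_balance_le hγ hpb hg hs hε hc hr0 (hr.2.le.trans ht₂τ)
      (by positivity) (fun hy => (hb₁ r hr2 y (hball y hy)).trans (by linarith))
      (fun hy => (hb₂ r hr2 y (hball y hy)).trans (by linarith))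
      (fun hy => (hb₃ r hr2 y (hball y hy)).trans (by linarith))
      (fun hy => (hb₄ r hr2 y (hball y hy)).trans (by linarith))
      (fun hy => (hsm r hr y ((coneFun_pos_iff hc0 (hr.2.le.trans ht₂τ)).1 hy)).1)
      (fun hy => (hsm r hr y ((coneFun_pos_iff hc0 (hr.2.le.trans ht₂τ)).1 hy)).2)
  have hE := nonpos_of_deriv_le_mul (E := fun r => ∫ y, F (r, y)) (C := C)
    ((continuousOn_integral_of_support (A := Icc t₁ t₂) (cF.continuousOn.mono
      (prod_mono hsubI subset_rfl)) hF0)) ?_ hder hle ht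
  · have hz := eq_zero_of_integral_nonpos (hcont t ht) (hFnn t ht) (hF0 t ht) hE x
    have hpos : 0 < coneFun c τ a (t, x) := (coneFun_pos_iff hc0 (ht.2.trans ht₂τ)).2 hx
    have hχ : coneCutoff c τ a (t, x) ≠ 0 := by
      rw [coneCutoff, max_eq_left hpos.le]; positivity
    have hη := (mul_eq_zero.1 hz).resolve_left hχ
    have hρ := hρ0 t ht x
    obtain ⟨e1, e2, e3⟩ := eq_zero_of_energy_eq_zero hρ hg0 hη
    exact ⟨e1, e2, sub_eq_zero.1 e3⟩
  · have : ∀ y, F (t₁, y) = 0 := by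
      intro y
      by_cases hy : 0 < coneFun c τ a (t₁, y)
      · obtain ⟨a1, a2, a3⟩ := h1 y ((coneFun_pos_iff hc0 ((ht.1.trans ht.2).trans ht₂τ)).1 hy)
        simp [hF, a1, a2, a3]
      · simp [hF, coneCutoff, max_eq_right (not_lt.1 hy)]
    simp [this]

/-- Since the cone narrows with time, the vertical segment below `(t, x)` stays inside it. The
velocity vanishes on a neighbourhood of each interior point of the segment, so the mass equation
there reduces to `∂ₜρ = 0`. -/
theorem cone_density (h : IsFlow T γ l ρ U V p S) {c τ t₁ t₂ : ℝ} {a : Plane} (hc : 0 < c)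
    (ht₁ : 0 ≤ t₁) (ht₂ : t₂ < T)
    (h0 : ∀ t ∈ Icc t₁ t₂, ∀ x, ‖x - a‖ < c * (τ - t) → U (t, x) = 0 ∧ V (t, x) = 0)
    {t : ℝ} (ht : t ∈ Icc t₁ t₂) {x : Plane} (hx : ‖x - a‖ < c * (τ - t)) :
    ρ (t, x) = ρ (t₁, x) := by
  refine eq_of_hasDerivAt_zero (f := fun r => ρ (r, x)) ht.1 ?_ ?_
  · exact h.contDiffOn_ρ.continuousOn.comp (by fun_prop)
      fun r hr => ⟨⟨ht₁.trans hr.1, (hr.2.trans ht.2).trans_lt ht₂⟩, mem_univ _⟩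
  · intro r hr
    have hr0 : r ∈ Ioo 0 T := ⟨ht₁.trans_lt hr.1, (hr.2.trans_le ht.2).trans ht₂⟩
    have hxr : ‖x - a‖ < c * (τ - r) := hx.trans (by nlinarith [hr.2])
    have hev : ∀ᶠ z in 𝓝 (r, x), U z = 0 ∧ V z = 0 := by
      have ho : IsOpen {z : ℝ × Plane | ‖z.2 - a‖ < c * (τ - z.1)} :=
        isOpen_lt (by fun_prop) (by fun_prop)
      filter_upwards [ho.mem_nhds (show (r, x) ∈ _ from hxr),
        (isOpen_Ioo.prod isOpen_univ).mem_nhds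
          (show (r, x) ∈ Ioo t₁ t₂ ×ˢ univ from ⟨⟨hr.1, hr.2.trans_le ht.2⟩, mem_univ x⟩)]
        with z hz hz'
      exact h0 z.1 (Ioo_subset_Icc_self hz'.1) z.2 hz
    have hU : dd (dirX 0) U (r, x) = 0 := by
      have : U =ᶠ[𝓝 (r, x)] fun _ => 0 := hev.mono fun z hz => hz.1
      rw [dd, this.fderiv_eq]; simp
    have hV : dd (dirX 1) V (r, x) = 0 := by
      have : V =ᶠ[𝓝 (r, x)] fun _ => 0 := hev.mono fun z hz => hz.2
      rw [dd, this.fderiv_eq]; simp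
    have hm := h.mass r hr0 x
    rw [hU, hV, hev.self_of_nhds.1, hev.self_of_nhds.2] at hm
    have := hasDerivAt_time (differentiableAt_of_contDiffOn_Ico h.contDiffOn_ρ hr0 x)
    rwa [show dd dirT ρ (r, x) = 0 by linarith] at this

end IsFlow

/-! ### Finite speed of propagation by continuity in time -/

namespace IsFlow

variable {T γ l : ℝ} {ρ U V p S : ℝ × Plane → ℝ}

/-- The gas is at rest, with density `ρb` and pressure `pb`, at a point of space-time. -/
def AtRest (ρ U V p : ℝ × Plane → ℝ) (ρb pb : ℝ) (z : ℝ × Plane) : Prop :=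
  U z = 0 ∧ V z = 0 ∧ p z = pb ∧ ρ z = ρb

theorem isClosed_atRest_slice (h : IsFlow T γ l ρ U V p S) (ρb pb : ℝ) {t : ℝ} (ht : t ∈ Ico 0 T) :
    IsClosed {x : Plane | AtRest ρ U V p ρb pb (t, x)} := by
  have c₁ := continuous_slice h.contDiffOn_U.continuousOn ht
  have c₂ := continuous_slice h.contDiffOn_V.continuousOn ht
  have c₃ := continuous_slice h.contDiffOn_p.continuousOn ht
  have c₄ := continuous_slice h.contDiffOn_ρ.continuousOn ht
  exact (isClosed_eq c₁ continuous_const).inter ((isClosed_eq c₂ continuous_const).inter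
    ((isClosed_eq c₃ continuous_const).inter (isClosed_eq c₄ continuous_const)))

theorem continuousOn_time {T : ℝ} {f : ℝ × Plane → ℝ} (hf : ContDiffOn ℝ 1 f (Ico 0 T ×ˢ univ))
    (x : Plane) : ContinuousOn (fun t => f (t, x)) (Ico 0 T) :=
  hf.continuousOn.comp (by fun_prop) fun _ hr => ⟨hr, mem_univ _⟩

/-- Continuous induction on `t`: the set of times at which the cone slice is at rest is closed and
can be extended to the right. Of the excess `2ε` in the cone speed, one `ε` allows for small
velocities and the other for a sound speed slightly above `σ`. -/
theorem atRest_cone (h : IsFlow T γ l ρ U V p S) {ρb pb σ ε τ : ℝ} {a : Plane}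
    (hγ : 0 < γ) (hpb : 0 < pb) (hρb : 0 < ρb) (hσ : 0 < σ) (hσ2 : σ ^ 2 * ρb = γ * pb)
    (hε : 0 < ε) (hτ : τ < T)
    (h0 : ∀ x, ‖x - a‖ < (σ + 2 * ε) * τ → AtRest ρ U V p ρb pb (0, x)) :
    ∀ t ∈ Icc 0 τ, ∀ x, ‖x - a‖ < (σ + 2 * ε) * (τ - t) → AtRest ρ U V p ρb pb (t, x) := by
  set c := σ + 2 * ε with hc
  have hc0 : 0 < c := by positivity
  have hIcc : ∀ {t}, t ∈ Icc 0 τ → t ∈ Ico 0 T := fun ht => ⟨ht.1, ht.2.trans_lt hτ⟩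
  refine IsClosed.Icc_subset_of_forall_mem_nhdsWithin
    (s := {t | ∀ x, ‖x - a‖ < c * (τ - t) → AtRest ρ U V p ρb pb (t, x)}) ?_ ?_ ?_
  · refine IsSeqClosed.isClosed fun u t hu hut => ?_
    have ht : t ∈ Icc 0 τ := isClosed_Icc.mem_of_tendsto hut (Eventually.of_forall fun n => (hu n).2)
    refine ⟨fun x hx => ?_, ht⟩
    -- The cone condition is strict, hence open in time, so `x` lies in the slices at nearby times
    -- and the rest values pass to the limit.
    have hev : ∀ᶠ n in atTop, ‖x - a‖ < c * (τ - u n) :=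
      ((tendsto_const_nhds.sub hut).const_mul c).eventually (lt_mem_nhds hx)
    have hT : ∀ n, u n ∈ Ico 0 T := fun n => hIcc (hu n).2
    have lim : ∀ f : ℝ × Plane → ℝ, ContDiffOn ℝ 1 f (Ico 0 T ×ˢ univ) →
        Tendsto (fun n => f (u n, x)) atTop (𝓝 (f (t, x))) := fun f hf =>
      (continuousOn_time hf x t (hIcc ht)).tendsto.comp
        (tendsto_nhdsWithin_iff.2 ⟨hut, Eventually.of_forall hT⟩)
    refine ⟨tendsto_nhds_unique (lim U h.contDiffOn_U) ?_,
      tendsto_nhds_unique (lim V h.contDiffOn_V) ?_,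
      tendsto_nhds_unique (lim p h.contDiffOn_p) ?_,
      tendsto_nhds_unique (lim ρ h.contDiffOn_ρ) ?_⟩
    · exact tendsto_const_nhds.congr' (hev.mono fun n hn => ((hu n).1 x hn).1.symm)
    · exact tendsto_const_nhds.congr' (hev.mono fun n hn => ((hu n).1 x hn).2.1.symm)
    · exact tendsto_const_nhds.congr' (hev.mono fun n hn => ((hu n).1 x hn).2.2.1.symm)
    · exact tendsto_const_nhds.congr' (hev.mono fun n hn => ((hu n).1 x hn).2.2.2.symm)
  · intro x hx
    exact h0 x (by simpa using hx)
  · rintro t ⟨htA, ht⟩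
    have htT : t ∈ Ico 0 T := hIcc (Ico_subset_Icc_self ht)
    have hrad : 0 < c * (τ - t) := mul_pos hc0 (sub_pos.2 ht.2)
    -- Passing to the closed ball gives compactness, which makes the smallness of the perturbation
    -- uniform in `y` for times near `t`.
    have hK : ∀ y ∈ Metric.closedBall a (c * (τ - t)), AtRest ρ U V p ρb pb (t, y) := by
      have : Metric.closedBall a (c * (τ - t)) ⊆ {y | AtRest ρ U V p ρb pb (t, y)} := by
        rw [← closure_ball a hrad.ne']
        exact closure_minimal (fun y hy => htA y (mem_ball_iff_norm.1 hy))
          (h.isClosed_atRest_slice ρb pb htT)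
      exact this
    have hP : ∀ᶠ r in 𝓝 t, ∀ y ∈ Metric.closedBall a (c * (τ - t)), r ∈ Ico 0 T →
        U (r, y) ^ 2 + V (r, y) ^ 2 ≤ ε ^ 2 ∧ γ * pb ≤ ρ (r, y) * (σ + ε) ^ 2 := by
      refine (isCompact_closedBall a _).eventually_forall_of_forall_eventually
        (P := fun r y => r ∈ Ico 0 T → U (r, y) ^ 2 + V (r, y) ^ 2 ≤ ε ^ 2
          ∧ γ * pb ≤ ρ (r, y) * (σ + ε) ^ 2) fun y hy => ?_
      obtain ⟨r1, r2, r3, r4⟩ := hK y hy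
      have cU := h.contDiffOn_U.continuousOn (t, y) ⟨htT, mem_univ y⟩
      have cV := h.contDiffOn_V.continuousOn (t, y) ⟨htT, mem_univ y⟩
      have cρ := h.contDiffOn_ρ.continuousOn (t, y) ⟨htT, mem_univ y⟩
      have l1 : ∀ᶠ z in 𝓝[Ico 0 T ×ˢ univ] (t, y), U z ^ 2 + V z ^ 2 < ε ^ 2 := by
        refine ((cU.pow 2).add (cV.pow 2)).tendsto.eventually (gt_mem_nhds ?_)
        simp only [Pi.add_apply, Pi.pow_apply, r1, r2]; simp; positivity
      have l2 : ∀ᶠ z in 𝓝[Ico 0 T ×ˢ univ] (t, y), γ * pb < ρ z * (σ + ε) ^ 2 := by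
        -- At rest `γp̄ = σ²ρ̄`, which is strictly below `(σ + ε)²ρ̄`; the slack persists nearby.
        refine (cρ.mul continuousWithinAt_const).tendsto.eventually (lt_mem_nhds ?_)
        simp only [Pi.mul_apply, r4, ← hσ2]; nlinarith [mul_pos hρb (mul_pos hσ hε), mul_pos hρb (pow_pos hε 2)]
      filter_upwards [eventually_nhdsWithin_iff.1 l1, eventually_nhdsWithin_iff.1 l2]
        with z h1 h2 hz
      exact ⟨(h1 ⟨hz, mem_univ _⟩).le, (h2 ⟨hz, mem_univ _⟩).le⟩
    obtain ⟨t', ht', hsub⟩ := mem_nhdsGT_iff_exists_Ioo_subset.1 (mem_nhdsWithin_of_mem_nhds hP)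
    obtain ⟨t₂, htt₂, ht₂⟩ := exists_between (lt_min ht' ht.2)
    have ht₂τ : t₂ ≤ τ := (ht₂.trans_le (min_le_right _ _)).le
    have huvp : ∀ r ∈ Icc t t₂, ∀ x, ‖x - a‖ < c * (τ - r) →
        U (r, x) = 0 ∧ V (r, x) = 0 ∧ p (r, x) = pb := by
      intro r hr x hx
      refine h.cone_step hγ hpb rfl (s := σ + ε) (by positivity) hε.le (c := c) (by rw [hc]; ring)
        ht.1 (ht₂τ.trans_lt hτ) ht₂τ (fun x hx => ?_) (fun r hr x hx => ?_) hr hx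
      · obtain ⟨r1, r2, r3, -⟩ := htA x hx
        exact ⟨r1, r2, r3⟩
      · refine hsub ⟨hr.1, hr.2.trans (ht₂.trans_le (min_le_left _ _))⟩ x ?_ ?_
        · rw [mem_closedBall_iff_norm]
          exact hx.le.trans (by nlinarith [hr.1])
        · exact hIcc ⟨ht.1.trans hr.1.le, hr.2.le.trans ht₂τ⟩
    refine mem_of_superset (Ioc_mem_nhdsGT htt₂) fun r hr x hx => ?_
    have hr' := Ioc_subset_Icc_self hr
    obtain ⟨r1, r2, r3⟩ := huvp r hr' x hx
    refine ⟨r1, r2, r3, ?_⟩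
    rw [h.cone_density hc0 ht.1 (ht₂τ.trans_lt hτ)
      (fun r hr x hx => ⟨(huvp r hr x hx).1, (huvp r hr x hx).2.1⟩) hr' hx]
    exact (htA x (hx.trans_le (by nlinarith [hr.1]))).2.2.2

/-- Finite speed of propagation: perturbations of the state of rest spread with at most the sound
speed `σ` of that state. -/
theorem atRest_of_radius_le (h : IsFlow T γ l ρ U V p S) {ρb pb σ R : ℝ}
    (hγ : 0 < γ) (hpb : 0 < pb) (hρb : 0 < ρb) (hσ : 0 < σ) (hσ2 : σ ^ 2 * ρb = γ * pb)
    (hR : 0 < R) (h0 : ∀ x, R ≤ ‖x‖ → AtRest ρ U V p ρb pb (0, x)) {t : ℝ} (ht : t ∈ Ico 0 T)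
    {x : Plane} (hx : R + σ * t ≤ ‖x‖) : AtRest ρ U V p ρb pb (t, x) := by
  have key : ∀ a : Plane, R + σ * t < ‖a‖ → AtRest ρ U V p ρb pb (t, a) := by
    intro a ha
    -- The apex is placed at the later time `t + ε`, so that `(t, a)` is strictly inside the cone.
    -- For small `ε` the base of the cone still misses the disc of radius `R`.
    have hlim : Tendsto (fun ε : ℝ => R + (σ + 2 * ε) * (t + ε)) (𝓝[>] 0) (𝓝 (R + σ * t)) := by
      have : ContinuousAt (fun ε : ℝ => R + (σ + 2 * ε) * (t + ε)) 0 := by fun_prop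
      simpa using this.tendsto.mono_left nhdsWithin_le_nhds
    have hlim2 : Tendsto (fun ε : ℝ => t + ε) (𝓝[>] 0) (𝓝 t) := by
      have : ContinuousAt (fun ε : ℝ => t + ε) 0 := by fun_prop
      simpa using this.tendsto.mono_left nhdsWithin_le_nhds
    obtain ⟨ε, ⟨h1, h2⟩, hε⟩ := ((hlim.eventually (gt_mem_nhds ha)).and
      (hlim2.eventually (gt_mem_nhds ht.2))).and self_mem_nhdsWithin |>.exists
    have hε : 0 < ε := hε
    refine h.atRest_cone hγ hpb hρb hσ hσ2 hε (τ := t + ε) (a := a) h2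
      (fun x hx => h0 x ?_) t ⟨ht.1, by linarith⟩ a ?_
    · have := norm_sub_norm_le a x
      rw [norm_sub_rev] at this
      linarith
    · simp; positivity
  have hr : 0 < R + σ * t := by have := mul_nonneg hσ.le ht.1; linarith
  -- Closedness of the set of rest points adds the boundary circle itself.
  have hcl : closure (Metric.closedBall (0 : Plane) (R + σ * t))ᶜ
      ⊆ {x | AtRest ρ U V p ρb pb (t, x)} :=
    closure_minimal (fun y hy => key y (by simpa using hy)) (h.isClosed_atRest_slice ρb pb ht)
  rw [closure_compl, interior_closedBall _ hr.ne'] at hcl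
  exact hcl (by simpa using hx)

end IsFlow

/-! ### Integral balance laws of the flow -/

set_option linter.unusedSimpArgs false

theorem dd_posPart_sq {f : ℝ × Plane → ℝ} {z v : ℝ × Plane} (hf : DifferentiableAt ℝ f z) :
    dd v (fun y => max (f y) 0 ^ 2) z = 2 * max (f z) 0 * dd v f z :=
  dd_comp (φ := fun s => max s 0 ^ 2) (hasDerivAt_posPart_sq _) hf

namespace IsFlow

variable {T γ l : ℝ} {ρ U V p S : ℝ × Plane → ℝ} {ρb pb r : ℝ}

/-- Density and fluxes need only vanish at the rest state; this explains the shifts by `ρb` and `pb`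
in the balances below. -/
theorem hasDerivAt_integral {F H₀ H₁ Q : ℝ × Plane → ℝ}
    (hrest : ∀ t ∈ Ico 0 T, ∀ x, r < ‖x‖ → AtRest ρ U V p ρb pb (t, x))
    (hF : ContDiffOn ℝ 1 F (Ico 0 T ×ˢ univ)) (hH₀ : ContDiffOn ℝ 1 H₀ (Ico 0 T ×ˢ univ))
    (hH₁ : ContDiffOn ℝ 1 H₁ (Ico 0 T ×ˢ univ))
    (hF0 : ∀ t ∈ Ico 0 T, ∀ x, AtRest ρ U V p ρb pb (t, x) → F (t, x) = 0)
    (hH₀0 : ∀ t ∈ Ico 0 T, ∀ x, AtRest ρ U V p ρb pb (t, x) → H₀ (t, x) = 0)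
    (hH₁0 : ∀ t ∈ Ico 0 T, ∀ x, AtRest ρ U V p ρb pb (t, x) → H₁ (t, x) = 0)
    (hQ : ∀ t ∈ Ioo 0 T, ∀ x,
      dd dirT F (t, x) + dd (dirX 0) H₀ (t, x) + dd (dirX 1) H₁ (t, x) = Q (t, x))
    {t : ℝ} (ht : t ∈ Ioo 0 T) :
    HasDerivAt (fun s => ∫ x, F (s, x)) (∫ x, Q (t, x)) t := by
  have hsub : Ioo 0 T ×ˢ (univ : Set Plane) ⊆ Ico 0 T ×ˢ univ :=
    prod_mono Ioo_subset_Ico_self subset_rfl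
  have := hasDerivAt_integral_of_balance (r := r) (hF.mono hsub) (hH₀.mono hsub) (hH₁.mono hsub)
    (fun t ht x hx => hF0 t (Ioo_subset_Ico_self ht) x (hrest t (Ioo_subset_Ico_self ht) x hx))
    (fun t ht x hx => hH₀0 t (Ioo_subset_Ico_self ht) x (hrest t (Ioo_subset_Ico_self ht) x hx))
    (fun t ht x hx => hH₁0 t (Ioo_subset_Ico_self ht) x (hrest t (Ioo_subset_Ico_self ht) x hx)) ht
  simpa only [hQ t ht] using this

theorem hasDerivAt_mass (h : IsFlow T γ l ρ U V p S)
    (hrest : ∀ t ∈ Ico 0 T, ∀ x, r < ‖x‖ → AtRest ρ U V p ρb pb (t, x))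
    {t : ℝ} (ht : t ∈ Ioo 0 T) :
    HasDerivAt (fun s => ∫ x, (ρ (s, x) - ρb)) 0 t := by
  have cρ := h.contDiffOn_ρ
  have cU := h.contDiffOn_U
  have cV := h.contDiffOn_V
  have := hasDerivAt_integral (F := fun z => ρ z - ρb) (H₀ := fun z => ρ z * U z)
    (H₁ := fun z => ρ z * V z) (Q := fun _ => 0) hrest (by fun_prop) (by fun_prop) (by fun_prop)
    (fun t _ x ⟨h1, h2, h3, h4⟩ => by simp [h1, h2, h3, h4])
    (fun t _ x ⟨h1, h2, h3, h4⟩ => by simp [h1, h2, h3, h4])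
    (fun t _ x ⟨h1, h2, h3, h4⟩ => by simp [h1, h2, h3, h4]) (fun t ht x => ?_) ht
  · simpa using this
  · have hρd := differentiableAt_of_contDiffOn_Ico h.contDiffOn_ρ ht x
    have hUd := differentiableAt_of_contDiffOn_Ico h.contDiffOn_U ht x
    have hVd := differentiableAt_of_contDiffOn_Ico h.contDiffOn_V ht x
    simp (disch := fun_prop) only [dd_sub, dd_mul, dd_const]
    linear_combination h.mass t ht x

theorem hasDerivAt_inertia (h : IsFlow T γ l ρ U V p S)
    (hrest : ∀ t ∈ Ico 0 T, ∀ x, r < ‖x‖ → AtRest ρ U V p ρb pb (t, x))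
    {t : ℝ} (ht : t ∈ Ioo 0 T) :
    HasDerivAt (fun s => ∫ x : Plane, 1 / 2 * (x 0 ^ 2 + x 1 ^ 2) * (ρ (s, x) - ρb))
      (∫ x : Plane, ρ (t, x) * (U (t, x) * x 0 + V (t, x) * x 1)) t := by
  have cρ := h.contDiffOn_ρ
  have cU := h.contDiffOn_U
  have cV := h.contDiffOn_V
  have := hasDerivAt_integral (F := fun z => 1 / 2 * (z.2 0 ^ 2 + z.2 1 ^ 2) * (ρ z - ρb))
    (H₀ := fun z => 1 / 2 * (z.2 0 ^ 2 + z.2 1 ^ 2) * (ρ z * U z))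
    (H₁ := fun z => 1 / 2 * (z.2 0 ^ 2 + z.2 1 ^ 2) * (ρ z * V z))
    (Q := fun z => ρ z * (U z * z.2 0 + V z * z.2 1))
    hrest (by fun_prop) (by fun_prop) (by fun_prop)
    (fun t _ x ⟨h1, h2, h3, h4⟩ => by simp [h1, h2, h3, h4])
    (fun t _ x ⟨h1, h2, h3, h4⟩ => by simp [h1, h2, h3, h4])
    (fun t _ x ⟨h1, h2, h3, h4⟩ => by simp [h1, h2, h3, h4]) (fun t ht x => ?_) ht
  · exact this
  · have hρd := differentiableAt_of_contDiffOn_Ico h.contDiffOn_ρ ht x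
    have hUd := differentiableAt_of_contDiffOn_Ico h.contDiffOn_U ht x
    have hVd := differentiableAt_of_contDiffOn_Ico h.contDiffOn_V ht x
    simp (disch := fun_prop) only [dd_sub, dd_add, dd_mul, dd_sq, dd_const, dd_coord, coord_dirT,
      coord_dirX_same, coord_dirX_zero_one, coord_dirX_one_zero]
    linear_combination 1 / 2 * (x 0 ^ 2 + x 1 ^ 2) * h.mass t ht x

/-- The virial identity. The flux `(p - p̄)x` contributes `2(p - p̄)` because the plane has
divergence `div x = 2`, and the Coriolis force contributes the angular momentum. -/
theorem hasDerivAt_radialMomentum (h : IsFlow T γ l ρ U V p S)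
    (hrest : ∀ t ∈ Ico 0 T, ∀ x, r < ‖x‖ → AtRest ρ U V p ρb pb (t, x))
    {t : ℝ} (ht : t ∈ Ioo 0 T) :
    HasDerivAt (fun s => ∫ x : Plane, ρ (s, x) * (U (s, x) * x 0 + V (s, x) * x 1))
      (∫ x : Plane, (ρ (t, x) * (U (t, x) ^ 2 + V (t, x) ^ 2) + 2 * (p (t, x) - pb)
        - l * (ρ (t, x) * (U (t, x) * x 1 - V (t, x) * x 0)))) t := by
  have cρ := h.contDiffOn_ρ
  have cU := h.contDiffOn_U
  have cV := h.contDiffOn_V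
  have cp := h.contDiffOn_p
  have := hasDerivAt_integral (F := fun z => ρ z * (U z * z.2 0 + V z * z.2 1))
    (H₀ := fun z => ρ z * (U z * z.2 0 + V z * z.2 1) * U z + (p z - pb) * z.2 0)
    (H₁ := fun z => ρ z * (U z * z.2 0 + V z * z.2 1) * V z + (p z - pb) * z.2 1)
    (Q := fun z => ρ z * (U z ^ 2 + V z ^ 2) + 2 * (p z - pb)
      - l * (ρ z * (U z * z.2 1 - V z * z.2 0)))
    hrest (by fun_prop) (by fun_prop) (by fun_prop)
    (fun t _ x ⟨h1, h2, h3, h4⟩ => by simp [h1, h2, h3, h4])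
    (fun t _ x ⟨h1, h2, h3, h4⟩ => by simp [h1, h2, h3, h4])
    (fun t _ x ⟨h1, h2, h3, h4⟩ => by simp [h1, h2, h3, h4]) (fun t ht x => ?_) ht
  · exact this
  · have hρd := differentiableAt_of_contDiffOn_Ico h.contDiffOn_ρ ht x
    have hUd := differentiableAt_of_contDiffOn_Ico h.contDiffOn_U ht x
    have hVd := differentiableAt_of_contDiffOn_Ico h.contDiffOn_V ht x
    have hpd := differentiableAt_of_contDiffOn_Ico h.contDiffOn_p ht x
    simp (disch := fun_prop) only [dd_sub, dd_add, dd_mul, dd_sq, dd_const, dd_coord, coord_dirT,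
      coord_dirX_same, coord_dirX_zero_one, coord_dirX_one_zero]
    linear_combination (U (t, x) * x 0 + V (t, x) * x 1) * h.mass t ht x
      + x 0 * h.momentum_U t ht x + x 1 * h.momentum_V t ht x

/-- Pressure exerts no torque, so only the Coriolis torque remains; it is `l` times the rate of
change of the moment of inertia. -/
theorem hasDerivAt_angularMomentum (h : IsFlow T γ l ρ U V p S)
    (hrest : ∀ t ∈ Ico 0 T, ∀ x, r < ‖x‖ → AtRest ρ U V p ρb pb (t, x))
    {t : ℝ} (ht : t ∈ Ioo 0 T) :
    HasDerivAt (fun s => ∫ x : Plane, ρ (s, x) * (U (s, x) * x 1 - V (s, x) * x 0))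
      (∫ x : Plane, l * (ρ (t, x) * (U (t, x) * x 0 + V (t, x) * x 1))) t := by
  have cρ := h.contDiffOn_ρ
  have cU := h.contDiffOn_U
  have cV := h.contDiffOn_V
  have cp := h.contDiffOn_p
  have := hasDerivAt_integral (F := fun z => ρ z * (U z * z.2 1 - V z * z.2 0))
    (H₀ := fun z => ρ z * (U z * z.2 1 - V z * z.2 0) * U z + (p z - pb) * z.2 1)
    (H₁ := fun z => ρ z * (U z * z.2 1 - V z * z.2 0) * V z - (p z - pb) * z.2 0)
    (Q := fun z => l * (ρ z * (U z * z.2 0 + V z * z.2 1)))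
    hrest (by fun_prop) (by fun_prop) (by fun_prop)
    (fun t _ x ⟨h1, h2, h3, h4⟩ => by simp [h1, h2, h3, h4])
    (fun t _ x ⟨h1, h2, h3, h4⟩ => by simp [h1, h2, h3, h4])
    (fun t _ x ⟨h1, h2, h3, h4⟩ => by simp [h1, h2, h3, h4]) (fun t ht x => ?_) ht
  · exact this
  · have hρd := differentiableAt_of_contDiffOn_Ico h.contDiffOn_ρ ht x
    have hUd := differentiableAt_of_contDiffOn_Ico h.contDiffOn_U ht x
    have hVd := differentiableAt_of_contDiffOn_Ico h.contDiffOn_V ht x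
    have hpd := differentiableAt_of_contDiffOn_Ico h.contDiffOn_p ht x
    simp (disch := fun_prop) only [dd_sub, dd_add, dd_mul, dd_sq, dd_const, dd_coord, coord_dirT,
      coord_dirX_same, coord_dirX_zero_one, coord_dirX_one_zero]
    linear_combination (U (t, x) * x 1 - V (t, x) * x 0) * h.mass t ht x
      + x 1 * h.momentum_U t ht x - x 0 * h.momentum_V t ht x

/-- The Coriolis force does no work. The pressure in the enthalpy flux needs no shift since the
velocity factor already vanishes at rest. -/
theorem hasDerivAt_energy (h : IsFlow T γ l ρ U V p S)
    (hrest : ∀ t ∈ Ico 0 T, ∀ x, r < ‖x‖ → AtRest ρ U V p ρb pb (t, x))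
    (hγ : γ ≠ 1) {t : ℝ} (ht : t ∈ Ioo 0 T) :
    HasDerivAt (fun s => ∫ x : Plane, (1 / 2 * (ρ (s, x) * (U (s, x) ^ 2 + V (s, x) ^ 2))
      + 1 / (γ - 1) * (p (s, x) - pb))) 0 t := by
  have cρ := h.contDiffOn_ρ
  have cU := h.contDiffOn_U
  have cV := h.contDiffOn_V
  have cp := h.contDiffOn_p
  have := hasDerivAt_integral (F := fun z => 1 / 2 * (ρ z * (U z ^ 2 + V z ^ 2))
      + 1 / (γ - 1) * (p z - pb))
    (H₀ := fun z => (1 / 2 * (ρ z * (U z ^ 2 + V z ^ 2)) + γ / (γ - 1) * p z) * U z)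
    (H₁ := fun z => (1 / 2 * (ρ z * (U z ^ 2 + V z ^ 2)) + γ / (γ - 1) * p z) * V z)
    (Q := fun _ => 0) hrest (by fun_prop) (by fun_prop) (by fun_prop)
    (fun t _ x ⟨h1, h2, h3, h4⟩ => by simp [h1, h2, h3, h4])
    (fun t _ x ⟨h1, h2, h3, h4⟩ => by simp [h1, h2, h3, h4])
    (fun t _ x ⟨h1, h2, h3, h4⟩ => by simp [h1, h2, h3, h4]) (fun t ht x => ?_) ht
  · simpa using this
  · have hρd := differentiableAt_of_contDiffOn_Ico h.contDiffOn_ρ ht x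
    have hUd := differentiableAt_of_contDiffOn_Ico h.contDiffOn_U ht x
    have hVd := differentiableAt_of_contDiffOn_Ico h.contDiffOn_V ht x
    have hpd := differentiableAt_of_contDiffOn_Ico h.contDiffOn_p ht x
    simp (disch := fun_prop) only [dd_sub, dd_add, dd_mul, dd_sq, dd_const]
    have hk : γ / (γ - 1) = 1 + 1 / (γ - 1) := by
      have := sub_ne_zero.2 hγ
      field_simp; ring
    have hk2 : 1 / (γ - 1) * γ = 1 + 1 / (γ - 1) := by rw [← hk]; ring
    rw [hk]
    generalize 1 / (γ - 1) = k at hk2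
    linear_combination 1 / 2 * (U (t, x) ^ 2 + V (t, x) ^ 2) * h.mass t ht x
      + U (t, x) * h.momentum_U t ht x + V (t, x) * h.momentum_V t ht x + k * h.pressure t ht x
      - p (t, x) * (dd (dirX 0) U (t, x) + dd (dirX 1) V (t, x)) * hk2

theorem hasDerivAt_massMoment_zero (h : IsFlow T γ l ρ U V p S)
    (hrest : ∀ t ∈ Ico 0 T, ∀ x, r < ‖x‖ → AtRest ρ U V p ρb pb (t, x))
    {t : ℝ} (ht : t ∈ Ioo 0 T) :
    HasDerivAt (fun s => ∫ x : Plane, (ρ (s, x) - ρb) * x 0)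
      (∫ x : Plane, ρ (t, x) * U (t, x)) t := by
  have cρ := h.contDiffOn_ρ
  have cU := h.contDiffOn_U
  have cV := h.contDiffOn_V
  have := hasDerivAt_integral (F := fun z => (ρ z - ρb) * z.2 0)
    (H₀ := fun z => ρ z * U z * z.2 0) (H₁ := fun z => ρ z * V z * z.2 0)
    (Q := fun z => ρ z * U z) hrest (by fun_prop) (by fun_prop) (by fun_prop)
    (fun t _ x ⟨h1, h2, h3, h4⟩ => by simp [h1, h2, h3, h4])
    (fun t _ x ⟨h1, h2, h3, h4⟩ => by simp [h1, h2, h3, h4])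
    (fun t _ x ⟨h1, h2, h3, h4⟩ => by simp [h1, h2, h3, h4]) (fun t ht x => ?_) ht
  · exact this
  · have hρd := differentiableAt_of_contDiffOn_Ico h.contDiffOn_ρ ht x
    have hUd := differentiableAt_of_contDiffOn_Ico h.contDiffOn_U ht x
    have hVd := differentiableAt_of_contDiffOn_Ico h.contDiffOn_V ht x
    simp (disch := fun_prop) only [dd_sub, dd_add, dd_mul, dd_sq, dd_const, dd_coord, coord_dirT,
      coord_dirX_same, coord_dirX_zero_one, coord_dirX_one_zero]
    linear_combination x 0 * h.mass t ht x

theorem hasDerivAt_massMoment_one (h : IsFlow T γ l ρ U V p S)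
    (hrest : ∀ t ∈ Ico 0 T, ∀ x, r < ‖x‖ → AtRest ρ U V p ρb pb (t, x))
    {t : ℝ} (ht : t ∈ Ioo 0 T) :
    HasDerivAt (fun s => ∫ x : Plane, (ρ (s, x) - ρb) * x 1)
      (∫ x : Plane, ρ (t, x) * V (t, x)) t := by
  have cρ := h.contDiffOn_ρ
  have cU := h.contDiffOn_U
  have cV := h.contDiffOn_V
  have := hasDerivAt_integral (F := fun z => (ρ z - ρb) * z.2 1)
    (H₀ := fun z => ρ z * U z * z.2 1) (H₁ := fun z => ρ z * V z * z.2 1)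
    (Q := fun z => ρ z * V z) hrest (by fun_prop) (by fun_prop) (by fun_prop)
    (fun t _ x ⟨h1, h2, h3, h4⟩ => by simp [h1, h2, h3, h4])
    (fun t _ x ⟨h1, h2, h3, h4⟩ => by simp [h1, h2, h3, h4])
    (fun t _ x ⟨h1, h2, h3, h4⟩ => by simp [h1, h2, h3, h4]) (fun t ht x => ?_) ht
  · exact this
  · have hρd := differentiableAt_of_contDiffOn_Ico h.contDiffOn_ρ ht x
    have hUd := differentiableAt_of_contDiffOn_Ico h.contDiffOn_U ht x
    have hVd := differentiableAt_of_contDiffOn_Ico h.contDiffOn_V ht x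
    simp (disch := fun_prop) only [dd_sub, dd_add, dd_mul, dd_sq, dd_const, dd_coord, coord_dirT,
      coord_dirX_same, coord_dirX_zero_one, coord_dirX_one_zero]
    linear_combination x 1 * h.mass t ht x

theorem hasDerivAt_momentum_zero (h : IsFlow T γ l ρ U V p S)
    (hrest : ∀ t ∈ Ico 0 T, ∀ x, r < ‖x‖ → AtRest ρ U V p ρb pb (t, x))
    {t : ℝ} (ht : t ∈ Ioo 0 T) :
    HasDerivAt (fun s => ∫ x : Plane, ρ (s, x) * U (s, x))
      (l * ∫ x : Plane, ρ (t, x) * V (t, x)) t := by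
  have cρ := h.contDiffOn_ρ
  have cU := h.contDiffOn_U
  have cV := h.contDiffOn_V
  have cp := h.contDiffOn_p
  have := hasDerivAt_integral (F := fun z => ρ z * U z)
    (H₀ := fun z => ρ z * U z * U z + (p z - pb)) (H₁ := fun z => ρ z * U z * V z)
    (Q := fun z => l * (ρ z * V z)) hrest (by fun_prop) (by fun_prop) (by fun_prop)
    (fun t _ x ⟨h1, h2, h3, h4⟩ => by simp [h1, h2, h3, h4])
    (fun t _ x ⟨h1, h2, h3, h4⟩ => by simp [h1, h2, h3, h4])
    (fun t _ x ⟨h1, h2, h3, h4⟩ => by simp [h1, h2, h3, h4]) (fun t ht x => ?_) ht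
  · simpa only [integral_const_mul] using this
  · have hρd := differentiableAt_of_contDiffOn_Ico h.contDiffOn_ρ ht x
    have hUd := differentiableAt_of_contDiffOn_Ico h.contDiffOn_U ht x
    have hVd := differentiableAt_of_contDiffOn_Ico h.contDiffOn_V ht x
    have hpd := differentiableAt_of_contDiffOn_Ico h.contDiffOn_p ht x
    simp (disch := fun_prop) only [dd_sub, dd_add, dd_mul, dd_const]
    linear_combination U (t, x) * h.mass t ht x + h.momentum_U t ht x

theorem hasDerivAt_momentum_one (h : IsFlow T γ l ρ U V p S)
    (hrest : ∀ t ∈ Ico 0 T, ∀ x, r < ‖x‖ → AtRest ρ U V p ρb pb (t, x))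
    {t : ℝ} (ht : t ∈ Ioo 0 T) :
    HasDerivAt (fun s => ∫ x : Plane, ρ (s, x) * V (s, x))
      (-l * ∫ x : Plane, ρ (t, x) * U (t, x)) t := by
  have cρ := h.contDiffOn_ρ
  have cU := h.contDiffOn_U
  have cV := h.contDiffOn_V
  have cp := h.contDiffOn_p
  have := hasDerivAt_integral (F := fun z => ρ z * V z)
    (H₀ := fun z => ρ z * V z * U z) (H₁ := fun z => ρ z * V z * V z + (p z - pb))
    (Q := fun z => -l * (ρ z * U z)) hrest (by fun_prop) (by fun_prop) (by fun_prop)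
    (fun t _ x ⟨h1, h2, h3, h4⟩ => by simp [h1, h2, h3, h4])
    (fun t _ x ⟨h1, h2, h3, h4⟩ => by simp [h1, h2, h3, h4])
    (fun t _ x ⟨h1, h2, h3, h4⟩ => by simp [h1, h2, h3, h4]) (fun t ht x => ?_) ht
  · simpa only [integral_const_mul] using this
  · have hρd := differentiableAt_of_contDiffOn_Ico h.contDiffOn_ρ ht x
    have hUd := differentiableAt_of_contDiffOn_Ico h.contDiffOn_U ht x
    have hVd := differentiableAt_of_contDiffOn_Ico h.contDiffOn_V ht x
    have hpd := differentiableAt_of_contDiffOn_Ico h.contDiffOn_p ht x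
    simp (disch := fun_prop) only [dd_sub, dd_add, dd_mul, dd_const]
    linear_combination V (t, x) * h.mass t ht x + h.momentum_V t ht x

theorem entropy_eq_of_atRest (h : IsFlow T γ l ρ U V p S)
    (hρb : 0 < ρb) {Sb : ℝ} (hpb : pb = Real.exp Sb * ρb ^ γ) {t : ℝ}
    (ht : t ∈ Ico 0 T) {x : Plane} (hx : AtRest ρ U V p ρb pb (t, x)) : S (t, x) = Sb := by
  have e := h.state t ht x
  rw [hx.2.2.1, hx.2.2.2, hpb] at e
  exact (Real.exp_injective (mul_right_cancel₀ (Real.rpow_pos_of_pos hρb γ).ne' e)).symm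

/-- The minimum principle for the transported entropy. -/
theorem entropy_ge (h : IsFlow T γ l ρ U V p S)
    (hrest : ∀ t ∈ Ico 0 T, ∀ x, r < ‖x‖ → AtRest ρ U V p ρb pb (t, x))
    (hρb : 0 < ρb) {Sb : ℝ} (hpb : pb = Real.exp Sb * ρb ^ γ)
    (h0 : ∀ x, Sb ≤ S (0, x)) {t : ℝ} (ht : t ∈ Ico 0 T) (x : Plane) : Sb ≤ S (t, x) := by
  have cρ := h.contDiffOn_ρ
  have cU := h.contDiffOn_U
  have cV := h.contDiffOn_V
  have cS := h.contDiffOn_S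
  have cφ : ContDiffOn ℝ 1 (fun z => max (Sb - S z) 0 ^ 2) (Ico 0 T ×ˢ univ) :=
    contDiff_posPart_sq.comp_contDiffOn (contDiffOn_const.sub cS)
  have cF : ContDiffOn ℝ 1 (fun z => ρ z * max (Sb - S z) 0 ^ 2) (Ico 0 T ×ˢ univ) := cρ.mul cφ
  have hφ0 : ∀ t ∈ Ico 0 T, ∀ x, AtRest ρ U V p ρb pb (t, x) →
      ρ (t, x) * max (Sb - S (t, x)) 0 ^ 2 = 0 := fun t ht x hx => by
    simp [h.entropy_eq_of_atRest hρb hpb ht hx]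
  -- Any function of the transported entropy, weighted by the density, is conserved. The squared
  -- positive part of `S̄ - S` is `C¹` and zero initially, so its integral stays zero.
  have hder : ∀ t ∈ Ioo 0 T,
      HasDerivAt (fun s => ∫ x : Plane, ρ (s, x) * max (Sb - S (s, x)) 0 ^ 2) 0 t := by
    intro t ht
    have := hasDerivAt_integral (F := fun z => ρ z * max (Sb - S z) 0 ^ 2)
      (H₀ := fun z => ρ z * max (Sb - S z) 0 ^ 2 * U z)
      (H₁ := fun z => ρ z * max (Sb - S z) 0 ^ 2 * V z)
      (Q := fun _ => 0) hrest cF (cF.mul cU) (cF.mul cV) hφ0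
      (fun t _ x ⟨h1, h2, h3, h4⟩ => by simp [h1])
      (fun t _ x ⟨h1, h2, h3, h4⟩ => by simp [h2]) (fun t ht x => ?_) ht
    · simpa using this
    · have hρd := differentiableAt_of_contDiffOn_Ico h.contDiffOn_ρ ht x
      have hUd := differentiableAt_of_contDiffOn_Ico h.contDiffOn_U ht x
      have hVd := differentiableAt_of_contDiffOn_Ico h.contDiffOn_V ht x
      have hSd := differentiableAt_of_contDiffOn_Ico h.contDiffOn_S ht x
      have hφd := differentiableAt_of_contDiffOn_Ico cφ ht x
      have hSd' : DifferentiableAt ℝ (fun z => Sb - S z) (t, x) := by fun_prop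
      have hk : ∀ v, dd v (fun z => max (Sb - S z) 0 ^ 2) (t, x)
          = 2 * max (Sb - S (t, x)) 0 * -dd v S (t, x) := by
        intro v
        rw [dd_posPart_sq hSd', dd_sub (differentiableAt_const _) hSd, dd_const, zero_sub]
      have hFd := hρd.fun_mul hφd
      rw [dd_mul hFd hUd, dd_mul hFd hVd, dd_mul hρd hφd, dd_mul hρd hφd, dd_mul hρd hφd, hk, hk,
        hk]
      linear_combination max (Sb - S (t, x)) 0 ^ 2 * h.mass t ht x
        - 2 * ρ (t, x) * max (Sb - S (t, x)) 0 * h.entropy t ht x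
  have hcont := continuousOn_integral_of_support cF.continuousOn
    (fun t ht x hx => hφ0 t ht x (hrest t ht x hx))
  have heq := eq_of_hasDerivAt_zero ht.1 (hcont.mono fun s hs => ⟨hs.1, hs.2.trans_lt ht.2⟩)
    fun s hs => hder s ⟨hs.1, hs.2.trans ht.2⟩
  have hz := eq_zero_of_integral_nonpos (continuous_slice cF.continuousOn ht)
    (fun x => mul_nonneg (h.ρ_pos t ht x).le (sq_nonneg _))
    (fun x hx => hφ0 t ht x (hrest t ht x hx)) (heq.le.trans (by simp [h0])) x
  have h2 := (mul_eq_zero.1 hz).resolve_left (h.ρ_pos t ht x).ne'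
  have h3 : max (Sb - S (t, x)) 0 = 0 := pow_eq_zero_iff two_ne_zero |>.1 h2
  linarith [le_max_left (Sb - S (t, x)) 0]

end IsFlow

/-! ### Moments of a classical solution over the moving disc -/

/-- Trades the moving domain for a fixed one: the excess over the far field `g` is integrated over
the whole plane, and all dependence on the radius sits in the explicit integral of `g`. -/
theorem setIntegral_ball_eq {f g : Plane → ℝ} {r : ℝ} (hf : Continuous f) (hg : Continuous g)
    (h : ∀ x, r ≤ ‖x‖ → f x = g x) :
    ∫ x in Metric.ball (0 : Plane) r, f x
      = (∫ x, (f x - g x)) + ∫ x in Metric.ball (0 : Plane) r, g x := by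
  have h1 : ∫ x in Metric.ball (0 : Plane) r, (f x - g x) = ∫ x, (f x - g x) :=
    setIntegral_eq_integral_of_forall_compl_eq_zero fun x hx => by
      rw [h x (by simpa using hx), sub_self]
  rw [← h1, integral_sub (integrableOn_ball_of_continuous hf r)
    (integrableOn_ball_of_continuous hg r)]
  ring

theorem integral_ball_const {r : ℝ} (hr : 0 ≤ r) (c : ℝ) :
    ∫ _ in Metric.ball (0 : Plane) r, c = Real.pi * r ^ 2 * c := by
  rw [setIntegral_const, volume_real_ball_plane _ hr, smul_eq_mul]

theorem normSq_plane (x : Plane) : ‖x‖ ^ 2 = x 0 ^ 2 + x 1 ^ 2 := by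
  rw [EuclideanSpace.norm_sq_eq, Fin.sum_univ_two]; simp

theorem inner_plane (x y : Plane) : inner ℝ x y = x 0 * y 0 + x 1 * y 1 := by
  rw [PiLp.inner_apply, Fin.sum_univ_two]; simp; ring

namespace CauchyData

variable {D : CauchyData}

theorem γ_pos : 0 < D.γ := zero_lt_one.trans D.one_lt_γ

theorem exp_Sbar : Real.exp D.Sbar = D.pbar * D.ρbar ^ (-D.γ) :=
  Real.exp_log (mul_pos D.pbar_pos (Real.rpow_pos_of_pos D.ρbar_pos _))

theorem pbar_eq : D.pbar = Real.exp D.Sbar * D.ρbar ^ D.γ := by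
  rw [exp_Sbar, mul_assoc, ← Real.rpow_add D.ρbar_pos]; simp

theorem σ_sq : D.σ ^ 2 = D.γ * Real.exp D.Sbar * D.ρbar ^ (D.γ - 1) := by
  have := D.γ_pos
  have := Real.rpow_pos_of_pos D.ρbar_pos (D.γ - 1)
  exact Real.sq_sqrt (by positivity)

theorem σ_sq_mul : D.σ ^ 2 * D.ρbar = D.γ * D.pbar := by
  rw [σ_sq, pbar_eq, mul_assoc, ← Real.rpow_add_one D.ρbar_pos.ne']; ring_nf

theorem σ_pos : 0 < D.σ := by
  have := D.γ_pos
  have := Real.rpow_pos_of_pos D.ρbar_pos (D.γ - 1)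
  exact Real.sqrt_pos.2 (by positivity)

theorem radius_zero : D.radius 0 = D.R := by simp [radius]

theorem radius_pos {t : ℝ} (ht : 0 ≤ t) : 0 < D.radius t := by
  have := D.R_pos
  have := D.σ_pos
  unfold radius; positivity

theorem radius_mono {s t : ℝ} (h : s ≤ t) : D.radius s ≤ D.radius t := by
  have := D.σ_pos
  unfold radius; gcongr

theorem hasDerivAt_radius (t : ℝ) : HasDerivAt D.radius D.σ t :=
  (((hasDerivAt_id t).const_mul D.σ).const_add D.R).congr_deriv (mul_one _)

theorem continuous_radius : Continuous D.radius := by unfold radius; fun_prop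

/-- The moment of inertia of the perturbation, over the whole plane. -/
noncomputable def excessG (D : CauchyData) (ρ : ℝ → Plane → ℝ) (t : ℝ) : ℝ :=
  ∫ x : Plane, 1 / 2 * (x 0 ^ 2 + x 1 ^ 2) * (ρ t x - D.ρbar)

/-- The radial momentum over the whole plane. -/
noncomputable def radialMom (ρ : ℝ → Plane → ℝ) (u : ℝ → Plane → Plane) (t : ℝ) : ℝ :=
  ∫ x : Plane, ρ t x * (u t x 0 * x 0 + u t x 1 * x 1)

/-- The angular momentum over the whole plane. -/
noncomputable def angularMom (ρ : ℝ → Plane → ℝ) (u : ℝ → Plane → Plane) (t : ℝ) : ℝ :=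
  ∫ x : Plane, ρ t x * (u t x 0 * x 1 - u t x 1 * x 0)

/-- The kinetic energy over the whole plane. -/
noncomputable def kinetic (ρ : ℝ → Plane → ℝ) (u : ℝ → Plane → Plane) (t : ℝ) : ℝ :=
  ∫ x : Plane, 1 / 2 * (ρ t x * (u t x 0 ^ 2 + u t x 1 ^ 2))

/-- The total excess of pressure. -/
noncomputable def excessP (D : CauchyData) (p : ℝ → Plane → ℝ) (t : ℝ) : ℝ := ∫ x : Plane, (p t x - D.pbar)

namespace IsClassicalSolution

variable {T : ℝ} {u : ℝ → Plane → Plane} {ρ p S : ℝ → Plane → ℝ}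

theorem atRest (h : D.IsClassicalSolution T u ρ p S) {t : ℝ} (ht : t ∈ Ico 0 T) {x : Plane}
    (hx : D.radius t ≤ ‖x‖) :
    IsFlow.AtRest (fun z => ρ z.1 z.2) (fun z => u z.1 z.2 0) (fun z => u z.1 z.2 1)
      (fun z => p z.1 z.2) D.ρbar D.pbar (t, x) := by
  refine h.isFlow.atRest_of_radius_le D.γ_pos D.pbar_pos D.ρbar_pos D.σ_pos D.σ_sq_mul D.R_pos
    (fun y hy => ?_) ht hx
  have hy' : y ∉ Metric.ball (0 : Plane) D.R := by simpa using hy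
  simp [IsFlow.AtRest, h.initial_u, h.initial_ρ, h.initial_p, D.u₀_outside y hy',
    D.ρ₀_outside y hy', D.p₀_outside y hy']

/-- One radius valid for all times below `T`, as the balance laws with a fixed support require. -/
theorem atRest_of_radius_lt (h : D.IsClassicalSolution T u ρ p S) :
    ∀ t ∈ Ico 0 T, ∀ x, D.radius T < ‖x‖ →
      IsFlow.AtRest (fun z => ρ z.1 z.2) (fun z => u z.1 z.2 0) (fun z => u z.1 z.2 1)
        (fun z => p z.1 z.2) D.ρbar D.pbar (t, x) :=
  fun _ ht _ hx => h.atRest ht ((radius_mono ht.2.le).trans hx.le)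

theorem zero_mem (h : D.IsClassicalSolution T u ρ p S) : (0 : ℝ) ∈ Ico 0 T := ⟨le_rfl, h.T_pos⟩

theorem continuous_ρ (h : D.IsClassicalSolution T u ρ p S) {t : ℝ} (ht : t ∈ Ico 0 T) :
    Continuous (ρ t) :=
  continuous_slice (f := fun z => ρ z.1 z.2) h.contDiffOn_ρ.continuousOn ht

theorem continuous_p (h : D.IsClassicalSolution T u ρ p S) {t : ℝ} (ht : t ∈ Ico 0 T) :
    Continuous (p t) :=
  continuous_slice (f := fun z => p z.1 z.2) h.contDiffOn_p.continuousOn ht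

theorem continuous_u (h : D.IsClassicalSolution T u ρ p S) {t : ℝ} (ht : t ∈ Ico 0 T) (i : Fin 2) :
    Continuous fun x => u t x i :=
  continuous_slice (f := fun z => u z.1 z.2 i) (contDiffOn_euclidean.1 h.contDiffOn_u i).continuousOn
    ht

theorem ρ_eq (h : D.IsClassicalSolution T u ρ p S) {t : ℝ} (ht : t ∈ Ico 0 T) {x : Plane}
    (hx : D.radius t ≤ ‖x‖) : ρ t x = D.ρbar := (h.atRest ht hx).2.2.2

theorem integral_ρ_ball (h : D.IsClassicalSolution T u ρ p S) {t : ℝ} (ht : t ∈ Ico 0 T) :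
    ∫ x in Metric.ball (0 : Plane) (D.radius t), ρ t x = D.totalMass t := by
  have hex : ∀ s ∈ Ico 0 T, ∫ x in Metric.ball (0 : Plane) (D.radius s), ρ s x
      = (∫ x, (ρ s x - D.ρbar)) + Real.pi * D.radius s ^ 2 * D.ρbar := fun s hs => by
    rw [setIntegral_ball_eq (h.continuous_ρ hs) continuous_const
      (fun x hx => (h.atRest hs hx).2.2.2), integral_ball_const (radius_pos hs.1).le]
  have hm0 : D.m0 = ∫ x, (ρ 0 x - D.ρbar) := by
    have h1 : ∫ x in Metric.ball (0 : Plane) D.R, (ρ 0 x - D.ρbar) = ∫ x, (ρ 0 x - D.ρbar) :=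
      setIntegral_eq_integral_of_forall_compl_eq_zero fun x hx => by
        rw [h.initial_ρ, D.ρ₀_outside x hx, sub_self]
    rw [← h1, m0, massExcess]
    simp only [h.initial_ρ]
  have cρ := h.contDiffOn_ρ
  have hc : ContinuousOn (fun s => ∫ x, (ρ s x - D.ρbar)) (Ico 0 T) :=
    continuousOn_integral_of_support (F := fun z => ρ z.1 z.2 - D.ρbar) (r := D.radius T)
      (cρ.continuousOn.sub continuousOn_const)
      (fun t ht x hx => by simp [(h.atRest_of_radius_lt t ht x hx).2.2.2])
  have := eq_of_hasDerivAt_zero ht.1 (hc.mono fun s hs => ⟨hs.1, hs.2.trans_lt ht.2⟩)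
    fun s hs => h.isFlow.hasDerivAt_mass h.atRest_of_radius_lt ⟨hs.1, hs.2.trans ht.2⟩
  rw [hex t ht, this, ← hm0, totalMass]; ring

theorem G_eq (h : D.IsClassicalSolution T u ρ p S) {t : ℝ} (ht : t ∈ Ico 0 T) :
    D.G ρ t = D.excessG ρ t + Real.pi * D.ρbar / 4 * D.radius t ^ 4 := by
  have hρ := h.continuous_ρ ht
  rw [G, momentG, setIntegral_ball_eq (g := fun x => ‖x‖ ^ 2 * D.ρbar) (by fun_prop) (by fun_prop)
    (fun x hx => by rw [h.ρ_eq ht hx]), integral_mul_const,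
    integral_ball_normSq (radius_pos ht.1).le, excessG, mul_add, ← integral_const_mul]
  congr 1
  · congr 1; ext x; rw [normSq_plane]; ring
  · ring

theorem hasDerivAt_excessG (h : D.IsClassicalSolution T u ρ p S) {t : ℝ} (ht : t ∈ Ioo 0 T) :
    HasDerivAt (D.excessG ρ) (radialMom ρ u t) t :=
  h.isFlow.hasDerivAt_inertia h.atRest_of_radius_lt ht

theorem continuousOn_excessG (h : D.IsClassicalSolution T u ρ p S) :
    ContinuousOn (D.excessG ρ) (Ico 0 T) := by
  have cρ := h.contDiffOn_ρ.continuousOn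
  exact continuousOn_integral_of_support
    (F := fun z => 1 / 2 * (z.2 0 ^ 2 + z.2 1 ^ 2) * (ρ z.1 z.2 - D.ρbar)) (r := D.radius T)
    (by fun_prop) (fun t ht x hx => by simp [(h.atRest_of_radius_lt t ht x hx).2.2.2])

theorem continuousOn_u (h : D.IsClassicalSolution T u ρ p S) (i : Fin 2) :
    ContinuousOn (fun z : ℝ × Plane => u z.1 z.2 i) (Ico 0 T ×ˢ univ) :=
  (contDiffOn_euclidean.1 h.contDiffOn_u i).continuousOn

theorem u_eq_zero (h : D.IsClassicalSolution T u ρ p S) {t : ℝ} (ht : t ∈ Ico 0 T) {x : Plane}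
    (hx : D.radius t ≤ ‖x‖) (i : Fin 2) : u t x i = 0 := by
  have := h.atRest ht hx
  fin_cases i
  · exact this.1
  · exact this.2.1

theorem continuousOn_radialMom (h : D.IsClassicalSolution T u ρ p S) :
    ContinuousOn (radialMom ρ u) (Ico 0 T) := by
  have cρ := h.contDiffOn_ρ.continuousOn
  have c0 := h.continuousOn_u 0
  have c1 := h.continuousOn_u 1
  exact continuousOn_integral_of_support
    (F := fun z => ρ z.1 z.2 * (u z.1 z.2 0 * z.2 0 + u z.1 z.2 1 * z.2 1)) (r := D.radius T)
    (by fun_prop) (fun t ht x hx => by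
      simp [h.u_eq_zero ht ((radius_mono ht.2.le).trans hx.le)])

theorem continuousOn_angularMom (h : D.IsClassicalSolution T u ρ p S) :
    ContinuousOn (angularMom ρ u) (Ico 0 T) := by
  have cρ := h.contDiffOn_ρ.continuousOn
  have c0 := h.continuousOn_u 0
  have c1 := h.continuousOn_u 1
  exact continuousOn_integral_of_support
    (F := fun z => ρ z.1 z.2 * (u z.1 z.2 0 * z.2 1 - u z.1 z.2 1 * z.2 0)) (r := D.radius T)
    (by fun_prop) (fun t ht x hx => by
      simp [h.u_eq_zero ht ((radius_mono ht.2.le).trans hx.le)])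

theorem radialMom_zero (h : D.IsClassicalSolution T u ρ p S) : radialMom ρ u 0 = D.F₁0 := by
  have h1 : ∫ x in Metric.ball (0 : Plane) D.R, ρ 0 x * (u 0 x 0 * x 0 + u 0 x 1 * x 1)
      = radialMom ρ u 0 :=
    setIntegral_eq_integral_of_forall_compl_eq_zero fun x hx => by
      rw [h.initial_u, D.u₀_outside x hx]; simp
  rw [← h1, F₁0, momentF₁]
  simp only [h.initial_u, h.initial_ρ, inner_plane]

theorem angularMom_zero (h : D.IsClassicalSolution T u ρ p S) : angularMom ρ u 0 = D.F₂0 := by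
  have h1 : ∫ x in Metric.ball (0 : Plane) D.R, ρ 0 x * (u 0 x 0 * x 1 - u 0 x 1 * x 0)
      = angularMom ρ u 0 :=
    setIntegral_eq_integral_of_forall_compl_eq_zero fun x hx => by
      rw [h.initial_u, D.u₀_outside x hx]; simp
  rw [← h1, F₂0, momentF₂]
  simp only [h.initial_u, h.initial_ρ, inner_plane, perp]
  simp [sub_eq_add_neg]

theorem excessG_zero (h : D.IsClassicalSolution T u ρ p S) :
    D.excessG ρ 0 = D.G0 - Real.pi * D.ρbar / 4 * D.R ^ 4 := by
  have h1 := h.G_eq h.zero_mem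
  rw [radius_zero] at h1
  have h2 : D.G ρ 0 = D.G0 := by
    rw [G, G0, radius_zero]; congr 1; ext x; exact h.initial_ρ x
  linarith

/-- `F₂ - l·excessG` is constant: the Coriolis torque is an exact time derivative. -/
theorem angularMom_eq (h : D.IsClassicalSolution T u ρ p S) {t : ℝ} (ht : t ∈ Ico 0 T) :
    angularMom ρ u t = D.F₂0 + D.l * (D.excessG ρ t - D.excessG ρ 0) := by
  have hsub : Icc 0 t ⊆ Ico 0 T := fun s hs => ⟨hs.1, hs.2.trans_lt ht.2⟩
  have := eq_of_hasDerivAt_zero (f := fun s => angularMom ρ u s - D.l * D.excessG ρ s) ht.1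
    ((h.continuousOn_angularMom.mono hsub).sub
      (continuousOn_const.mul (h.continuousOn_excessG.mono hsub))) fun s hs => by
    have hs' : s ∈ Ioo 0 T := ⟨hs.1, hs.2.trans ht.2⟩
    have h1 := h.isFlow.hasDerivAt_angularMomentum h.atRest_of_radius_lt hs'
    rw [integral_const_mul] at h1
    have h2 := (h.hasDerivAt_excessG hs').const_mul D.l
    have h3 := h1.sub h2
    exact h3.congr_deriv (sub_self _)
  rw [h.angularMom_zero] at this
  linarith

theorem kinetic_nonneg (h : D.IsClassicalSolution T u ρ p S) {t : ℝ} (ht : t ∈ Ico 0 T) :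
    0 ≤ kinetic ρ u t :=
  integral_nonneg fun x => by have := h.ρ_pos t ht x; simp only [Pi.zero_apply]; positivity

theorem integrable_kinetic (h : D.IsClassicalSolution T u ρ p S) {t : ℝ} (ht : t ∈ Ico 0 T) :
    Integrable fun x : Plane => 1 / 2 * (ρ t x * (u t x 0 ^ 2 + u t x 1 ^ 2)) := by
  have c1 := h.continuous_ρ ht
  have c2 := h.continuous_u ht 0
  have c3 := h.continuous_u ht 1
  exact integrable_of_eq_zero_outside (r := D.radius t)
    (continuous_const.mul (c1.mul ((c2.pow 2).add (c3.pow 2))))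
    fun x hx => by simp [h.u_eq_zero ht hx.le]

theorem integrable_excessP (h : D.IsClassicalSolution T u ρ p S) {t : ℝ} (ht : t ∈ Ico 0 T) :
    Integrable fun x : Plane => p t x - D.pbar :=
  integrable_of_eq_zero_outside (r := D.radius t) ((h.continuous_p ht).sub continuous_const)
    fun x hx => by
      have : p t x = D.pbar := (h.atRest ht hx.le).2.2.1
      simp [this]

theorem energy_eq (h : D.IsClassicalSolution T u ρ p S) {t : ℝ} (ht : t ∈ Ico 0 T) :
    kinetic ρ u t + 1 / (D.γ - 1) * D.excessP p t = D.e0 := by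
  have cρ := h.contDiffOn_ρ.continuousOn
  have cp := h.contDiffOn_p.continuousOn
  have c0 := h.continuousOn_u 0
  have c1 := h.continuousOn_u 1
  set F : ℝ × Plane → ℝ := fun z => 1 / 2 * (ρ z.1 z.2 * (u z.1 z.2 0 ^ 2 + u z.1 z.2 1 ^ 2))
      + 1 / (D.γ - 1) * (p z.1 z.2 - D.pbar) with hF
  have hc := continuousOn_integral_of_support (A := Ico 0 T) (F := F) (r := D.radius T)
    (by fun_prop) (fun t ht x hx => by
      obtain ⟨h1, h2, h3, h4⟩ := h.atRest_of_radius_lt t ht x hx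
      simp only at h1 h2 h3 h4
      simp [hF, h1, h2, h3, h4])
  have heq := eq_of_hasDerivAt_zero ht.1 (hc.mono fun s hs => ⟨hs.1, hs.2.trans_lt ht.2⟩)
    fun s hs => h.isFlow.hasDerivAt_energy h.atRest_of_radius_lt D.one_lt_γ.ne'
      ⟨hs.1, hs.2.trans ht.2⟩
  have hsplit : ∀ s ∈ Ico 0 T, ∫ x, F (s, x)
      = kinetic ρ u s + 1 / (D.γ - 1) * D.excessP p s := fun s hs => by
    rw [kinetic, excessP, ← integral_const_mul]
    exact integral_add (h.integrable_kinetic hs) ((h.integrable_excessP hs).const_mul _)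
  rw [← hsplit t ht, heq, hsplit 0 h.zero_mem, e0, energyExcess, kineticEnergy]
  have h1 : ∫ x in Metric.ball (0 : Plane) D.R, (p 0 x - D.pbar) = D.excessP p 0 :=
    setIntegral_eq_integral_of_forall_compl_eq_zero fun x hx => by
      rw [h.initial_p, D.p₀_outside x hx, sub_self]
  have h2 : ∫ x in Metric.ball (0 : Plane) D.R, 1 / 2 * (ρ 0 x * (u 0 x 0 ^ 2 + u 0 x 1 ^ 2))
      = kinetic ρ u 0 :=
    setIntegral_eq_integral_of_forall_compl_eq_zero fun x hx => by
      rw [h.initial_u, D.u₀_outside x hx]; simp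
  rw [← h1, ← h2, integral_const_mul]
  simp only [h.initial_p, h.initial_ρ, h.initial_u, normSq_plane]

theorem hasDerivAt_radialMom (h : D.IsClassicalSolution T u ρ p S) {t : ℝ} (ht : t ∈ Ioo 0 T) :
    HasDerivAt (radialMom ρ u) (2 * kinetic ρ u t + 2 * D.excessP p t
      - D.l * (D.F₂0 + D.l * (D.excessG ρ t - D.excessG ρ 0))) t := by
  have ht' := Ioo_subset_Ico_self ht
  have h1 := h.isFlow.hasDerivAt_radialMomentum h.atRest_of_radius_lt ht
  refine h1.congr_deriv ?_
  have c1 := h.continuous_ρ ht'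
  have c2 := h.continuous_u ht' 0
  have c3 := h.continuous_u ht' 1
  have i1 := (h.integrable_kinetic ht').const_mul 2
  have i2 := (h.integrable_excessP ht').const_mul 2
  have i3 : Integrable fun x : Plane => D.l * (ρ t x * (u t x 0 * x 1 - u t x 1 * x 0)) :=
    integrable_of_eq_zero_outside (r := D.radius t)
      (continuous_const.mul (c1.mul ((c2.mul (by fun_prop)).sub (c3.mul (by fun_prop)))))
      fun x hx => by simp [h.u_eq_zero ht' hx.le]
  have e₁ := integral_add i1 i2
  have e₂ := integral_sub (i1.add i2) i3
  simp only [Pi.add_apply, integral_const_mul] at e₁ e₂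
  rw [← h.angularMom_eq ht']
  refine Eq.trans ?_ (e₂.trans ?_)
  · congr 1; ext x; ring
  · rw [e₁, kinetic, excessP, angularMom, integral_const_mul]

end IsClassicalSolution

end CauchyData

/-! ### Momentum and centre of mass -/

namespace CauchyData

variable {D : CauchyData}

theorem continuous_I₁ : Continuous D.I₁ := by unfold I₁; fun_prop

theorem continuous_I₂ : Continuous D.I₂ := by unfold I₂; fun_prop

theorem hasDerivAt_P₁ (t : ℝ) : HasDerivAt D.P₁ (D.I₁ t) t :=
  (intervalIntegral.integral_hasDerivAt_right (continuous_I₁.intervalIntegrable _ _)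
    continuous_I₁.stronglyMeasurable.stronglyMeasurableAtFilter
    continuous_I₁.continuousAt).const_add _

theorem hasDerivAt_P₂ (t : ℝ) : HasDerivAt D.P₂ (D.I₂ t) t :=
  (intervalIntegral.integral_hasDerivAt_right (continuous_I₂.intervalIntegrable _ _)
    continuous_I₂.stronglyMeasurable.stronglyMeasurableAtFilter
    continuous_I₂.continuousAt).const_add _

/-- The components of a vector that rotates with angular velocity `-l`. -/
theorem rotation_solution {J₁ J₂ : ℝ → ℝ} {l t : ℝ} (ht : 0 ≤ t)
    (c₁ : ContinuousOn J₁ (Icc 0 t)) (c₂ : ContinuousOn J₂ (Icc 0 t))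
    (d₁ : ∀ s ∈ Ioo 0 t, HasDerivAt J₁ (l * J₂ s) s)
    (d₂ : ∀ s ∈ Ioo 0 t, HasDerivAt J₂ (-l * J₁ s) s) :
    J₁ t = J₁ 0 * Real.cos (l * t) + J₂ 0 * Real.sin (l * t) ∧
      J₂ t = J₂ 0 * Real.cos (l * t) - J₁ 0 * Real.sin (l * t) := by
  have dc : ∀ s, HasDerivAt (fun s => Real.cos (l * s)) (-Real.sin (l * s) * (l * 1)) s := fun s =>
    ((hasDerivAt_id s).const_mul l).cos
  have ds : ∀ s, HasDerivAt (fun s => Real.sin (l * s)) (Real.cos (l * s) * (l * 1)) s := fun s =>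
    ((hasDerivAt_id s).const_mul l).sin
  have cc : ContinuousOn (fun s => Real.cos (l * s)) (Icc 0 t) := by fun_prop
  have cs : ContinuousOn (fun s => Real.sin (l * s)) (Icc 0 t) := by fun_prop
  -- Rotating the vector back by the angle `lt` yields two constants; `hA` and `hB` are its
  -- components.
  have hA := eq_of_hasDerivAt_zero
    (f := fun s => J₁ s * Real.cos (l * s) - J₂ s * Real.sin (l * s)) ht
    ((c₁.mul cc).sub (c₂.mul cs)) fun s hs =>
      (((d₁ s hs).mul (dc s)).sub ((d₂ s hs).mul (ds s))).congr_deriv (by ring)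
  have hB := eq_of_hasDerivAt_zero
    (f := fun s => J₁ s * Real.sin (l * s) + J₂ s * Real.cos (l * s)) ht
    ((c₁.mul cs).add (c₂.mul cc)) fun s hs =>
      (((d₁ s hs).mul (ds s)).add ((d₂ s hs).mul (dc s))).congr_deriv (by ring)
  simp only [mul_zero, Real.cos_zero, Real.sin_zero, mul_one, sub_zero, zero_add] at hA hB
  have h1 := Real.sin_sq_add_cos_sq (l * t)
  constructor
  · linear_combination Real.cos (l * t) * hA + Real.sin (l * t) * hB - J₁ t * h1
  · linear_combination Real.cos (l * t) * hB - Real.sin (l * t) * hA - J₂ t * h1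

namespace IsClassicalSolution

variable {T : ℝ} {u : ℝ → Plane → Plane} {ρ p S : ℝ → Plane → ℝ}

theorem continuousOn_momentum (h : D.IsClassicalSolution T u ρ p S) (i : Fin 2) :
    ContinuousOn (fun s => ∫ x : Plane, ρ s x * u s x i) (Ico 0 T) :=
  continuousOn_integral_of_support (F := fun z => ρ z.1 z.2 * u z.1 z.2 i) (r := D.radius T)
    (h.contDiffOn_ρ.continuousOn.mul (h.continuousOn_u i))
    (fun t ht x hx => by simp [h.u_eq_zero ht ((radius_mono ht.2.le).trans hx.le)])

theorem momentum_zero (h : D.IsClassicalSolution T u ρ p S) (i : Fin 2) :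
    ∫ x : Plane, ρ 0 x * u 0 x i = D.I0 i := by
  have h1 : ∫ x in Metric.ball (0 : Plane) D.R, ρ 0 x * u 0 x i = ∫ x : Plane, ρ 0 x * u 0 x i :=
    setIntegral_eq_integral_of_forall_compl_eq_zero fun x hx => by
      rw [h.initial_u, D.u₀_outside x hx]; simp
  rw [← h1, I0, momentum]
  simp only [h.initial_ρ, h.initial_u]

theorem momentum_eq_I (h : D.IsClassicalSolution T u ρ p S) {t : ℝ} (ht : t ∈ Ico 0 T) :
    ∫ x : Plane, ρ t x * u t x 0 = D.I₁ t ∧ ∫ x : Plane, ρ t x * u t x 1 = D.I₂ t := by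
  have hsub : Icc 0 t ⊆ Ico 0 T := fun s hs => ⟨hs.1, hs.2.trans_lt ht.2⟩
  have := rotation_solution ht.1 ((h.continuousOn_momentum 0).mono hsub)
    ((h.continuousOn_momentum 1).mono hsub)
    (fun s hs => h.isFlow.hasDerivAt_momentum_zero h.atRest_of_radius_lt
      ⟨hs.1, hs.2.trans ht.2⟩)
    (fun s hs => h.isFlow.hasDerivAt_momentum_one h.atRest_of_radius_lt
      ⟨hs.1, hs.2.trans ht.2⟩)
  simpa only [h.momentum_zero, I₁, I₂] using this

theorem continuousOn_excessMoment (h : D.IsClassicalSolution T u ρ p S) (i : Fin 2) :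
    ContinuousOn (fun s => ∫ x : Plane, (ρ s x - D.ρbar) * x i) (Ico 0 T) := by
  have cρ := h.contDiffOn_ρ.continuousOn
  exact continuousOn_integral_of_support (F := fun z => (ρ z.1 z.2 - D.ρbar) * z.2 i)
    (r := D.radius T) (by fun_prop)
    (fun t ht x hx => by simp [h.ρ_eq ht ((radius_mono ht.2.le).trans hx.le)])

theorem massMoment_eq (h : D.IsClassicalSolution T u ρ p S) {t : ℝ} (ht : t ∈ Ico 0 T)
    (i : Fin 2) : ∫ x in Metric.ball (0 : Plane) (D.radius t), ρ t x * x i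
      = ∫ x : Plane, (ρ t x - D.ρbar) * x i := by
  have hρ := h.continuous_ρ ht
  rw [setIntegral_ball_eq (g := fun x => D.ρbar * x i) (by fun_prop) (by fun_prop)
    (fun x hx => by rw [h.ρ_eq ht hx]), integral_const_mul, integral_ball_coord]
  simp only [← sub_mul]; ring

theorem excessMoment_zero (h : D.IsClassicalSolution T u ρ p S) (i : Fin 2) :
    ∫ x : Plane, (ρ 0 x - D.ρbar) * x i = D.P0 i := by
  rw [← h.massMoment_eq h.zero_mem, radius_zero, P0, massMoment]
  simp only [h.initial_ρ]

theorem massMoment_eq_P (h : D.IsClassicalSolution T u ρ p S) {t : ℝ} (ht : t ∈ Ico 0 T) :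
    ∫ x in Metric.ball (0 : Plane) (D.radius t), ρ t x * x 0 = D.P₁ t ∧
      ∫ x in Metric.ball (0 : Plane) (D.radius t), ρ t x * x 1 = D.P₂ t := by
  have hsub : Icc 0 t ⊆ Ico 0 T := fun s hs => ⟨hs.1, hs.2.trans_lt ht.2⟩
  have c₁ : Continuous D.P₁ := continuous_iff_continuousAt.2 fun t => (hasDerivAt_P₁ t).continuousAt
  have c₂ : Continuous D.P₂ := continuous_iff_continuousAt.2 fun t => (hasDerivAt_P₂ t).continuousAt
  have h1 := eq_of_hasDerivAt_zero
    (f := fun s => (∫ x : Plane, (ρ s x - D.ρbar) * x 0) - D.P₁ s) ht.1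
    (((h.continuousOn_excessMoment 0).mono hsub).sub c₁.continuousOn) fun s hs => by
      have hs' : s ∈ Ioo 0 T := ⟨hs.1, hs.2.trans ht.2⟩
      have d := h.isFlow.hasDerivAt_massMoment_zero h.atRest_of_radius_lt hs'
      refine (d.sub (hasDerivAt_P₁ s)).congr_deriv ?_
      rw [← (h.momentum_eq_I (Ioo_subset_Ico_self hs')).1, sub_self]
  have h2 := eq_of_hasDerivAt_zero
    (f := fun s => (∫ x : Plane, (ρ s x - D.ρbar) * x 1) - D.P₂ s) ht.1
    (((h.continuousOn_excessMoment 1).mono hsub).sub c₂.continuousOn) fun s hs => by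
      have hs' : s ∈ Ioo 0 T := ⟨hs.1, hs.2.trans ht.2⟩
      have d := h.isFlow.hasDerivAt_massMoment_one h.atRest_of_radius_lt hs'
      refine (d.sub (hasDerivAt_P₂ s)).congr_deriv ?_
      rw [← (h.momentum_eq_I (Ioo_subset_Ico_self hs')).2, sub_self]
  have z₁ : D.P₁ 0 = D.P0 0 := by simp [P₁]
  have z₂ : D.P₂ 0 = D.P0 1 := by simp [P₂]
  simp only [h.excessMoment_zero, z₁, z₂] at h1 h2
  rw [h.massMoment_eq ht, h.massMoment_eq ht]
  constructor <;> linarith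

/-! ### Lower bounds for the pressure -/

theorem entropy_ge (h : D.IsClassicalSolution T u ρ p S) (hS : ∀ x, D.Sbar ≤ D.S₀ x) {t : ℝ}
    (ht : t ∈ Ico 0 T) (x : Plane) : D.Sbar ≤ S t x := by
  refine h.isFlow.entropy_ge h.atRest_of_radius_lt D.ρbar_pos D.pbar_eq (fun x => ?_) ht x
  have e := h.state_eq 0 h.zero_mem x
  rw [h.initial_ρ, h.initial_p] at e
  refine (hS x).trans_eq ?_
  rw [S₀, e, mul_assoc, ← Real.rpow_add (D.ρ₀_pos x)]
  simp

theorem exp_Sbar_mul_rpow_le (h : D.IsClassicalSolution T u ρ p S) (hS : ∀ x, D.Sbar ≤ D.S₀ x)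
    {t : ℝ} (ht : t ∈ Ico 0 T) (x : Plane) : Real.exp D.Sbar * ρ t x ^ D.γ ≤ p t x := by
  rw [h.state_eq t ht x]
  have := Real.rpow_nonneg (h.ρ_pos t ht x).le D.γ
  gcongr
  exact h.entropy_ge hS ht x

/-- Bernoulli's inequality for `(ρ/ρ̄)^γ`: the graph of `e^S̄ ρ^γ` lies above its tangent at `ρ̄`,
whose slope is `σ²`. -/
theorem pressure_excess_ge (h : D.IsClassicalSolution T u ρ p S) (hS : ∀ x, D.Sbar ≤ D.S₀ x)
    {t : ℝ} (ht : t ∈ Ico 0 T) (x : Plane) :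
    D.σ ^ 2 * (ρ t x - D.ρbar) ≤ p t x - D.pbar := by
  have hρ := h.ρ_pos t ht x
  have hb := D.ρbar_pos
  have h1 : 1 + D.γ * (ρ t x / D.ρbar - 1) ≤ (1 + (ρ t x / D.ρbar - 1)) ^ D.γ :=
    one_add_mul_self_le_rpow_one_add (by have := div_pos hρ hb; linarith) D.one_lt_γ.le
  rw [add_sub_cancel, Real.div_rpow hρ.le hb.le] at h1
  have h2 := mul_le_mul_of_nonneg_left h1 D.pbar_pos.le
  have hbγ := Real.rpow_pos_of_pos hb D.γ
  have h3 : D.pbar * (ρ t x ^ D.γ / D.ρbar ^ D.γ) = Real.exp D.Sbar * ρ t x ^ D.γ := by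
    rw [pbar_eq]; field_simp
  have h4 : D.pbar * (1 + D.γ * (ρ t x / D.ρbar - 1))
      = D.pbar + D.σ ^ 2 * (ρ t x - D.ρbar) := by
    have : D.σ ^ 2 = D.γ * D.pbar / D.ρbar := by rw [← D.σ_sq_mul]; field_simp
    rw [this]; field_simp
  have := h.exp_Sbar_mul_rpow_le hS ht x
  linarith

theorem integrable_excess_ρ (h : D.IsClassicalSolution T u ρ p S) {t : ℝ} (ht : t ∈ Ico 0 T) :
    Integrable fun x : Plane => ρ t x - D.ρbar :=
  integrable_of_eq_zero_outside (r := D.radius t) ((h.continuous_ρ ht).sub continuous_const)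
    fun x hx => by simp [h.ρ_eq ht hx.le]

theorem integral_excess_ρ (h : D.IsClassicalSolution T u ρ p S) {t : ℝ} (ht : t ∈ Ico 0 T) :
    ∫ x, (ρ t x - D.ρbar) = D.m0 := by
  have h1 := h.integral_ρ_ball ht
  rw [setIntegral_ball_eq (h.continuous_ρ ht) continuous_const (fun x hx => h.ρ_eq ht hx),
    integral_ball_const (radius_pos ht.1).le, totalMass] at h1
  linarith

theorem excessP_ge (h : D.IsClassicalSolution T u ρ p S) (hS : ∀ x, D.Sbar ≤ D.S₀ x)
    {t : ℝ} (ht : t ∈ Ico 0 T) : D.σ ^ 2 * D.m0 ≤ D.excessP p t := by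
  rw [← h.integral_excess_ρ ht, ← integral_const_mul]
  exact integral_mono ((h.integrable_excess_ρ ht).const_mul _) (h.integrable_excessP ht)
    (h.pressure_excess_ge hS ht)

end IsClassicalSolution

end CauchyData

/-! ### Non-concentration of mass and the uniform gap -/

/-- A bound for the mass in a disc by a weighted mass, when the weight is small only on a set of
small area and the density is controlled by `N + k`. -/
theorem integral_ball_le_of_weight {ρ w k : Plane → ℝ} {r δ N A : ℝ} (hρ : Continuous ρ)
    (hw : Continuous w) (hk : Continuous k) (hρ0 : ∀ x, 0 ≤ ρ x)
    (hw0 : ∀ x ∈ Metric.ball (0 : Plane) r, 0 ≤ w x) (hk0 : ∀ x, 0 ≤ k x) (hδ : 0 < δ)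
    (hN : 0 ≤ N) (hle : ∀ x, ρ x ≤ N + k x)
    (hA : volume.real (Metric.ball (0 : Plane) r ∩ {x | w x < δ}) ≤ A) :
    ∫ x in Metric.ball (0 : Plane) r, ρ x
      ≤ δ⁻¹ * (∫ x in Metric.ball (0 : Plane) r, ρ x * w x) + N * A
        + ∫ x in Metric.ball (0 : Plane) r, k x := by
  have hm : MeasurableSet {x | w x < δ} := (isOpen_lt hw continuous_const).measurableSet
  have i1 : IntegrableOn (fun x => δ⁻¹ * (ρ x * w x)) (Metric.ball 0 r) :=
    integrableOn_ball_of_continuous (by fun_prop) r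
  have i2 : IntegrableOn ({x | w x < δ}.indicator fun _ => N) (Metric.ball (0 : Plane) r) :=
    (integrableOn_ball_of_continuous continuous_const r).indicator hm
  have i3 : IntegrableOn k (Metric.ball 0 r) := integrableOn_ball_of_continuous hk r
  have e2 : ∫ x in Metric.ball (0 : Plane) r, {x | w x < δ}.indicator (fun _ => N) x
      = volume.real (Metric.ball (0 : Plane) r ∩ {x | w x < δ}) * N := by
    rw [setIntegral_indicator hm, setIntegral_const, smul_eq_mul]
  calc ∫ x in Metric.ball (0 : Plane) r, ρ x
      ≤ ∫ x in Metric.ball (0 : Plane) r,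
          (δ⁻¹ * (ρ x * w x) + {x | w x < δ}.indicator (fun _ => N) x + k x) := by
        refine setIntegral_mono_on (integrableOn_ball_of_continuous hρ r) ((i1.add i2).add i3)
          Metric.isOpen_ball.measurableSet fun x hx => ?_
        -- Where `w ≥ δ` the weighted mass controls `ρ`; elsewhere `ρ ≤ N + k` and the area is
        -- small.
        by_cases hxw : w x < δ
        · rw [indicator_of_mem (show x ∈ {x | w x < δ} from hxw)]
          have := mul_nonneg (inv_nonneg.2 hδ.le) (mul_nonneg (hρ0 x) (hw0 x hx))
          linarith [hle x]
        · rw [indicator_of_notMem (show x ∉ {x | w x < δ} from hxw)]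
          have : ρ x ≤ δ⁻¹ * (ρ x * w x) := by
            rw [inv_mul_eq_div, le_div_iff₀ hδ]
            exact mul_le_mul_of_nonneg_left (not_lt.1 hxw) (hρ0 x)
          linarith [hk0 x]
    _ = δ⁻¹ * (∫ x in Metric.ball (0 : Plane) r, ρ x * w x)
        + volume.real (Metric.ball (0 : Plane) r ∩ {x | w x < δ}) * N
        + ∫ x in Metric.ball (0 : Plane) r, k x := by
        have e3 := integral_add (i1.add i2) i3
        simp only [Pi.add_apply] at e3
        rw [e3, integral_add i1 i2, e2, integral_const_mul]
    _ ≤ _ := by rw [mul_comm N A]; gcongr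

theorem volume_inter_normSq_sub_lt (c : Plane) (r : ℝ) {δ : ℝ} (hδ : 0 ≤ δ) :
    volume.real (Metric.ball (0 : Plane) r ∩ {x | ‖x - c‖ ^ 2 < δ}) ≤ Real.pi * δ := by
  have hsub : Metric.ball (0 : Plane) r ∩ {x | ‖x - c‖ ^ 2 < δ} ⊆ Metric.ball c (Real.sqrt δ) :=
    fun x hx => mem_ball_iff_norm.2 (Real.lt_sqrt_of_sq_lt hx.2)
  refine (measureReal_mono hsub Metric.isBounded_ball.measure_lt_top.ne).trans_eq ?_
  rw [volume_real_ball_plane _ (Real.sqrt_nonneg _), Real.sq_sqrt hδ]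

/-- The set lies in the annulus between the radii `√(r² - δ)` and `r`, whose area is exactly `πδ`.
-/
theorem volume_annulus_le {r δ : ℝ} (hr : 0 ≤ r) (hδ0 : 0 ≤ δ) (hδ : δ ≤ r ^ 2) :
    volume.real (Metric.ball (0 : Plane) r ∩ {x | r ^ 2 - ‖x‖ ^ 2 < δ}) ≤ Real.pi * δ := by
  have hs := Real.sq_sqrt (sub_nonneg.2 hδ)
  set s := Real.sqrt (r ^ 2 - δ) with hsdef
  have hs0 : 0 ≤ s := Real.sqrt_nonneg _
  have hsr : s ≤ r := Real.sqrt_le_iff.2 ⟨hr, by linarith⟩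
  have hsub : Metric.ball (0 : Plane) r ∩ {x | r ^ 2 - ‖x‖ ^ 2 < δ}
      ⊆ Metric.ball (0 : Plane) r \ Metric.ball 0 s := by
    rintro x ⟨hx, hx'⟩
    refine ⟨hx, fun hxs => ?_⟩
    rw [mem_ball_zero_iff] at hxs
    have := pow_lt_pow_left₀ hxs (norm_nonneg x) two_ne_zero
    rw [mem_ofPred_eq] at hx'
    linarith
  refine (measureReal_mono hsub
    (Metric.isBounded_ball.subset sdiff_subset).measure_lt_top.ne).trans_eq ?_
  rw [measureReal_sdiff (Metric.ball_subset_ball hsr) Metric.isOpen_ball.measurableSet,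
    volume_real_ball_plane _ hr, volume_real_ball_plane _ hs0, hs]
  ring

namespace CauchyData

variable {D : CauchyData}

theorem totalMass_mono {s t : ℝ} (hs : 0 ≤ s) (h : s ≤ t) : D.totalMass s ≤ D.totalMass t := by
  have h1 := D.radius_mono h
  have h2 := D.radius_pos hs
  have h3 := D.ρbar_pos
  have := Real.pi_pos
  unfold totalMass
  gcongr

theorem totalMass_zero_pos : 0 < D.totalMass 0 := by
  have h1 : D.totalMass 0 = ∫ x in Metric.ball (0 : Plane) D.R, D.ρ₀ x := by
    rw [totalMass, radius_zero, m0, massExcess, integral_sub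
      (integrableOn_ball_of_continuous D.contDiff_ρ₀.continuous _)
      (integrableOn_ball_of_continuous continuous_const _), integral_ball_const D.R_pos.le]
    ring
  rw [h1, setIntegral_pos_iff_support_of_nonneg_ae (ae_of_all _ fun x => (D.ρ₀_pos x).le)
    (integrableOn_ball_of_continuous D.contDiff_ρ₀.continuous _)]
  have : Function.support D.ρ₀ = univ := by
    ext x; simp [(D.ρ₀_pos x).ne']
  rw [this, univ_inter]
  exact Metric.measure_ball_pos _ _ D.R_pos

theorem totalMass_pos {t : ℝ} (ht : 0 ≤ t) : 0 < D.totalMass t :=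
  totalMass_zero_pos.trans_le (totalMass_mono le_rfl ht)

namespace IsClassicalSolution

variable {T : ℝ} {u : ℝ → Plane → Plane} {ρ p S : ℝ → Plane → ℝ}

/-- The parallel axis theorem, with `c` the centre of mass. -/
theorem sub_phiMinus_eq (h : D.IsClassicalSolution T u ρ p S) {t : ℝ} (ht : t ∈ Ico 0 T)
    {c : Plane} (hc₀ : c 0 = D.P₁ t / D.totalMass t) (hc₁ : c 1 = D.P₂ t / D.totalMass t) :
    D.G ρ t - D.phiMinus t
      = 1 / 2 * ∫ x in Metric.ball (0 : Plane) (D.radius t), ρ t x * ‖x - c‖ ^ 2 := by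
  have hρ := h.continuous_ρ ht
  have hM := totalMass_pos (D := D) ht.1
  have hi : ∀ {f : Plane → ℝ}, Continuous f → IntegrableOn f (Metric.ball 0 (D.radius t)) :=
    fun hf => integrableOn_ball_of_continuous hf _
  have e : ∫ x in Metric.ball (0 : Plane) (D.radius t), ρ t x * ‖x - c‖ ^ 2
      = (∫ x in Metric.ball (0 : Plane) (D.radius t), ‖x‖ ^ 2 * ρ t x)
        + (c 0 ^ 2 + c 1 ^ 2) * (∫ x in Metric.ball (0 : Plane) (D.radius t), ρ t x)
        - 2 * c 0 * (∫ x in Metric.ball (0 : Plane) (D.radius t), ρ t x * x 0)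
        - 2 * c 1 * (∫ x in Metric.ball (0 : Plane) (D.radius t), ρ t x * x 1) := by
    have i1 := hi (f := fun x => ‖x‖ ^ 2 * ρ t x) (by fun_prop)
    have i2 := hi (f := fun x => (c 0 ^ 2 + c 1 ^ 2) * ρ t x) (by fun_prop)
    have i3 := hi (f := fun x => 2 * c 0 * (ρ t x * x 0)) (by fun_prop)
    have i4 := hi (f := fun x => 2 * c 1 * (ρ t x * x 1)) (by fun_prop)
    have e1 := integral_add i1 i2
    have e2 := integral_sub (i1.add i2) i3
    have e3 := integral_sub ((i1.add i2).sub i3) i4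
    simp only [Pi.add_apply, Pi.sub_apply] at e1 e2 e3
    rw [integral_const_mul] at e1 e2 e3
    rw [e2, e1] at e3
    rw [← e3]
    congr 1; ext x
    rw [normSq_sub_plane, normSq_plane]; ring
  obtain ⟨p₁, p₂⟩ := h.massMoment_eq_P ht
  rw [e, h.integral_ρ_ball ht, p₁, p₂, G, momentG, phiMinus, hc₀, hc₁]
  field_simp
  ring

theorem phiPlus_sub_eq (h : D.IsClassicalSolution T u ρ p S) {t : ℝ} (ht : t ∈ Ico 0 T) :
    D.phiPlus t - D.G ρ t
      = 1 / 2 * ∫ x in Metric.ball (0 : Plane) (D.radius t),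
          ρ t x * (D.radius t ^ 2 - ‖x‖ ^ 2) := by
  have hρ := h.continuous_ρ ht
  have i1 := integrableOn_ball_of_continuous (f := fun x => D.radius t ^ 2 * ρ t x) (by fun_prop)
    (D.radius t)
  have i2 := integrableOn_ball_of_continuous (f := fun x => ‖x‖ ^ 2 * ρ t x) (by fun_prop)
    (D.radius t)
  have e := integral_sub i1 i2
  rw [integral_const_mul, h.integral_ρ_ball ht] at e
  have e' : ∫ x in Metric.ball (0 : Plane) (D.radius t), ρ t x * (D.radius t ^ 2 - ‖x‖ ^ 2)
      = ∫ x in Metric.ball (0 : Plane) (D.radius t), (D.radius t ^ 2 * ρ t x - ‖x‖ ^ 2 * ρ t x) := by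
    congr 1; ext x; ring
  rw [e', e, phiPlus, G, momentG]; ring

/-- `ρ ≤ N + ρ²/N` for any `N > 0`, and `ρ² ≤ 1 + ρ^γ` since `γ > 2`. The pressure bounds `ρ^γ`, so
a large `N` makes the integral of the second term small uniformly in time. -/
theorem le_add_pressure (h : D.IsClassicalSolution T u ρ p S) (hγ : 2 < D.γ)
    (hS : ∀ x, D.Sbar ≤ D.S₀ x) {t : ℝ} (ht : t ∈ Ico 0 T) {N : ℝ} (hN : 0 < N) (x : Plane) :
    ρ t x ≤ N + N⁻¹ * (1 + (Real.exp D.Sbar)⁻¹ * p t x) := by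
  have hρ := h.ρ_pos t ht x
  have h1 : ρ t x ^ D.γ ≤ (Real.exp D.Sbar)⁻¹ * p t x := by
    rw [inv_mul_eq_div, le_div_iff₀ (Real.exp_pos _), mul_comm]
    exact h.exp_Sbar_mul_rpow_le hS ht x
  have h2 : ρ t x ^ 2 ≤ 1 + ρ t x ^ D.γ := by
    rcases le_or_gt (ρ t x) 1 with h3 | h3
    · have := Real.rpow_nonneg hρ.le D.γ
      nlinarith
    · have := Real.rpow_le_rpow_of_exponent_le h3.le hγ.le
      rw [Real.rpow_two] at this
      linarith
  have h3 : ρ t x ≤ N + N⁻¹ * ρ t x ^ 2 := by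
    have h4 : N * (N + N⁻¹ * ρ t x ^ 2 - ρ t x) = (N - ρ t x) ^ 2 + N * ρ t x := by
      field_simp; ring
    have h5 : 0 < N * (N + N⁻¹ * ρ t x ^ 2 - ρ t x) := by rw [h4]; positivity
    linarith [(pos_iff_pos_of_mul_pos h5).1 hN]
  have h4 : N⁻¹ * ρ t x ^ 2 ≤ N⁻¹ * (1 + (Real.exp D.Sbar)⁻¹ * p t x) := by
    gcongr; linarith
  linarith

theorem integral_pressure_ball_le (h : D.IsClassicalSolution T u ρ p S) {t : ℝ}
    (ht : t ∈ Ico 0 T) : ∫ x in Metric.ball (0 : Plane) (D.radius t), p t x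
      ≤ (D.γ - 1) * D.e0 + Real.pi * D.radius T ^ 2 * D.pbar := by
  rw [setIntegral_ball_eq (h.continuous_p ht) continuous_const
    (fun x hx => ((h.atRest ht hx).2.2.1 : p t x = D.pbar)),
    integral_ball_const (radius_pos ht.1).le]
  have h1 := h.energy_eq ht
  have h2 := h.kinetic_nonneg ht
  have h3 : 0 < D.γ - 1 := sub_pos.2 D.one_lt_γ
  have h4 : D.excessP p t = (D.γ - 1) * (D.e0 - kinetic ρ u t) := by
    rw [← h1]; field_simp; ring
  have h5 := radius_mono (D := D) ht.2.le
  have h6 := D.radius_pos ht.1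
  have h7 := D.pbar_pos
  have h8 := Real.pi_pos
  have h9 : Real.pi * D.radius t ^ 2 * D.pbar ≤ Real.pi * D.radius T ^ 2 * D.pbar := by gcongr
  have h10 : D.excessP p t ≤ (D.γ - 1) * D.e0 := by rw [h4]; gcongr; linarith
  exact add_le_add h10 h9

/-- The bounds `φ₋ < G < φ₊` hold with a uniform gap, because the energy bound prevents the mass
from concentrating. -/
theorem exists_gap (h : D.IsClassicalSolution T u ρ p S) (hγ : 2 < D.γ)
    (hS : ∀ x, D.Sbar ≤ D.S₀ x) :
    ∃ g, 0 < g ∧ ∀ t ∈ Ico 0 T, D.phiMinus t + g ≤ D.G ρ t ∧ D.G ρ t + g ≤ D.phiPlus t := by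
  have hπ := Real.pi_pos
  have hM := D.totalMass_zero_pos
  have hR := D.R_pos
  -- `K₀` bounds the integral of `1 + e^(-S̄)p` over the disc at every time, and `K` is a positive
  -- majorant. `N` is chosen so that `K/N` is a quarter of the initial mass, and `δ` so that `Nπδ`
  -- is at most another quarter. At least half of the initial mass then has weight at least `δ`, in
  -- the sense that `∫ρw ≥ δM/2`. The bound `δ ≤ R²` serves the annulus estimate.
  set K₀ := Real.pi * D.radius T ^ 2
    + (Real.exp D.Sbar)⁻¹ * ((D.γ - 1) * D.e0 + Real.pi * D.radius T ^ 2 * D.pbar) with hK₀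
  set K := |K₀| + 1 with hK
  have hK0 : 0 < K := by positivity
  set N := 4 * K / D.totalMass 0 with hN
  have hN0 : 0 < N := by positivity
  set δ := min (D.R ^ 2) (D.totalMass 0 / (4 * N * Real.pi)) with hδ
  have hδ0 : 0 < δ := lt_min (by positivity) (by positivity)
  have hpp : ∀ t ∈ Ico 0 T, ∀ x, 0 < p t x := fun t ht x => by
    rw [h.state_eq t ht x]
    exact mul_pos (Real.exp_pos _) (Real.rpow_pos_of_pos (h.ρ_pos t ht x) _)
  have key : ∀ t ∈ Ico 0 T, ∀ w : Plane → ℝ, Continuous w →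
      (∀ x ∈ Metric.ball (0 : Plane) (D.radius t), 0 ≤ w x) →
      volume.real (Metric.ball (0 : Plane) (D.radius t) ∩ {x | w x < δ}) ≤ Real.pi * δ →
      δ * D.totalMass 0 / 4
        ≤ 1 / 2 * ∫ x in Metric.ball (0 : Plane) (D.radius t), ρ t x * w x := by
    intro t ht w hw hw0 hA
    have hp := h.continuous_p ht
    have h1 := integral_ball_le_of_weight (h.continuous_ρ ht) hw
      (k := fun x => N⁻¹ * (1 + (Real.exp D.Sbar)⁻¹ * p t x)) (by fun_prop)
      (fun x => (h.ρ_pos t ht x).le) hw0 (fun x => by have := hpp t ht x; positivity) hδ0 hN0.le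
      (h.le_add_pressure hγ hS ht hN0) hA
    have h2 : ∫ x in Metric.ball (0 : Plane) (D.radius t),
        N⁻¹ * (1 + (Real.exp D.Sbar)⁻¹ * p t x) ≤ D.totalMass 0 / 4 := by
      have e := integral_add
        (integrableOn_ball_of_continuous (continuous_const (y := (1 : ℝ))) (D.radius t))
        (integrableOn_ball_of_continuous (f := fun x => (Real.exp D.Sbar)⁻¹ * p t x)
          (by fun_prop) (D.radius t))
      rw [integral_const_mul, e, integral_ball_const (radius_pos ht.1).le, integral_const_mul]
      have e1 := h.integral_pressure_ball_le ht
      have e2 := radius_mono (D := D) ht.2.le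
      have e3 := D.radius_pos ht.1
      have e4 : Real.pi * D.radius t ^ 2 * 1 + (Real.exp D.Sbar)⁻¹ *
          ∫ x in Metric.ball (0 : Plane) (D.radius t), p t x ≤ K₀ := by
        rw [mul_one, hK₀]; gcongr
      have e5 : K₀ ≤ K := by rw [hK]; linarith [le_abs_self K₀]
      calc _ ≤ N⁻¹ * K := by gcongr; exact e4.trans e5
        _ = _ := by rw [hN]; field_simp
    have h3 : N * (Real.pi * δ) ≤ D.totalMass 0 / 4 := by
      calc N * (Real.pi * δ) ≤ N * (Real.pi * (D.totalMass 0 / (4 * N * Real.pi))) := by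
            gcongr; exact min_le_right _ _
        _ = _ := by field_simp
    rw [h.integral_ρ_ball ht] at h1
    have h4 := totalMass_mono (D := D) le_rfl ht.1
    have h5 : D.totalMass 0 / 2
        ≤ δ⁻¹ * ∫ x in Metric.ball (0 : Plane) (D.radius t), ρ t x * w x := by linarith
    rw [inv_mul_eq_div, le_div_iff₀ hδ0] at h5
    linarith
  refine ⟨δ * D.totalMass 0 / 4, by positivity, fun t ht => ⟨?_, ?_⟩⟩
  · have h1 := key t ht (fun x => ‖x - !₂[D.P₁ t / D.totalMass t, D.P₂ t / D.totalMass t]‖ ^ 2)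
      (by fun_prop) (fun x _ => sq_nonneg _) (volume_inter_normSq_sub_lt _ _ hδ0.le)
    rw [← h.sub_phiMinus_eq ht (by simp) (by simp)] at h1
    linarith
  · have hr := D.radius_pos ht.1
    have h1 := key t ht (fun x => D.radius t ^ 2 - ‖x‖ ^ 2) (by fun_prop)
      (fun x hx => sub_nonneg.2 (pow_le_pow_left₀ (norm_nonneg x)
        (mem_ball_zero_iff.1 hx).le 2))
      (volume_annulus_le hr.le hδ0.le ((min_le_left _ _).trans (by
        have := radius_mono (D := D) ht.1
        rw [radius_zero] at this
        gcongr)))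
    rw [← h.phiPlus_sub_eq ht] at h1
    linarith

end IsClassicalSolution

end CauchyData

/-! ### Twofold integration and comparison with the explicit bounds -/

theorem nonneg_of_second_deriv_nonneg {f f' f'' : ℝ → ℝ} {t : ℝ} (ht : 0 ≤ t)
    (hf : ContinuousOn f (Icc 0 t)) (hf' : ContinuousOn f' (Icc 0 t))
    (hd : ∀ s ∈ Ioo 0 t, HasDerivAt f (f' s) s) (hd' : ∀ s ∈ Ioo 0 t, HasDerivAt f' (f'' s) s)
    (h0 : f 0 = 0) (h0' : f' 0 = 0) (h : ∀ s ∈ Ioo 0 t, 0 ≤ f'' s) : 0 ≤ f t := by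
  have m' : MonotoneOn f' (Icc 0 t) := by
    refine monotoneOn_of_deriv_nonneg (convex_Icc 0 t) hf' ?_ ?_ <;> rw [interior_Icc]
    · exact fun s hs => (hd' s hs).differentiableAt.differentiableWithinAt
    · exact fun s hs => by rw [(hd' s hs).deriv]; exact h s hs
  have m : MonotoneOn f (Icc 0 t) := by
    refine monotoneOn_of_deriv_nonneg (convex_Icc 0 t) hf ?_ ?_ <;> rw [interior_Icc]
    · exact fun s hs => (hd s hs).differentiableAt.differentiableWithinAt
    · intro s hs
      rw [(hd s hs).deriv, ← h0']
      exact m' (left_mem_Icc.2 ht) (Ioo_subset_Icc_self hs) hs.1.le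
  exact h0 ▸ m (left_mem_Icc.2 ht) (right_mem_Icc.2 ht) ht

theorem hasDerivAt_primitive {k : ℝ → ℝ} (hk : Continuous k) (t : ℝ) :
    HasDerivAt (fun t => ∫ s in (0 : ℝ)..t, k s) (k t) t :=
  intervalIntegral.integral_hasDerivAt_right (hk.intervalIntegrable _ _)
    hk.stronglyMeasurable.stronglyMeasurableAtFilter hk.continuousAt

theorem continuous_primitive {k : ℝ → ℝ} (hk : Continuous k) :
    Continuous fun t => ∫ s in (0 : ℝ)..t, k s :=
  continuous_iff_continuousAt.2 fun t => (hasDerivAt_primitive hk t).continuousAt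

theorem hasDerivAt_second_primitive {k : ℝ → ℝ} (hk : Continuous k) (A B C t : ℝ) :
    HasDerivAt (fun t => (∫ τ in (0 : ℝ)..t, ∫ s in (0 : ℝ)..τ, k s) + A / 2 * t ^ 2 + B * t + C)
      ((∫ s in (0 : ℝ)..t, k s) + A * t + B) t := by
  have h1 := hasDerivAt_primitive (continuous_primitive hk) t
  have h2 := (hasDerivAt_pow 2 t).const_mul (A / 2)
  have h3 := (hasDerivAt_id t).const_mul B
  refine (((h1.add h2).add h3).add_const C).congr_deriv ?_
  simp; ring

theorem hasDerivAt_primitive_add_linear {k : ℝ → ℝ} (hk : Continuous k) (A B t : ℝ) :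
    HasDerivAt (fun t => (∫ s in (0 : ℝ)..t, k s) + A * t + B) (k t + A) t := by
  refine (((hasDerivAt_primitive hk t).add
    ((hasDerivAt_id t).const_mul A)).add_const B).congr_deriv (by simp)

namespace CauchyData

variable {D : CauchyData}

theorem continuous_totalMass : Continuous D.totalMass := by
  have := D.continuous_radius
  unfold totalMass; fun_prop

theorem continuous_phiPlus : Continuous D.phiPlus := by
  have := D.continuous_radius
  have := D.continuous_totalMass
  unfold phiPlus; fun_prop

theorem continuous_q : Continuous D.q := by
  have := D.continuous_radius
  unfold q; fun_prop

theorem continuous_q_sub : Continuous fun s => D.q s - D.l ^ 2 * D.phiPlus s :=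
  continuous_q.sub (continuous_const.mul continuous_phiPlus)

theorem continuous_fPlus : Continuous D.fPlus := continuous_iff_continuousAt.2 fun t =>
  (hasDerivAt_second_primitive continuous_q D.A₀ D.dG0 D.G0 t).continuousAt

theorem continuous_fMinus : Continuous D.fMinus := continuous_iff_continuousAt.2 fun t =>
  (hasDerivAt_second_primitive continuous_q_sub D.A₁ D.dG0 D.G0 t).continuousAt

theorem continuousAt_phiMinus {t : ℝ} (ht : 0 ≤ t) : ContinuousAt D.phiMinus t := by
  have := (totalMass_pos (D := D) ht).ne'
  exact (((hasDerivAt_P₁ t).continuousAt.pow 2).add ((hasDerivAt_P₂ t).continuousAt.pow 2)).div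
    (continuousAt_const.mul continuous_totalMass.continuousAt) (by positivity)

namespace IsClassicalSolution

variable {T : ℝ} {u : ℝ → Plane → Plane} {ρ p S : ℝ → Plane → ℝ}

/-- The first derivative of `G` in time. -/
noncomputable def velG (D : CauchyData) (ρ : ℝ → Plane → ℝ) (u : ℝ → Plane → Plane) (t : ℝ) : ℝ :=
  radialMom ρ u t + Real.pi * D.ρbar * D.σ * D.radius t ^ 3

theorem continuousOn_G (h : D.IsClassicalSolution T u ρ p S) : ContinuousOn (D.G ρ) (Ico 0 T) := by
  refine ContinuousOn.congr (f := fun t => D.excessG ρ t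
    + Real.pi * D.ρbar / 4 * D.radius t ^ 4) ?_ fun t ht => h.G_eq ht
  exact h.continuousOn_excessG.add
    (continuousOn_const.mul (D.continuous_radius.continuousOn.pow 4))

theorem hasDerivAt_G (h : D.IsClassicalSolution T u ρ p S) {t : ℝ} (ht : t ∈ Ioo 0 T) :
    HasDerivAt (D.G ρ) (velG D ρ u t) t := by
  have h1 : D.G ρ =ᶠ[𝓝 t] fun t => D.excessG ρ t + Real.pi * D.ρbar / 4 * D.radius t ^ 4 := by
    filter_upwards [Ioo_mem_nhds ht.1 ht.2] with s hs
    exact h.G_eq (Ioo_subset_Ico_self hs)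
  have h2 := (h.hasDerivAt_excessG ht).add
    (((D.hasDerivAt_radius t).pow 4).const_mul (Real.pi * D.ρbar / 4))
  refine (h2.congr_of_eventuallyEq h1).congr_deriv ?_
  simp [velG]; ring

theorem continuousOn_velG (h : D.IsClassicalSolution T u ρ p S) :
    ContinuousOn (velG D ρ u) (Ico 0 T) :=
  h.continuousOn_radialMom.add (continuousOn_const.mul (D.continuous_radius.continuousOn.pow 3))

/-- The closed second-order equation for `G`. In `q`, the term with `σ²` comes from the moving
boundary, and the term with `r⁴ - R⁴` from replacing the excess of `G` by `G` itself. -/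
theorem hasDerivAt_velG (h : D.IsClassicalSolution T u ρ p S) {t : ℝ} (ht : t ∈ Ioo 0 T) :
    HasDerivAt (velG D ρ u) (2 * kinetic ρ u t + 2 * D.excessP p t
      + D.l ^ 2 * D.G0 - D.l * D.F₂0 + D.q t - D.l ^ 2 * D.G ρ t) t := by
  have h1 := (h.hasDerivAt_radialMom ht).add
    (((D.hasDerivAt_radius t).pow 3).const_mul (Real.pi * D.ρbar * D.σ))
  refine h1.congr_deriv ?_
  rw [h.G_eq (Ioo_subset_Ico_self ht), h.excessG_zero, q]
  simp; ring

theorem velG_zero (h : D.IsClassicalSolution T u ρ p S) : velG D ρ u 0 = D.dG0 := by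
  rw [velG, h.radialMom_zero, radius_zero, dG0]

theorem G_zero (h : D.IsClassicalSolution T u ρ p S) : D.G ρ 0 = D.G0 := by
  rw [h.G_eq h.zero_mem, h.excessG_zero, radius_zero]; ring

theorem G_nonneg (h : D.IsClassicalSolution T u ρ p S) {t : ℝ} (ht : t ∈ Ico 0 T) :
    0 ≤ D.G ρ t :=
  mul_nonneg (by norm_num) (integral_nonneg fun x =>
    mul_nonneg (sq_nonneg _) (h.ρ_pos t ht x).le)

theorem G_le_fPlus (h : D.IsClassicalSolution T u ρ p S) (hγ : 2 < D.γ) {t : ℝ}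
    (ht : t ∈ Ico 0 T) : D.G ρ t ≤ D.fPlus t := by
  have hsub : Icc 0 t ⊆ Ico 0 T := fun s hs => ⟨hs.1, hs.2.trans_lt ht.2⟩
  have hmem : ∀ s ∈ Ioo 0 t, s ∈ Ioo 0 T := fun s hs => ⟨hs.1, hs.2.trans ht.2⟩
  refine sub_nonneg.1 (nonneg_of_second_deriv_nonneg (f := fun s => D.fPlus s - D.G ρ s)
    (f' := fun s => ((∫ r in (0 : ℝ)..s, D.q r) + D.A₀ * s + D.dG0) - velG D ρ u s) ht.1
    (continuous_fPlus.continuousOn.sub (h.continuousOn_G.mono hsub)) ?_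
    (fun s hs => (hasDerivAt_second_primitive continuous_q _ _ _ s).sub
      (h.hasDerivAt_G (hmem s hs)))
    (fun s hs => (hasDerivAt_primitive_add_linear continuous_q _ _ s).sub
      (h.hasDerivAt_velG (hmem s hs))) ?_ ?_ fun s hs => ?_)
  · refine ContinuousOn.sub ?_ (h.continuousOn_velG.mono hsub)
    exact fun s _ => (hasDerivAt_primitive_add_linear continuous_q _ _
      s).continuousAt.continuousWithinAt
  · simp [fPlus, h.G_zero]
  · simp [h.velG_zero]
  · have hs' := Ioo_subset_Ico_self (hmem s hs)
    have e1 := h.energy_eq hs'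
    have e2 : 0 ≤ D.l ^ 2 * D.G ρ s := mul_nonneg (sq_nonneg _) (h.G_nonneg hs')
    have e3 : 0 < D.γ - 1 := sub_pos.2 D.one_lt_γ
    have e4 : (D.γ - 1) * D.e0 = (D.γ - 1) * kinetic ρ u s + D.excessP p s := by
      rw [← e1]; field_simp
    -- The kinetic part of `2(γ-1)e(0)` exceeds `2E_k` by `2(γ-2)E_k`.
    have e5 : 0 ≤ (D.γ - 2) * kinetic ρ u s :=
      mul_nonneg (sub_nonneg.2 hγ.le) (h.kinetic_nonneg hs')
    rw [A₀]
    linarith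

theorem fMinus_le_G (h : D.IsClassicalSolution T u ρ p S) (hγ : 2 < D.γ)
    (hS : ∀ x, D.Sbar ≤ D.S₀ x) {t : ℝ} (ht : t ∈ Ico 0 T) : D.fMinus t ≤ D.G ρ t := by
  have hsub : Icc 0 t ⊆ Ico 0 T := fun s hs => ⟨hs.1, hs.2.trans_lt ht.2⟩
  have hmem : ∀ s ∈ Ioo 0 t, s ∈ Ioo 0 T := fun s hs => ⟨hs.1, hs.2.trans ht.2⟩
  obtain ⟨g, hg, hgap⟩ := h.exists_gap hγ hS
  refine sub_nonneg.1 (nonneg_of_second_deriv_nonneg (f := fun s => D.G ρ s - D.fMinus s)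
    (f' := fun s => velG D ρ u s
      - ((∫ r in (0 : ℝ)..s, (D.q r - D.l ^ 2 * D.phiPlus r)) + D.A₁ * s + D.dG0)) ht.1
    ((h.continuousOn_G.mono hsub).sub continuous_fMinus.continuousOn) ?_
    (fun s hs => (h.hasDerivAt_G (hmem s hs)).sub
      (hasDerivAt_second_primitive continuous_q_sub _ _ _ s))
    (fun s hs => (h.hasDerivAt_velG (hmem s hs)).sub
      (hasDerivAt_primitive_add_linear continuous_q_sub _ _ s)) ?_ ?_ fun s hs => ?_)
  · refine ContinuousOn.sub (h.continuousOn_velG.mono hsub) ?_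
    exact fun s _ => (hasDerivAt_primitive_add_linear continuous_q_sub _ _
      s).continuousAt.continuousWithinAt
  · simp [fMinus, h.G_zero]
  · simp [h.velG_zero]
  · have hs' := Ioo_subset_Ico_self (hmem s hs)
    have e1 := h.energy_eq hs'
    have e2 : D.l ^ 2 * D.G ρ s ≤ D.l ^ 2 * D.phiPlus s :=
      mul_le_mul_of_nonneg_left (by linarith [(hgap s hs').2]) (sq_nonneg _)
    have e3 : 0 < D.γ - 1 := sub_pos.2 D.one_lt_γ
    have e4 : 2 * (D.γ - 2) / (D.γ - 1) * D.σ ^ 2 * D.m0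
        ≤ 2 * (D.γ - 2) / (D.γ - 1) * D.excessP p s := by
      rw [mul_assoc]
      exact mul_le_mul_of_nonneg_left (h.excessP_ge hS hs')
        (div_nonneg (by linarith) e3.le)
    -- Splits `2Π` into the part absorbed by `2e(0)` and the remainder bounded below through `m(0)`.
    have e5 : 2 * (D.γ - 2) / (D.γ - 1) * D.excessP p s
        = 2 * D.excessP p s - 2 * (1 / (D.γ - 1) * D.excessP p s) := by field_simp; ring
    rw [A₁]
    linarith

end IsClassicalSolution

end CauchyData

/-! ### Conclusion -/

theorem theorem2 (D : CauchyData) (hγ : 2 < D.γ) (hS : ∀ x : Plane, D.Sbar ≤ D.S₀ x) :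
    (∀ (T : ℝ) (u : ℝ → Plane → Plane) (ρ p S : ℝ → Plane → ℝ),
      D.IsClassicalSolution T u ρ p S →
        ∀ t ∈ Set.Ico 0 T, D.fMinus t ≤ D.G ρ t ∧ D.G ρ t ≤ D.fPlus t) ∧
    (∀ Tstar : ℝ, 0 < Tstar →
      (D.fPlus Tstar = D.phiMinus Tstar ∨ D.fMinus Tstar = D.phiPlus Tstar) →
        ∀ (T : ℝ) (u : ℝ → Plane → Plane) (ρ p S : ℝ → Plane → ℝ),
          D.IsClassicalSolution T u ρ p S → T < Tstar) := by
  refine ⟨fun T u ρ p S h t ht => ⟨h.fMinus_le_G hγ hS ht, h.G_le_fPlus hγ ht⟩,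
    fun Tstar hT hor T u ρ p S h => ?_⟩
  by_contra hcon
  obtain ⟨g, hg, hgap⟩ := h.exists_gap hγ hS
  -- If `T = T_*` the solution is not controlled at `T_*` itself, so the inequalities are passed to
  -- the left limit. The explicit functions are continuous there, and the fixed gap `g` contradicts
  -- equality at `T_*`.
  have hmem : ∀ᶠ t in 𝓝[<] Tstar, t ∈ Ico 0 T := by
    filter_upwards [Ioo_mem_nhdsLT hT] with t ht
    exact ⟨ht.1.le, ht.2.trans_le (not_lt.1 hcon)⟩
  rcases hor with he | he
  · have h1 : D.phiMinus Tstar + g ≤ D.fPlus Tstar :=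
      le_of_tendsto_of_tendsto
        (((CauchyData.continuousAt_phiMinus hT.le).tendsto.mono_left nhdsWithin_le_nhds).add_const g)
        (CauchyData.continuous_fPlus.continuousAt.tendsto.mono_left nhdsWithin_le_nhds)
        (hmem.mono fun t ht => (hgap t ht).1.trans (h.G_le_fPlus hγ ht))
    linarith
  · have h1 : D.fMinus Tstar + g ≤ D.phiPlus Tstar :=
      le_of_tendsto_of_tendsto
        ((CauchyData.continuous_fMinus.continuousAt.tendsto.mono_left
          nhdsWithin_le_nhds).add_const g)
        (CauchyData.continuous_phiPlus.continuousAt.tendsto.mono_left nhdsWithin_le_nhds)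
        (hmem.mono fun t ht => (add_le_add_left (h.fMinus_le_G hγ hS ht) g).trans (hgap t ht).2)
    linarith
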